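/- Let $k$ be a field and let $H$ be a coquasitriangular Hopf algebra over $k$, i.e. a Hopf algebra with a convolution-invertible bilinear form $\mathbf r:H\otimes H\to k$ such that $yx=\mathbf r(x_{(1)},y_{(1)})\,x_{(2)}y_{(2)}\,\mathbf r^{-1}(x_{(3)},y_{(3)})$, $\mathbf r(xy,z)=\mathbf r(x,z_{(1)})\mathbf r(y,z_{(2)})$ and $\mathbf r(x,yz)=\mathbf r(x_{(1)},z)\mathbf r(x_{(2)},y)$ for all $x,y,z\in H$. (The antipode $S_H$ is then bijective.) The category $\mathcal M^H$ of right $H$-comodules is braided by $v\otimes w\mapsto \mathbf r(v_{(1)},w_{(1)})\,w_{(0)}\otimes v_{(0)}$. Let $A$ be a Hopf algebra in the braided category $\mathcal M^H$ with bijective antipode $S_A$, counit $\varepsilon$, comultiplication $a\mapsto a_{[1]}\otimes a_{[2]}$ and coaction $a\mapsto a_{(0)}\otimes a_{(1)}$, and let ${}_\varepsilon k$ be the trivial left $A$-module. Let ${}_A\mathcal M^H$ be the category of left $A$-modules in $\mathcal M^H$. An object of ${}_A\mathcal M^H$ is called finite relative projective if it is isomorphic, in ${}_A\mathcal M^H$,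 to a direct summand of $A\otimes V$ for a comodule $V$ having a left dual in $\mathcal M^H$. An object is of type FP in ${}_A\mathcal M^H$ if it has a finite resolution in ${}_A\mathcal M^H$ by finite relative projective objects. For any resolution $P_*\to{}_\varepsilon k$ in ${}_A\mathcal M^H$ by finite relative projective objects (finite or not), $\operatorname{Hom}_A(P_n,A)$ is an $H$-comodule via $f\mapsto f_{(0)}\otimes f_{(1)}$, where $f_{(0)}(x)\otimes f_{(1)}=f(x_{(0)})_{(0)}\otimes S_H^{-1}(x_{(1)})f(x_{(0)})_{(1)}$ for $x\in P_n$, and this induces an $H$-comodule structure $[f]\mapsto[f_{(0)}]\otimes f_{(1)}$ on $\operatorname{Ext}^n_A({}_\varepsilon k,A)$. Right multiplication in $A$ makes $\operatorname{Ext}^n_A({}_\varepsilon k,A)$ a right $A$-module. Write $A^e=A\otimes A^{\mathrm{op}}$. Assume that ${}_\varepsilon k$, with the trivial coaction, is of type FP in ${}_A\mathcal M^H$, and that there is an integer $n\ge 0$ such that $\operatorname{Ext}^i_A({}_\varepsilon k,A)=0$ for $i\ne n$ and $\operatorname{Ext}^n_A({}_\varepsilon k,A)$ is one-dimensional over $k$.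 Then there are an algebra map $\psi:A\to k$, a group-like element $g\in H$ and an algebra automorphism $\mu$ of $A$ such that: 1. $e\cdot a=\psi(a)e$ for all $e\in\operatorname{Ext}^n_A({}_\varepsilon k,A)$ and $a\in A$, and $\psi(a_{(0)})a_{(1)}=\psi(a)1$ for all $a\in A$; 2. the $H$-comodule structure on $\operatorname{Ext}^n_A({}_\varepsilon k,A)$ is $e\mapsto e\otimes g$, whichever resolution $P_*$ as above is used to compute it; 3. for all $a\in A$, $$\mu(a)=\psi(a_{[1]})\,\mathbf r\big(a_{[2](1)},\,S_H(a_{[2](2)})\,g^{-1}\big)\,S_A^2(a_{[2](0)});$$ 4. $A$ is twisted Calabi–Yau of dimension $n$ with Nakayama automorphism $\mu$: that is, $A$ has a finite resolution by finitely generated projective $A$-bimodules, $\operatorname{Ext}^i_{A^e}(A,A^e)=0$ for $i\neq n$, and $\operatorname{Ext}^n_{A^e}(A,A^e)\simeq A_\mu$ as right $A^e$-modules, where $A_\mu=A$ with $x\cdot(a\otimes b)=b\,x\,\mu(a)$, and the right $A^e$-module structure on $\operatorname{Ext}^n_{A^e}(A,A^e)$ is induced by right multiplication in $A^e$. -/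

import Mathlib

open TensorProduct CategoryTheory
open scoped ModuleCat

universe u

noncomputable section

namespace BraidedHopf

/-! ### Right comodules over a bialgebra `H` -/

section Comodules

variable {k : Type*} [Field k] {H : Type*} [Ring H] [Bialgebra k H]
  {V : Type*} [AddCommGroup V] [Module k V]
  {W : Type*} [AddCommGroup W] [Module k W]

/-- `ρ : V → V ⊗ H` is a (coassociative, counital) right `H`-comodule structure on `V`. -/
structure IsCoaction (ρ : V →ₗ[k] V ⊗[k] H) : Prop where
  coassoc : (TensorProduct.assoc k V H H).toLinearMap ∘ₗ ρ.rTensor H ∘ₗ ρ =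
    (Coalgebra.comul (R := k) (A := H)).lTensor V ∘ₗ ρ
  counit : (TensorProduct.rid k V).toLinearMap ∘ₗ
    (Coalgebra.counit (R := k) (A := H)).lTensor V ∘ₗ ρ = LinearMap.id

/-- The linear map `f : V → W` is `H`-colinear for the coactions `ρV` and `ρW`. -/
def IsColinear (ρV : V →ₗ[k] V ⊗[k] H) (ρW : W →ₗ[k] W ⊗[k] H) (f : V →ₗ[k] W) : Prop :=
  ρW ∘ₗ f = f.rTensor H ∘ₗ ρV

/-- The tensor product of comodules: `v ⊗ w ↦ v₍₀₎ ⊗ w₍₀₎ ⊗ v₍₁₎ w₍₁₎`. -/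
def tensorCoaction (ρV : V →ₗ[k] V ⊗[k] H) (ρW : W →ₗ[k] W ⊗[k] H) :
    V ⊗[k] W →ₗ[k] (V ⊗[k] W) ⊗[k] H :=
  (LinearMap.mul' k H).lTensor (V ⊗[k] W) ∘ₗ
    (TensorProduct.tensorTensorTensorComm k V H W H).toLinearMap ∘ₗ TensorProduct.map ρV ρW

variable (k H V) in
/-- The trivial coaction `v ↦ v ⊗ 1`; on `V = k` this is the unit object of the monoidal category
of right `H`-comodules. -/
def trivialCoaction : V →ₗ[k] V ⊗[k] H :=
  (TensorProduct.mk k V H).flip 1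

/-- The comodule `(V, ρV)` has a left dual in the monoidal category of right `H`-comodules:
there are a comodule `D` and colinear maps `e : D ⊗ V → k`, `δ : k → V ⊗ D` satisfying the two
zigzag identities. -/
def HasLeftDual {k H V : Type u} [Field k] [Ring H] [Bialgebra k H] [AddCommGroup V] [Module k V]
    (ρV : V →ₗ[k] V ⊗[k] H) : Prop :=
  ∃ (D : Type u) (_ : AddCommGroup D) (_ : Module k D) (ρD : D →ₗ[k] D ⊗[k] H)
    (e : D ⊗[k] V →ₗ[k] k) (δ : k →ₗ[k] V ⊗[k] D),
    IsCoaction ρD ∧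
    IsColinear (tensorCoaction ρD ρV) (trivialCoaction k H k) e ∧
    IsColinear (trivialCoaction k H k) (tensorCoaction ρV ρD) δ ∧
    (TensorProduct.rid k V).toLinearMap ∘ₗ e.lTensor V ∘ₗ
      (TensorProduct.assoc k V D V).toLinearMap ∘ₗ δ.rTensor V ∘ₗ
      (TensorProduct.lid k V).symm.toLinearMap = LinearMap.id ∧
    (TensorProduct.lid k D).toLinearMap ∘ₗ e.rTensor D ∘ₗ
      (TensorProduct.assoc k D V D).symm.toLinearMap ∘ₗ δ.lTensor D ∘ₗ
      (TensorProduct.rid k D).symm.toLinearMap = LinearMap.id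

end Comodules

/-! ### Coquasitriangular structures and the braiding -/

/-- A universal `r`-form on a bialgebra `H`. Products of elements of `WithConv` are convolution
products. -/
structure UniversalRForm (k : Type*) (H : Type*) [Field k] [Ring H] [Bialgebra k H] where
  /-- the bilinear form `r` -/
  form : H →ₗ[k] H →ₗ[k] k
  /-- its convolution inverse `r⁻¹` -/
  inv : H →ₗ[k] H →ₗ[k] k
  form_mul_inv :
    WithConv.toConv (TensorProduct.lift form) * WithConv.toConv (TensorProduct.lift inv) = 1
  inv_mul_form :
    WithConv.toConv (TensorProduct.lift inv) * WithConv.toConv (TensorProduct.lift form) = 1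
  /-- `y x = r(x₍₁₎, y₍₁₎) x₍₂₎ y₍₂₎ r⁻¹(x₍₃₎, y₍₃₎)` -/
  mul_comm' :
    WithConv.toConv (LinearMap.mul' k H ∘ₗ (TensorProduct.comm k H H).toLinearMap) =
      WithConv.toConv (Algebra.linearMap k H ∘ₗ TensorProduct.lift form) *
        WithConv.toConv (LinearMap.mul' k H) *
        WithConv.toConv (Algebra.linearMap k H ∘ₗ TensorProduct.lift inv)
  /-- `r(x y, z) = r(x, z₍₁₎) r(y, z₍₂₎)` -/
  mul_left : ∀ x y : H, WithConv.toConv (form (x * y)) =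
    WithConv.toConv (form x) * WithConv.toConv (form y)
  /-- `r(x, y z) = r(x₍₁₎, z) r(x₍₂₎, y)` -/
  mul_right : ∀ y z : H, WithConv.toConv (form.flip (y * z)) =
    WithConv.toConv (form.flip z) * WithConv.toConv (form.flip y)

/-- The braiding `V ⊗ W → W ⊗ V`, `v ⊗ w ↦ r(v₍₁₎, w₍₁₎) w₍₀₎ ⊗ v₍₀₎`. -/
def UniversalRForm.braiding {k H V W : Type*} [Field k] [Ring H] [Bialgebra k H]
    [AddCommGroup V] [Module k V] [AddCommGroup W] [Module k W] (r : UniversalRForm k H)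
    (ρV : V →ₗ[k] V ⊗[k] H) (ρW : W →ₗ[k] W ⊗[k] H) : V ⊗[k] W →ₗ[k] W ⊗[k] V :=
  (TensorProduct.rid k (W ⊗[k] V)).toLinearMap ∘ₗ
    TensorProduct.map (TensorProduct.comm k V W).toLinearMap (TensorProduct.lift r.form) ∘ₗ
    (TensorProduct.tensorTensorTensorComm k V H W H).toLinearMap ∘ₗ TensorProduct.map ρV ρW

/-! ### Hopf algebras in the braided category of comodules -/

/-- For an algebra `A` and `c : A ⊗ A → A ⊗ A`, the multiplication of the braided tensor product
`A ⊗_c A`, namely `(m ⊗ m) ∘ (id ⊗ c ⊗ id)`. -/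
def braidedMul {k A : Type*} [Field k] [Ring A] [Algebra k A] (c : A ⊗[k] A →ₗ[k] A ⊗[k] A) :
    (A ⊗[k] A) ⊗[k] (A ⊗[k] A) →ₗ[k] A ⊗[k] A :=
  TensorProduct.map (LinearMap.mul' k A) (LinearMap.mul' k A) ∘ₗ
    (TensorProduct.assoc k A A (A ⊗[k] A)).symm.toLinearMap ∘ₗ
    ((TensorProduct.assoc k A A A).toLinearMap ∘ₗ c.rTensor A ∘ₗ
      (TensorProduct.assoc k A A A).symm.toLinearMap).lTensor A ∘ₗ
    (TensorProduct.assoc k A A (A ⊗[k] A)).toLinearMap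

/-- A Hopf algebra in the braided category of right `H`-comodules, the braiding being given by the
`r`-form `r`: the algebra and coalgebra `A` carries a coaction for which all structure maps are
colinear, the comultiplication `A → A ⊗_c A` and the counit are multiplicative and unital, and
there is a colinear antipode. -/
structure BraidedHopfAlgebra {k H : Type*} [Field k] [Ring H] [HopfAlgebra k H]
    (r : UniversalRForm k H) (A : Type*) [Ring A] [Algebra k A] [Coalgebra k A] where
  /-- the `H`-coaction on `A` -/
  coact : A →ₗ[k] A ⊗[k] H
  /-- the antipode of `A` -/
  antipode : A →ₗ[k] A
  isCoaction : IsCoaction coact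
  mul_colinear : IsColinear (tensorCoaction coact coact) coact (LinearMap.mul' k A)
  one_colinear : IsColinear (trivialCoaction k H k) coact (Algebra.linearMap k A)
  comul_colinear : IsColinear coact (tensorCoaction coact coact) (Coalgebra.comul (R := k))
  counit_colinear : IsColinear coact (trivialCoaction k H k) (Coalgebra.counit (R := k))
  antipode_colinear : IsColinear coact coact antipode
  comul_mul : Coalgebra.comul (R := k) ∘ₗ LinearMap.mul' k A =
    braidedMul (r.braiding coact coact) ∘ₗ
      TensorProduct.map (Coalgebra.comul (R := k)) (Coalgebra.comul (R := k))
  comul_one : Coalgebra.comul (R := k) (1 : A) = 1 ⊗ₜ[k] 1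
  counit_mul : ∀ a b : A, Coalgebra.counit (R := k) (a * b) =
    Coalgebra.counit (R := k) a * Coalgebra.counit (R := k) b
  counit_one : Coalgebra.counit (R := k) (1 : A) = 1
  antipode_mul_id : LinearMap.mul' k A ∘ₗ antipode.rTensor A ∘ₗ Coalgebra.comul (R := k) =
    Algebra.linearMap k A ∘ₗ Coalgebra.counit (R := k)
  id_mul_antipode : LinearMap.mul' k A ∘ₗ antipode.lTensor A ∘ₗ Coalgebra.comul (R := k) =
    Algebra.linearMap k A ∘ₗ Coalgebra.counit (R := k)

variable {k H A : Type u} [Field k] [Ring H] [HopfAlgebra k H] {r : UniversalRForm k H}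
  [Ring A] [Algebra k A] [Coalgebra k A]

/-- The counit of `A` as a ring homomorphism. -/
def BraidedHopfAlgebra.counitRingHom (B : BraidedHopfAlgebra r A) : A →+* k where
  toFun := Coalgebra.counit (R := k)
  map_one' := B.counit_one
  map_mul' := B.counit_mul
  map_zero' := map_zero _
  map_add' := map_add _

/-- The trivial left `A`-module `_εk`. -/
def BraidedHopfAlgebra.trivialModule (B : BraidedHopfAlgebra r A) : ModuleCat.{u} A :=
  (ModuleCat.restrictScalars B.counitRingHom).obj (ModuleCat.of k k)

/-! ### Modules over `A` in the category of comodules, and finiteness conditions -/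

section HopfModules

variable (B : BraidedHopfAlgebra r A)
  {M : Type u} [AddCommGroup M] [Module k M] [Module A M] [IsScalarTower k A M]

/-- The left `A`-module `M` with the coaction `ρ` is an object of `_A M^H`: `ρ` is a comodule
structure and the action `A ⊗ M → M` is colinear. -/
structure IsHopfModule (ρ : M →ₗ[k] M ⊗[k] H) : Prop where
  isCoaction : IsCoaction ρ
  smul_colinear : IsColinear (tensorCoaction B.coact ρ) ρ
    (TensorProduct.lift (Algebra.lsmul k k M).toLinearMap)

/-- The object `(M, ρ)` of `_A M^H` is finite relative projective: it is, in `_A M^H`, a direct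
summand (retract) of a free module `A ⊗ V`, with `V` a comodule having a left dual. -/
def IsFiniteRelativeProjective (ρ : M →ₗ[k] M ⊗[k] H) : Prop :=
  ∃ (V : Type u) (_ : AddCommGroup V) (_ : Module k V) (ρV : V →ₗ[k] V ⊗[k] H)
    (i : M →ₗ[A] A ⊗[k] V) (p : A ⊗[k] V →ₗ[A] M),
    IsCoaction ρV ∧ HasLeftDual ρV ∧
    IsColinear ρ (tensorCoaction B.coact ρV) (i.restrictScalars k) ∧
    IsColinear (tensorCoaction B.coact ρV) ρ (p.restrictScalars k) ∧
    p ∘ₗ i = LinearMap.id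

theorem IsFiniteRelativeProjective.projective {B : BraidedHopfAlgebra r A}
    {ρ : M →ₗ[k] M ⊗[k] H} (h : IsFiniteRelativeProjective B ρ) : Module.Projective A M := by
  obtain ⟨V, _, _, ρV, i, p, -, -, -, -, hip⟩ := h
  exact Module.Projective.of_split i p hip

end HopfModules

/-- A resolution `⋯ → P₁ → P₀ → M → 0` in `_A M^H` of the `A`-module `M` with coaction `ρM`, by
finite relative projective objects. -/
structure FiniteRelativeProjectiveResolution (B : BraidedHopfAlgebra r A) (M : ModuleCat.{u} A)
    (ρM : M →ₗ[k] M ⊗[k] H) where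
  /-- the underlying complex of `A`-modules -/
  complex : ChainComplex (ModuleCat.{u} A) ℕ
  /-- the coactions -/
  coact : ∀ i, complex.X i →ₗ[k] complex.X i ⊗[k] H
  isHopfModule : ∀ i, IsHopfModule B (coact i)
  finiteRelativeProjective : ∀ i, IsFiniteRelativeProjective B (coact i)
  d_colinear : ∀ i j, IsColinear (coact i) (coact j) ((complex.d i j).hom.restrictScalars k)
  /-- the augmentation -/
  aug : complex.X 0 ⟶ M
  d_comp_aug : complex.d 1 0 ≫ aug = 0
  aug_colinear : IsColinear (coact 0) ρM (aug.hom.restrictScalars k)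
  /-- the augmented complex is exact -/
  quasiIso : QuasiIso ((ChainComplex.toSingle₀Equiv complex M).symm ⟨aug, d_comp_aug⟩)

/-- The complex `C` has finite length. -/
def IsBoundedComplex {R : Type u} [Ring R] (C : ChainComplex (ModuleCat.{u} R) ℕ) : Prop :=
  ∃ N : ℕ, ∀ i, N < i → Limits.IsZero (C.X i)

/-- `_εk`, with the trivial coaction, is of type FP in `_A M^H`: it has a finite resolution by
finite relative projective objects. -/
def TrivialModuleIsTypeFP (B : BraidedHopfAlgebra r A) : Prop :=
  ∃ P : FiniteRelativeProjectiveResolution B B.trivialModule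
    (trivialCoaction k H B.trivialModule), IsBoundedComplex P.complex

/-- Forgetting the coactions gives a projective resolution of `A`-modules. -/
def FiniteRelativeProjectiveResolution.toProjectiveResolution {B : BraidedHopfAlgebra r A}
    {M : ModuleCat.{u} A} {ρM : M →ₗ[k] M ⊗[k] H}
    (P : FiniteRelativeProjectiveResolution B M ρM) : ProjectiveResolution M where
  complex := P.complex
  projective i := by
    have := (P.finiteRelativeProjective i).projective
    exact (IsProjective.iff_projective (P.complex.X i)).1 this
  π := (ChainComplex.toSingle₀Equiv P.complex M).symm ⟨P.aug, P.d_comp_aug⟩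
  quasiIso := P.quasiIso

/-! ### The right module and comodule structures on `Ext_A^n(M, A)` -/

/-- The right `R`-module structure on `Ext_R^i(M, R)` induced by right multiplication in `R`. -/
def extRightMul {R : Type u} [Ring R] {M : ModuleCat.{u} R} {i : ℕ}
    (e : Abelian.Ext M (ModuleCat.of R R) i) (x : R) : Abelian.Ext M (ModuleCat.of R R) i :=
  e.comp (Abelian.Ext.mk₀ (ModuleCat.ofHom (LinearMap.toSpanSingleton R R x))) (add_zero i)

namespace FiniteRelativeProjectiveResolution

variable {B : BraidedHopfAlgebra r A} {M : ModuleCat.{u} A} {ρM : M →ₗ[k] M ⊗[k] H}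
  (P : FiniteRelativeProjectiveResolution B M ρM)

/-- The `n`-cocycles of the complex `Hom_A(P, A)`. -/
def cocycles (n : ℕ) : Submodule k (P.complex.X n →ₗ[A] A) where
  carrier := {f | f ∘ₗ (P.complex.d (n + 1) n).hom = 0}
  add_mem' {f g} hf hg := by
    change (f + g) ∘ₗ _ = 0
    rw [LinearMap.add_comp, hf, hg, add_zero]
  zero_mem' := LinearMap.zero_comp _
  smul_mem' c f hf := by
    change (c • f) ∘ₗ _ = 0
    rw [LinearMap.smul_comp, hf, smul_zero]

/-- The class `[f]` in `Ext_A^n(M, A)` of an `n`-cocycle `f : P_n → A`. -/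
def extClass (n : ℕ) : P.cocycles n →ₗ[k] Abelian.Ext M (ModuleCat.of A A) n where
  toFun f := P.toProjectiveResolution.extMk (ModuleCat.ofHom f.1) (n + 1) rfl
    (ModuleCat.hom_ext f.2)
  map_add' f g := by
    rw [ProjectiveResolution.add_extMk]
    rfl
  map_smul' c f := by
    rw [RingHom.id_apply, Abelian.Ext.smul_eq_comp_mk₀, ProjectiveResolution.extMk_comp_mk₀]
    congr 1
    ext x
    exact Algebra.smul_def c (f.1 x)

/-- For `f ∈ Hom_A(P_n, A)`, the map
`x ↦ f(x₍₀₎)₍₀₎ ⊗ S_H⁻¹(x₍₁₎) f(x₍₀₎)₍₁₎` from `P_n` to `A ⊗ H`. Here `S_H⁻¹` is the inverse of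
`S_H` in the ring of linear endomorphisms of `H`; the antipode of a coquasitriangular Hopf algebra
is bijective. -/
def homCoactionAux (n : ℕ) (f : P.complex.X n →ₗ[A] A) : P.complex.X n →ₗ[k] A ⊗[k] H :=
  (LinearMap.mul' k H ∘ₗ (TensorProduct.comm k H H).toLinearMap ∘ₗ
      (Ring.inverse (HopfAlgebra.antipode k : Module.End k H)).lTensor H).lTensor A ∘ₗ
    (TensorProduct.assoc k A H H).toLinearMap ∘ₗ
    (B.coact ∘ₗ f.restrictScalars k).rTensor H ∘ₗ P.coact n

/-- `δ` is the `H`-coaction on `Ext_A^n(M, A)` induced by the coaction `f ↦ f₍₀₎ ⊗ f₍₁₎` on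
`Hom_A(P_n, A)` which is determined by
`f₍₀₎(x) ⊗ f₍₁₎ = f(x₍₀₎)₍₀₎ ⊗ S_H⁻¹(x₍₁₎) f(x₍₀₎)₍₁₎` for `x ∈ P_n`: that is,
`δ [f] = [f₍₀₎] ⊗ f₍₁₎` for every cocycle `f`. -/
def IsExtCoaction (n : ℕ) (δ : Abelian.Ext M (ModuleCat.of A A) n →ₗ[k]
    Abelian.Ext M (ModuleCat.of A A) n ⊗[k] H) : Prop :=
  ∀ f : P.cocycles n, ∃ w : P.cocycles n ⊗[k] H,
    (∀ x : P.complex.X n,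
      ((LinearMap.applyₗ' k x ∘ₗ (P.cocycles n).subtype).rTensor H) w =
        P.homCoactionAux n f x) ∧
    δ (P.extClass n f) = (P.extClass n).rTensor H w

end FiniteRelativeProjectiveResolution

/-! ### Smooth and twisted Calabi–Yau algebras -/

section CalabiYau

variable (k A : Type u) [Field k] [Ring A] [Algebra k A]

/-- `A` as a left module over `A^e = A ⊗ A^op`, via `(a ⊗ b) • x = a x b`. -/
def regularBimodule : ModuleCat.{u} (A ⊗[k] Aᵐᵒᵖ) :=
  letI : Module (A ⊗[k] Aᵐᵒᵖ) A := instModuleTensorProductMop k A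
  ModuleCat.of (A ⊗[k] Aᵐᵒᵖ) A

/-- `A` is smooth: it has a finite resolution by finitely generated projective `A`-bimodules. -/
def IsSmoothAlgebra : Prop :=
  ∃ P : ProjectiveResolution (regularBimodule k A), IsBoundedComplex P.complex ∧
    ∀ i, Module.Finite (A ⊗[k] Aᵐᵒᵖ) (P.complex.X i)

/-- The Hochschild cohomology `H^i(A, A ⊗ A) = Ext_{A^e}^i(A, A^e)`; it is a right `A^e`-module by
`extRightMul`. -/
abbrev HochschildRegular (i : ℕ) : Type u :=
  Abelian.Ext (regularBimodule k A) (ModuleCat.of (A ⊗[k] Aᵐᵒᵖ) (A ⊗[k] Aᵐᵒᵖ)) i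

variable {k A} in
/-- `A` is twisted Calabi–Yau of dimension `n` with Nakayama automorphism `μ`: it is smooth,
`H^i(A, A ⊗ A) = 0` for `i ≠ n`, and `H^n(A, A ⊗ A) ≃ A_μ` as bimodules, i.e. as right
`A^e`-modules, where `a ⊗ b` acts on `A_μ` by `x ↦ b x μ(a)`. -/
structure IsTwistedCalabiYau (n : ℕ) (μ : A ≃ₐ[k] A) : Prop where
  smooth : IsSmoothAlgebra k A
  vanishing : ∀ i, i ≠ n → Subsingleton (HochschildRegular k A i)
  nakayama : ∃ Φ : HochschildRegular k A n ≃ₗ[k] A, ∀ (e : HochschildRegular k A n) (a b : A),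
    Φ (extRightMul e (a ⊗ₜ[k] MulOpposite.op b)) = b * Φ e * μ a

end CalabiYau

/-- The linear endomorphism
`a ↦ ψ(a_[1]) r(a_[2]₍₁₎, S_H(a_[2]₍₂₎) g⁻¹) S_A²(a_[2]₍₀₎)` of `A`. -/
def nakayamaMap (B : BraidedHopfAlgebra r A) (ψ : A →ₐ[k] k) (g : Hˣ) : A →ₗ[k] A :=
  (TensorProduct.lid k A).toLinearMap ∘ₗ
    TensorProduct.map ψ.toLinearMap
      ((B.antipode ∘ₗ B.antipode) ∘ₗ (TensorProduct.rid k A).toLinearMap ∘ₗ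
        (TensorProduct.lift r.form ∘ₗ
          (LinearMap.mulRight k ((g⁻¹ : Hˣ) : H) ∘ₗ HopfAlgebra.antipode k).lTensor H ∘ₗ
          Coalgebra.comul (R := k)).lTensor A ∘ₗ
        B.coact) ∘ₗ
    Coalgebra.comul (R := k)

end BraidedHopf

end

open BraidedHopf

-- Notation: T_h(v) = r(v₁, h) v₀ is `opAct`, η_h(v) = r(h, v₁) v₀ is `homAct`, and κ(f) = f₀ ⊗ f₁
-- is the coaction `homCoact` on homomorphisms.
--
-- Smoothness comes from an induction functor. A Hopf module M gives the A-bimodule `Box` M = M ⊗ A,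
-- on which A acts from the left through its braided comultiplication. The functor is exact because
-- k is a field, it sends A ⊗ V to the free bimodule on V (`boxFreeEquiv`) and the trivial module to
-- A (`boxTrivialModuleEquiv`). Hence a finite resolution P of the trivial module becomes a finite
-- resolution of A by finitely generated projective bimodules.
--
-- For the cohomology, a bimodule map M ⊗ A → A^e is determined by its values φ(x) on x ⊗ 1, subject
-- to the twisted linearity φ(a x) = a₁ φ(η(x)) S(a₂). The operators `hatNu` built from S_A and from
-- S_A² are mutually inverse (`hatNu_hatNu`) and exchange twisted linear maps with A-linear maps M →
-- A ⊗ A. The resulting bijection `boxDual` is natural in colinear maps, so Ext_{A^e}(A, A^e) is the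
-- cohomology of Hom_A(P, A ⊗ A). As each P_i is finitely generated, this is Ext_A(k, A) ⊗ A: it
-- vanishes outside degree n, and in degree n each class is f₀ ⊗ ξ for a unique ξ in A, where f₀ is
-- a cocycle generating Ext_A^n(k, A).
--
-- The data ψ and g also come from f₀. Right multiplication gives f₀ a ~ ψ(a) f₀, and κ(f₀) ~ f₀ ⊗
-- g. Counit and coassociativity of κ make g group-like; applying κ to f₀ a in two ways makes ψ
-- colinear. A comparison map between two resolutions need not be colinear, but it is so up to
-- homotopy (`homCoact_chainMap_homotopic`), hence g does not depend on the resolution.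
--
-- The right A^e-action is read off on the classes f₀ ⊗ ξ. The element 1 ⊗ b sends ξ to b ξ
-- (`boxDual_tensorRight`). The element a ⊗ 1 is moved through `boxDual` at the price of replacing
-- f₀ by κ(f₀) (`boxDual_nuMul`); inserting g and ψ sends ξ = 1 to the stated formula for μ(a)
-- (`sw_nu_character`). Multiplicativity of μ then follows from the module axioms. Its bijectivity
-- follows from a factorization into invertible maps, one of which is the action of the functional
-- θ(h) = r(h₁, S h₂). The same θ implements S_H² and shows that S_H is bijective.

noncomputable section

namespace BraidedHopf

-- Linearity of functions as a side condition for `fun_prop`.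

section Linearity

variable (k : Type*) [CommSemiring k]
  {U V W X : Type*} [AddCommMonoid U] [Module k U] [AddCommMonoid V] [Module k V]
  [AddCommMonoid W] [Module k W] [AddCommMonoid X] [Module k X]

/-- `k`-linearity of a function, in a form suited to `fun_prop`. -/
@[fun_prop]
def Lin (f : V → W) : Prop := IsLinearMap k f

variable {k}

@[fun_prop] theorem Lin.id : Lin k (fun x : V => x) := ⟨fun _ _ => rfl, fun _ _ => rfl⟩
theorem Lin.add' {f : V → W} (hf : Lin k f) (x y : V) : f (x + y) = f x + f y := hf.map_add x y
theorem Lin.smul' {f : V → W} (hf : Lin k f) (c : k) (x : V) : f (c • x) = c • f x :=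
  hf.map_smul c x
theorem Lin.zero' {f : V → W} (hf : Lin k f) : f 0 = 0 := hf.map_zero

@[fun_prop] theorem Lin.comp {g : W → X} {f : V → W} (hg : Lin k g) (hf : Lin k f) :
    Lin k (fun x => g (f x)) :=
  ⟨fun x y => by rw [hf.add', hg.add'], fun c x => by rw [hf.smul', hg.smul']⟩
@[fun_prop] theorem Lin.coe (L : V →ₗ[k] W) : Lin k (fun x => L x) := ⟨L.map_add, L.map_smul⟩
@[fun_prop] theorem Lin.coe_equiv (L : V ≃ₗ[k] W) : Lin k (fun x => L x) :=
  ⟨L.map_add, L.map_smul⟩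
@[fun_prop] theorem Lin.apply {f : V → W →ₗ[k] X} (hf : Lin k f) (w : W) :
    Lin k (fun x => f x w) :=
  ⟨fun x y => by rw [hf.add', LinearMap.add_apply],
    fun c x => by rw [hf.smul', LinearMap.smul_apply]⟩
@[fun_prop] theorem Lin.sum {ι : Type*} (s : Finset ι) {f : ι → V → W} (hf : ∀ i, Lin k (f i)) :
    Lin k (fun x => ∑ i ∈ s, f i x) :=
  ⟨fun x y => by
    rw [← Finset.sum_add_distrib]; exact Finset.sum_congr rfl fun i _ => (hf i).add' x y,
   fun c x => by rw [Finset.smul_sum]; exact Finset.sum_congr rfl fun i _ => (hf i).smul' c x⟩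
@[fun_prop] theorem Lin.tmul_left {f : V → W} (hf : Lin k f) (y : X) :
    Lin k (fun x => f x ⊗ₜ[k] y) :=
  ⟨fun x y => by rw [hf.add', add_tmul], fun c x => by rw [hf.smul', smul_tmul']⟩
@[fun_prop] theorem Lin.tmul_right {f : V → W} (hf : Lin k f) (y : X) :
    Lin k (fun x => y ⊗ₜ[k] f x) :=
  ⟨fun x y => by rw [hf.add', tmul_add], fun c x => by rw [hf.smul', tmul_smul]⟩
@[fun_prop] theorem Lin.mul_left {R : Type*} [Semiring R] [Algebra k R] {f : V → R}
    (hf : Lin k f) (y : R) : Lin k (fun x => f x * y) :=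
  ⟨fun x y => by rw [hf.add', add_mul], fun c x => by rw [hf.smul', smul_mul_assoc]⟩
@[fun_prop] theorem Lin.mul_right {R : Type*} [Semiring R] [Algebra k R] {f : V → R}
    (hf : Lin k f) (y : R) : Lin k (fun x => y * f x) :=
  ⟨fun x y => by rw [hf.add', mul_add], fun c x => by rw [hf.smul', mul_smul_comm]⟩
/-- The linear map underlying a function satisfying `Lin`. -/
def Lin.toLin {f : V → W} (hf : Lin k f) : V →ₗ[k] W := IsLinearMap.mk' f hf
@[simp] theorem Lin.toLin_apply {f : V → W} (hf : Lin k f) (x : V) : hf.toLin x = f x := rfl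

end Linearity

section Structure
variable {k : Type*} [CommSemiring k] {V C : Type*} [AddCommMonoid V] [Module k V]
@[fun_prop] theorem Lin.comul [AddCommMonoid C] [Module k C] [Coalgebra k C] {f : V → C}
    (hf : Lin k f) : Lin k (fun x => Coalgebra.comul (R := k) (f x)) := (Lin.coe _).comp hf
@[fun_prop] theorem Lin.counit [AddCommMonoid C] [Module k C] [Coalgebra k C] {f : V → C}
    (hf : Lin k f) : Lin k (fun x => Coalgebra.counit (R := k) (f x)) := (Lin.coe _).comp hf
@[fun_prop] theorem Lin.antipode [Semiring C] [HopfAlgebra k C] {f : V → C}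
    (hf : Lin k f) : Lin k (fun x => HopfAlgebra.antipode k (f x)) := (Lin.coe _).comp hf
end Structure

section ModuleAction
variable {k : Type*} [CommSemiring k] {R V M : Type*} [Semiring R] [Algebra k R]
  [AddCommMonoid V] [Module k V] [AddCommMonoid M] [Module k M] [Module R M] [IsScalarTower k R M]
@[fun_prop] theorem Lin.act_left {f : V → R} (hf : Lin k f) (m : M) :
    Lin k (fun x => f x • m) :=
  ⟨fun x y => by rw [hf.add', add_smul], fun c x => by rw [hf.smul', smul_assoc]⟩
@[fun_prop] theorem Lin.act_right {f : V → M} (hf : Lin k f) (a : R) :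
    Lin k (fun x => a • f x) :=
  ⟨fun x y => by rw [hf.add', smul_add], fun c x => by
    rw [hf.smul']; exact smul_algebra_smul_comm c a (f x)⟩
end ModuleAction

-- Sweedler notation as finite sums.

section Sweedler
variable {k : Type*} [CommSemiring k]
  {U V W X Y : Type*} [AddCommMonoid U] [Module k U] [AddCommMonoid V] [Module k V]
  [AddCommMonoid W] [Module k W] [AddCommMonoid X] [Module k X] [AddCommMonoid Y] [Module k Y]

/-- `sw t B = ∑ B xᵢ yᵢ` for a chosen expression `t = ∑ xᵢ ⊗ yᵢ`. When `B` is bilinear the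
value does not depend on the choice. -/
def sw (t : V ⊗[k] W) (B : V → W → U) : U :=
  ∑ p ∈ (TensorProduct.exists_finset t).choose, B p.1 p.2

theorem sw_self (t : V ⊗[k] W) : sw t (fun x y => x ⊗ₜ[k] y) = t :=
  (TensorProduct.exists_finset t).choose_spec.symm

omit [Module k U] in
theorem sw_congr {t : V ⊗[k] W} {B B' : V → W → U} (h : ∀ x y, B x y = B' x y) :
    sw t B = sw t B' := Finset.sum_congr rfl fun p _ => h p.1 p.2

-- Each `sw` is a finite sum over a set depending only on its tensor, so exchanging two of them
-- needs no linearity of `B`. Rules that change the tensor itself need multilinearity, since another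
-- representative is then chosen.
omit [Module k U] in
theorem sw_comm (s : V ⊗[k] W) (t : X ⊗[k] Y) (B : V → W → X → Y → U) :
    sw s (fun a b => sw t fun c d => B a b c d) = sw t fun c d => sw s fun a b => B a b c d :=
  Finset.sum_comm

theorem map_sw {f : U → X} (hf : Lin k f) (t : V ⊗[k] W) (B : V → W → U) :
    f (sw t B) = sw t fun x y => f (B x y) :=
  map_sum hf.toLin _ _

/-- The bilinear map attached to a bilinear function. -/
def bilin {B : V → W → U} (h₁ : ∀ y, Lin k fun x => B x y) (h₂ : ∀ x, Lin k fun y => B x y) :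
    V →ₗ[k] W →ₗ[k] U :=
  LinearMap.mk₂ k B (fun _ _ y => (h₁ y).add' _ _) (fun _ _ y => (h₁ y).smul' _ _)
    (fun x _ _ => (h₂ x).add' _ _) (fun _ x _ => (h₂ x).smul' _ _)

theorem sw_eq_lift {B : V → W → U} (h₁ : ∀ y, Lin k fun x => B x y)
    (h₂ : ∀ x, Lin k fun y => B x y) (t : V ⊗[k] W) : sw t B = lift (bilin h₁ h₂) t := by
  conv_rhs => rw [← sw_self t]
  unfold sw
  rw [map_sum]
  rfl

theorem sw_bilin (B : V →ₗ[k] W →ₗ[k] U) (t : V ⊗[k] W) :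
    sw t (fun x y => B x y) = lift B t := by
  rw [sw_eq_lift (by fun_prop) (by fun_prop)]; rfl

theorem sw_tmul {B : V → W → U} (h₁ : ∀ y, Lin k fun x => B x y)
    (h₂ : ∀ x, Lin k fun y => B x y) (x : V) (y : W) : sw (x ⊗ₜ[k] y) B = B x y := by
  rw [sw_eq_lift h₁ h₂]; rfl

@[fun_prop] theorem Lin.sw_left {f : X → V ⊗[k] W} (hf : Lin k f) {B : V → W → U}
    (h₁ : ∀ y, Lin k fun x => B x y) (h₂ : ∀ x, Lin k fun y => B x y) :
    Lin k fun x => sw (f x) B := by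
  simp_rw [sw_eq_lift h₁ h₂]; fun_prop

@[fun_prop] theorem Lin.sw_right (t : V ⊗[k] W) {B : X → V → W → U}
    (h : ∀ x y, Lin k fun z => B z x y) :
    Lin k fun z => sw t (B z) := by
  unfold sw; fun_prop

/-- A linear image of a tensor can be computed on any representation. -/
theorem sw_map {f : X ⊗[k] Y →ₗ[k] V ⊗[k] W} {t : X ⊗[k] Y} {B : V → W → U}
    (h₁ : ∀ y, Lin k fun x => B x y) (h₂ : ∀ x, Lin k fun y => B x y) :
    sw (f t) B = sw t fun x y => sw (f (x ⊗ₜ y)) B := by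
  conv_lhs => rw [← sw_self t]
  exact map_sw (f := fun t => sw (f t) B) (by fun_prop) _ _

theorem sw_sw {t : X ⊗[k] Y} {C : X → Y → V ⊗[k] W} {B : V → W → U}
    (h₁ : ∀ y, Lin k fun x => B x y) (h₂ : ∀ x, Lin k fun y => B x y) :
    sw (sw t C) B = sw t fun x y => sw (C x y) B :=
  map_sw (f := fun t => sw t B) (by fun_prop) _ _

theorem sw_smul (c : k) (t : V ⊗[k] W) (B : V → W → U) :
    c • sw t B = sw t fun x y => c • B x y := Finset.smul_sum
theorem sw_mul {R : Type*} [Semiring R] (t : V ⊗[k] W) (B : V → W → R) (a : R) :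
    sw t B * a = sw t fun x y => B x y * a := Finset.sum_mul _ _ _
theorem mul_sw {R : Type*} [Semiring R] (t : V ⊗[k] W) (B : V → W → R) (a : R) :
    a * sw t B = sw t fun x y => a * B x y := Finset.mul_sum _ _ _
theorem sw_smul_left {R M : Type*} [Semiring R] [AddCommMonoid M] [Module R M] (t : V ⊗[k] W)
    (B : V → W → R) (m : M) : sw t B • m = sw t fun x y => B x y • m := Finset.sum_smul
theorem smul_sw {R M : Type*} [Semiring R] [AddCommMonoid M] [Module R M] (t : V ⊗[k] W)
    (B : V → W → M) (a : R) : a • sw t B = sw t fun x y => a • B x y := Finset.smul_sum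
theorem sw_tmul_right (t : V ⊗[k] W) (B : V → W → X) (y : Y) :
    sw t B ⊗ₜ[k] y = sw t fun a b => B a b ⊗ₜ[k] y := sum_tmul _ _ _
theorem tmul_sw (t : V ⊗[k] W) (B : V → W → X) (y : Y) :
    y ⊗ₜ[k] sw t B = sw t fun a b => y ⊗ₜ[k] B a b := tmul_sum _ _ _
theorem map_sw' (f : U →ₗ[k] X) (t : V ⊗[k] W) (B : V → W → U) :
    f (sw t B) = sw t fun x y => f (B x y) := map_sum f _ _

end Sweedler

end BraidedHopf

namespace BraidedHopf

-- Sweedler sums over images under the canonical maps of tensor products.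

section SweedlerTensor
variable {k : Type*} [CommSemiring k]
  {U V W X Y : Type*} [AddCommMonoid U] [Module k U] [AddCommMonoid V] [Module k V]
  [AddCommMonoid W] [Module k W] [AddCommMonoid X] [Module k X] [AddCommMonoid Y] [Module k Y]

theorem sw_lTensor (f : W →ₗ[k] X) {B : V → X → U} (h₁ : ∀ y, Lin k fun x => B x y)
    (h₂ : ∀ x, Lin k fun y => B x y) (t : V ⊗[k] W) :
    sw (f.lTensor V t) B = sw t fun x y => B x (f y) := by
  rw [sw_map h₁ h₂]
  exact sw_congr fun x y => sw_tmul h₁ h₂ _ _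

theorem sw_rTensor (f : V →ₗ[k] X) {B : X → W → U} (h₁ : ∀ y, Lin k fun x => B x y)
    (h₂ : ∀ x, Lin k fun y => B x y) (t : V ⊗[k] W) :
    sw (f.rTensor W t) B = sw t fun x y => B (f x) y := by
  rw [sw_map h₁ h₂]
  exact sw_congr fun x y => sw_tmul h₁ h₂ _ _

theorem sw_mapMap (f : V →ₗ[k] X) (g : W →ₗ[k] Y) {B : X → Y → U}
    (h₁ : ∀ y, Lin k fun x => B x y) (h₂ : ∀ x, Lin k fun y => B x y) (t : V ⊗[k] W) :
    sw (TensorProduct.map f g t) B = sw t fun x y => B (f x) (g y) := by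
  rw [sw_map h₁ h₂]
  exact sw_congr fun x y => sw_tmul h₁ h₂ _ _

theorem sw_swap {B : W → V → U} (h₁ : ∀ y, Lin k fun x => B x y)
    (h₂ : ∀ x, Lin k fun y => B x y) (t : V ⊗[k] W) :
    sw (TensorProduct.comm k V W t) B = sw t fun x y => B y x := by
  refine (sw_map (f := (TensorProduct.comm k V W).toLinearMap) h₁ h₂).trans ?_
  exact sw_congr fun x y => sw_tmul h₁ h₂ _ _

theorem sw_assoc {B : V → W → X → U} (h₁ : ∀ y z, Lin k fun x => B x y z)
    (h₂ : ∀ x z, Lin k fun y => B x y z) (h₃ : ∀ x y, Lin k fun z => B x y z)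
    (t : (V ⊗[k] W) ⊗[k] X) :
    (sw (TensorProduct.assoc k V W X t) fun x u => sw u fun y z => B x y z) =
      sw t fun u z => sw u fun x y => B x y z := by
  refine (sw_map (f := (TensorProduct.assoc k V W X).toLinearMap)
    (by fun_prop) (by fun_prop)).trans ?_
  refine sw_congr fun u z => ?_
  induction u with
  | zero => simp [zero_tmul,
      Lin.zero' (f := fun t : V ⊗[k] (W ⊗[k] X) => sw t fun x u => sw u fun y z => B x y z)
        (by fun_prop), Lin.zero' (f := fun t : V ⊗[k] W => sw t fun x y => B x y z) (by fun_prop)]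
  | tmul x y =>
    rw [sw_tmul (by fun_prop) (by fun_prop)]
    change (sw (x ⊗ₜ[k] (y ⊗ₜ[k] z)) _) = _
    rw [sw_tmul (by fun_prop) (by fun_prop), sw_tmul (by fun_prop) (by fun_prop)]
  | add u v hu hv =>
    rw [Lin.add' (f := fun t : V ⊗[k] W => sw t fun x y => B x y z) (by fun_prop), ← hu, ← hv,
      ← Lin.add' (f := fun t : V ⊗[k] (W ⊗[k] X) => sw t fun x u => sw u fun y z => B x y z)
        (by fun_prop), add_tmul, map_add]

theorem sw_tensorTensorTensorComm {B : V → X → W → Y → U}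
    (h₁ : ∀ y z w, Lin k fun x => B x y z w) (h₂ : ∀ x z w, Lin k fun y => B x y z w)
    (h₃ : ∀ x y w, Lin k fun z => B x y z w) (h₄ : ∀ x y z, Lin k fun w => B x y z w)
    (s : V ⊗[k] W) (t : X ⊗[k] Y) :
    (sw (TensorProduct.tensorTensorTensorComm k V W X Y (s ⊗ₜ t)) fun u v =>
      sw u fun x y => sw v fun z w => B x y z w) =
      sw s fun x z => sw t fun y w => B x y z w := by
  conv_lhs => rw [← sw_self s, ← sw_self t]
  simp_rw [sw_tmul_right, tmul_sw]
  refine (map_sw (f := fun t => sw (TensorProduct.tensorTensorTensorComm k V W X Y t) fun u v =>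
      sw u fun x y => sw v fun z w => B x y z w) (by fun_prop) _ _).trans (sw_congr fun x z => ?_)
  refine (map_sw (f := fun t => sw (TensorProduct.tensorTensorTensorComm k V W X Y t) fun u v =>
      sw u fun x y => sw v fun z w => B x y z w) (by fun_prop) _ _).trans (sw_congr fun y w => ?_)
  rw [tensorTensorTensorComm_tmul, sw_tmul (by fun_prop) (by fun_prop),
    sw_tmul (by fun_prop) (by fun_prop), sw_tmul (by fun_prop) (by fun_prop)]

theorem mul'_map_eq_sw {R : Type*} [Semiring R] [Algebra k R] (f : V →ₗ[k] R) (g : W →ₗ[k] R)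
    (t : V ⊗[k] W) :
    LinearMap.mul' k R (TensorProduct.map f g t) = sw t fun x y => f x * g y := by
  conv_lhs => rw [← sw_self t]
  rw [map_sw', map_sw']
  rfl

theorem lift_eq_sw (f : V →ₗ[k] W →ₗ[k] X) (t : V ⊗[k] W) :
    TensorProduct.lift f t = sw t fun x y => f x y := (sw_bilin f t).symm

theorem mul'_eq_sw {R : Type*} [Semiring R] [Algebra k R] (t : R ⊗[k] R) :
    LinearMap.mul' k R t = sw t fun x y => x * y := lift_eq_sw _ t

theorem lTensor_eq_sw (f : W →ₗ[k] X) (t : V ⊗[k] W) :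
    f.lTensor V t = sw t fun x y => x ⊗ₜ[k] f y := by
  conv_lhs => rw [← sw_self t]
  rw [map_sw']; rfl

theorem rTensor_eq_sw (f : V →ₗ[k] X) (t : V ⊗[k] W) :
    f.rTensor W t = sw t fun x y => f x ⊗ₜ[k] y := by
  conv_lhs => rw [← sw_self t]
  rw [map_sw']; rfl

theorem map_eq_sw (f : V →ₗ[k] X) (g : W →ₗ[k] Y) (t : V ⊗[k] W) :
    TensorProduct.map f g t = sw t fun x y => f x ⊗ₜ[k] g y := by
  conv_lhs => rw [← sw_self t]
  rw [map_sw']; rfl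

theorem rid_eq_sw (t : V ⊗[k] k) : TensorProduct.rid k V t = sw t fun x y => y • x := by
  conv_lhs => rw [← sw_self t]
  rw [map_sw (f := fun t => TensorProduct.rid k V t) (by fun_prop)]; rfl

theorem lid_eq_sw (t : k ⊗[k] V) : TensorProduct.lid k V t = sw t fun x y => x • y := by
  conv_lhs => rw [← sw_self t]
  rw [map_sw (f := fun t => TensorProduct.lid k V t) (by fun_prop)]; rfl

end SweedlerTensor

-- Coassociativity, counit and colinearity as rewriting rules.

section CoalgebraRules
variable {k : Type*} [CommSemiring k] {C : Type*} [AddCommMonoid C] [Module k C] [Coalgebra k C]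
  {U : Type*} [AddCommMonoid U] [Module k U]

local notation "Δ" => Coalgebra.comul (R := k)
local notation "ε" => Coalgebra.counit (R := k)

theorem sw_comul_comul {B : C → C → C → U} (h₁ : ∀ y z, Lin k fun x => B x y z)
    (h₂ : ∀ x z, Lin k fun y => B x y z) (h₃ : ∀ x y, Lin k fun z => B x y z) (c : C) :
    (sw (Δ c) fun x z => sw (Δ x) fun x y => B x y z) =
      sw (Δ c) fun x z => sw (Δ z) fun y z => B x y z := by
  have := congrArg (fun t => sw t fun x u => sw u fun y z => B x y z)
    (Coalgebra.coassoc_apply (R := k) c)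
  rwa [sw_assoc h₁ h₂ h₃, sw_rTensor _ (by fun_prop) (by fun_prop),
    sw_lTensor _ (by fun_prop) (by fun_prop)] at this

theorem sw_counit_left {f : C → U} (hf : Lin k f) (c : C) :
    (sw (Δ c) fun x y => ε x • f y) = f c := by
  have := congrArg (fun t => sw t fun x y => x • f y) (Coalgebra.rTensor_counit_comul (R := k) c)
  rwa [sw_rTensor _ (by fun_prop) (by fun_prop), sw_tmul (by fun_prop) (by fun_prop),
    one_smul] at this

theorem sw_counit_right {f : C → U} (hf : Lin k f) (c : C) :
    (sw (Δ c) fun x y => ε y • f x) = f c := by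
  have := congrArg (fun t => sw t fun x y => y • f x) (Coalgebra.lTensor_counit_comul (R := k) c)
  rwa [sw_lTensor _ (by fun_prop) (by fun_prop), sw_tmul (by fun_prop) (by fun_prop),
    one_smul] at this

end CoalgebraRules

section CoactionRules
variable {k : Type*} [Field k] {H : Type*} [Ring H] [Bialgebra k H]
  {V : Type*} [AddCommGroup V] [Module k V] {W : Type*} [AddCommGroup W] [Module k W]
  {U : Type*} [AddCommGroup U] [Module k U]
  {ρ : V →ₗ[k] V ⊗[k] H} {ρW : W →ₗ[k] W ⊗[k] H}

local notation "Δ" => Coalgebra.comul (R := k)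
local notation "ε" => Coalgebra.counit (R := k)

theorem sw_coact_coact (hρ : IsCoaction ρ) {B : V → H → H → U}
    (h₁ : ∀ y z, Lin k fun x => B x y z)
    (h₂ : ∀ x z, Lin k fun y => B x y z) (h₃ : ∀ x y, Lin k fun z => B x y z) (v : V) :
    (sw (ρ v) fun x z => sw (ρ x) fun x y => B x y z) =
      sw (ρ v) fun x z => sw (Δ z) fun y z => B x y z := by
  have := congrArg (fun t => sw t fun x u => sw u fun y z => B x y z)
    (LinearMap.congr_fun hρ.coassoc v)
  simp only [LinearMap.comp_apply, LinearEquiv.coe_coe] at this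
  rwa [sw_assoc h₁ h₂ h₃, sw_rTensor _ (by fun_prop) (by fun_prop),
    sw_lTensor _ (by fun_prop) (by fun_prop)] at this

theorem sw_coact_counit (hρ : IsCoaction ρ) {f : V → U} (hf : Lin k f) (v : V) :
    (sw (ρ v) fun x y => ε y • f x) = f v := by
  have := congrArg f (LinearMap.congr_fun hρ.counit v)
  simp only [LinearMap.comp_apply, LinearEquiv.coe_coe, LinearMap.id_apply] at this
  rw [rid_eq_sw, sw_lTensor _ (by fun_prop) (by fun_prop), map_sw hf] at this
  simpa only [hf.smul'] using this

theorem sw_tensorCoaction {B : V → W → H → U} (h₁ : ∀ y z, Lin k fun x => B x y z)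
    (h₂ : ∀ x z, Lin k fun y => B x y z) (h₃ : ∀ x y, Lin k fun z => B x y z) (v : V) (w : W) :
    (sw (tensorCoaction ρ ρW (v ⊗ₜ w)) fun u h => sw u fun x y => B x y h) =
      sw (ρ v) fun v₀ v₁ => sw (ρW w) fun w₀ w₁ => B v₀ w₀ (v₁ * w₁) := by
  simp only [tensorCoaction, LinearMap.comp_apply, LinearEquiv.coe_coe, map_tmul]
  rw [sw_lTensor _ (by fun_prop) (by fun_prop)]
  simp_rw [mul'_eq_sw]
  rw [← sw_tensorTensorTensorComm (B := fun x y z w => B x y (z * w)) (by fun_prop) (by fun_prop)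
    (by fun_prop) (by fun_prop)]
  exact sw_congr fun u h => sw_congr fun x y => map_sw (h₃ x y) _ _

theorem tensorCoaction_tmul (v : V) (w : W) : tensorCoaction ρ ρW (v ⊗ₜ w) =
    sw (ρ v) fun v₀ v₁ => sw (ρW w) fun w₀ w₁ => (v₀ ⊗ₜ[k] w₀) ⊗ₜ[k] (v₁ * w₁) := by
  rw [← sw_tensorCoaction (U := (V ⊗[k] W) ⊗[k] H) (B := fun x y h => (x ⊗ₜ[k] y) ⊗ₜ[k] h)
    (by fun_prop) (by fun_prop)
    (by fun_prop)]
  conv_lhs => rw [← sw_self (tensorCoaction ρ ρW (v ⊗ₜ w))]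
  refine sw_congr fun u h => ?_
  conv_lhs => rw [← sw_self u]
  rw [sw_tmul_right]

/-- Colinearity in Sweedler form. -/
theorem IsColinear.sw {f : V →ₗ[k] W} (hf : IsColinear ρ ρW f) {B : W → H → U}
    (h₁ : ∀ y, Lin k fun x => B x y) (h₂ : ∀ x, Lin k fun y => B x y) (v : V) :
    sw (ρW (f v)) B = BraidedHopf.sw (ρ v) fun x y => B (f x) y := by
  have := LinearMap.congr_fun hf v
  simp only [LinearMap.comp_apply] at this
  rw [this, sw_rTensor _ h₁ h₂]

end CoactionRules
end BraidedHopf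

namespace BraidedHopf

-- The antipode of H in Sweedler form.

section HopfRules
variable {k : Type*} [Field k] {H : Type*} [Ring H]
  {U : Type*} [AddCommGroup U] [Module k U]

local notation "Δ" => Coalgebra.comul (R := k)
local notation "ε" => Coalgebra.counit (R := k)
local notation "S" => HopfAlgebra.antipode k

theorem sw_mul_tensor {R R' : Type*} [Ring R] [Algebra k R] [Ring R'] [Algebra k R']
    {B : R → R' → U} (h₁ : ∀ y, Lin k fun x => B x y)
    (h₂ : ∀ x, Lin k fun y => B x y) (s t : R ⊗[k] R') :
    sw (s * t) B = sw s fun x₁ x₂ => sw t fun y₁ y₂ => B (x₁ * y₁) (x₂ * y₂) := by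
  conv_lhs => rw [← sw_self s, ← sw_self t]
  rw [sw_mul, sw_sw h₁ h₂]
  refine sw_congr fun x₁ x₂ => ?_
  rw [mul_sw, sw_sw h₁ h₂]
  refine sw_congr fun y₁ y₂ => ?_
  rw [Algebra.TensorProduct.tmul_mul_tmul, sw_tmul h₁ h₂]

theorem sw_comul_mul [Bialgebra k H] {B : H → H → U} (h₁ : ∀ y, Lin k fun x => B x y)
    (h₂ : ∀ x, Lin k fun y => B x y) (x y : H) :
    sw (Δ (x * y)) B =
      sw (Δ x) fun x₁ x₂ => sw (Δ y) fun y₁ y₂ => B (x₁ * y₁) (x₂ * y₂) := by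
  rw [Bialgebra.comul_mul, sw_mul_tensor h₁ h₂]

theorem sw_comul_one [Bialgebra k H] {B : H → H → U} (h₁ : ∀ y, Lin k fun x => B x y)
    (h₂ : ∀ x, Lin k fun y => B x y) : sw (Δ (1 : H)) B = B 1 1 := by
  rw [Bialgebra.comul_one, Algebra.TensorProduct.one_def, sw_tmul h₁ h₂]

variable [HopfAlgebra k H]

theorem sw_antipode_mul {f : H → U} (hf : Lin k f) (x : H) :
    (sw (Δ x) fun x₁ x₂ => f (S x₁ * x₂)) = ε x • f 1 := by
  have := congrArg f (HopfAlgebra.mul_antipode_rTensor_comul_apply (R := k) x)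
  rw [mul'_eq_sw, sw_rTensor _ (by fun_prop) (by fun_prop), map_sw hf] at this
  rw [this, Algebra.algebraMap_eq_smul_one, hf.smul']

theorem sw_mul_antipode {f : H → U} (hf : Lin k f) (x : H) :
    (sw (Δ x) fun x₁ x₂ => f (x₁ * S x₂)) = ε x • f 1 := by
  have := congrArg f (HopfAlgebra.mul_antipode_lTensor_comul_apply (R := k) x)
  rw [mul'_eq_sw, sw_lTensor _ (by fun_prop) (by fun_prop), map_sw hf] at this
  rw [this, Algebra.algebraMap_eq_smul_one, hf.smul']

/-- The map `h ↦ S h₂ ⊗ S h₁`. -/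
def antipodeSwap (k H : Type*) [Field k] [Ring H] [HopfAlgebra k H] : H →ₗ[k] H ⊗[k] H :=
  TensorProduct.map (HopfAlgebra.antipode k) (HopfAlgebra.antipode k) ∘ₗ
    (TensorProduct.comm k H H).toLinearMap ∘ₗ Coalgebra.comul

theorem antipodeSwap_apply (x : H) :
    antipodeSwap k H x = sw (Δ x) fun x₁ x₂ => S x₂ ⊗ₜ[k] S x₁ := by
  simp only [antipodeSwap, LinearMap.comp_apply, LinearEquiv.coe_coe]
  rw [map_eq_sw, sw_swap (by fun_prop) (by fun_prop)]

theorem antipodeSwap_mul_comul :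
    WithConv.toConv (antipodeSwap k H) * WithConv.toConv (Δ : H →ₗ[k] H ⊗[k] H) = 1 := by
  ext x
  rw [LinearMap.convMul_apply, mul'_map_eq_sw]
  have h1 : ∀ x y : H, antipodeSwap k H x * Δ y =
      sw (Δ x) fun x₁ x₂ => sw (Δ y) fun y₁ y₂ => (S x₂ * y₁) ⊗ₜ[k] (S x₁ * y₂) := by
    intro x y
    rw [antipodeSwap_apply, sw_mul]
    refine sw_congr fun x₁ x₂ => ?_
    conv_lhs => rw [← sw_self (Δ y)]
    rw [mul_sw]
    exact sw_congr fun y₁ y₂ => Algebra.TensorProduct.tmul_mul_tmul _ _ _ _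
  simp_rw [h1]
  rw [sw_comul_comul (B := fun a b c => sw (Δ c) fun y₁ y₂ => (S b * y₁) ⊗ₜ[k] (S a * y₂))
    (by fun_prop) (by fun_prop) (by fun_prop)]
  have h2 : ∀ a b : H, (sw (Δ b) fun y z => sw (Δ z) fun y₁ y₂ => (S y * y₁) ⊗ₜ[k] (S a * y₂)) =
      1 ⊗ₜ[k] (S a * b) := by
    intro a b
    rw [← sw_comul_comul (B := fun y y₁ y₂ => (S y * y₁) ⊗ₜ[k] (S a * y₂))
      (by fun_prop) (by fun_prop) (by fun_prop)]
    refine (sw_congr fun y z => sw_antipode_mul (f := fun w => w ⊗ₜ[k] (S a * z))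
      (by fun_prop) y).trans ?_
    exact sw_counit_left (f := fun b => 1 ⊗ₜ[k] (S a * b)) (by fun_prop) b
  simp_rw [h2]
  rw [sw_antipode_mul (f := fun y => (1 : H) ⊗ₜ[k] y) (by fun_prop), LinearMap.convOne_apply,
    Algebra.algebraMap_eq_smul_one]
  rfl

/-- In the convolution algebra of maps H → H ⊗ H, the map h ↦ S h₂ ⊗ S h₁ is a left inverse of Δ and
Δ ∘ S is a right inverse, so they agree. -/
theorem sw_comul_antipode {B : H → H → U} (h₁ : ∀ y, Lin k fun x => B x y)
    (h₂ : ∀ x, Lin k fun y => B x y) (x : H) :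
    sw (Δ (S x)) B = sw (Δ x) fun x₁ x₂ => B (S x₂) (S x₁) := by
  have h := left_inv_eq_right_inv (antipodeSwap_mul_comul (k := k) (H := H))
    LinearMap.comul_right_inv
  have h' : antipodeSwap k H x = Δ (S x) := by
    have := LinearMap.congr_fun (congrArg WithConv.ofConv h) x
    simpa using this
  rw [← h', antipodeSwap_apply, sw_sw h₁ h₂]
  exact sw_congr fun a b => sw_tmul h₁ h₂ _ _

end HopfRules

-- The axioms of the r-form in Sweedler form.

section RForm
variable {k : Type*} [Field k] {H : Type*} [Ring H]
  {U : Type*} [AddCommGroup U] [Module k U]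

local notation "Δ" => Coalgebra.comul (R := k)
local notation "ε" => Coalgebra.counit (R := k)
local notation "S" => HopfAlgebra.antipode k

theorem sw_comul_tmul {C D : Type*} [AddCommMonoid C] [Module k C] [Coalgebra k C]
    [AddCommMonoid D] [Module k D] [Coalgebra k D]
    {B : C → D → C → D → U}
    (h₁ : ∀ y z w, Lin k fun x => B x y z w) (h₂ : ∀ x z w, Lin k fun y => B x y z w)
    (h₃ : ∀ x y w, Lin k fun z => B x y z w) (h₄ : ∀ x y z, Lin k fun w => B x y z w)
    (x : C) (y : D) :
    (sw (Δ (x ⊗ₜ[k] y)) fun u v => sw u fun x₁ y₁ => sw v fun x₂ y₂ => B x₁ y₁ x₂ y₂) =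
      sw (Δ x) fun x₁ x₂ => sw (Δ y) fun y₁ y₂ => B x₁ y₁ x₂ y₂ := by
  rw [TensorProduct.comul_def]
  exact sw_tensorTensorTensorComm h₁ h₂ h₃ h₄ _ _

/-- The convolution product of bilinear maps in Sweedler form. -/
theorem convMul_lift_apply {R C D : Type*} [AddCommMonoid C] [Module k C] [Coalgebra k C]
    [AddCommMonoid D] [Module k D] [Coalgebra k D] [Ring R] [Algebra k R]
    (f g : C ⊗[k] D →ₗ[k] R) (x : C) (y : D) :
    (WithConv.toConv f * WithConv.toConv g) (x ⊗ₜ y) =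
      sw (Δ x) fun x₁ x₂ => sw (Δ y) fun y₁ y₂ => f (x₁ ⊗ₜ y₁) * g (x₂ ⊗ₜ y₂) := by
  rw [LinearMap.convMul_apply, mul'_map_eq_sw, ← sw_comul_tmul
    (B := fun x₁ y₁ x₂ y₂ => f (x₁ ⊗ₜ y₁) * g (x₂ ⊗ₜ y₂))
    (by fun_prop) (by fun_prop) (by fun_prop) (by fun_prop)]
  refine sw_congr fun u v => ?_
  conv_lhs => rw [← sw_self u, ← sw_self v]
  simp_rw [map_sw', sw_mul, mul_sw]

namespace UniversalRForm

section Bialgebra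
variable [Bialgebra k H] (r : UniversalRForm k H)

theorem form_mul_left (x y z : H) :
    r.form (x * y) z = sw (Δ z) fun z₁ z₂ => r.form x z₁ * r.form y z₂ := by
  have := LinearMap.congr_fun (congrArg WithConv.ofConv (r.mul_left x y)) z
  refine Eq.trans this ?_
  exact (LinearMap.convMul_apply _ _ _).trans (mul'_map_eq_sw _ _ _)

theorem form_mul_right (x y z : H) :
    r.form x (y * z) = sw (Δ x) fun x₁ x₂ => r.form x₁ z * r.form x₂ y := by
  have := LinearMap.congr_fun (congrArg WithConv.ofConv (r.mul_right y z)) x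
  refine Eq.trans this ?_
  exact (LinearMap.convMul_apply _ _ _).trans (mul'_map_eq_sw _ _ _)

theorem form_inv (x y : H) :
    (sw (Δ x) fun x₁ x₂ => sw (Δ y) fun y₁ y₂ => r.form x₁ y₁ * r.inv x₂ y₂) = ε x * ε y := by
  refine (convMul_lift_apply (TensorProduct.lift r.form)
    (TensorProduct.lift r.inv) x y).symm.trans ?_
  rw [r.form_mul_inv, LinearMap.convOne_apply, TensorProduct.counit_tmul]
  simp [mul_comm]

/-- `r(x₁, y₁) x₂ y₂ = y₁ x₁ r(x₂, y₂)` -/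
theorem form_smul_mul {f : H → U} (hf : Lin k f) (x y : H) :
    (sw (Δ x) fun x₁ x₂ => sw (Δ y) fun y₁ y₂ => r.form x₁ y₁ • f (x₂ * y₂)) =
      sw (Δ x) fun x₁ x₂ => sw (Δ y) fun y₁ y₂ => r.form x₂ y₂ • f (y₁ * x₁) := by
  -- Convolving the commutation axiom with r on the right cancels the factor r⁻¹.
  have h := congrArg (fun F => F *
    WithConv.toConv (Algebra.linearMap k H ∘ₗ TensorProduct.lift r.form))
    r.mul_comm'
  have h3 : WithConv.toConv (Algebra.linearMap k H ∘ₗ TensorProduct.lift r.inv) *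
      WithConv.toConv (Algebra.linearMap k H ∘ₗ TensorProduct.lift r.form) = 1 := by
    have h4 := LinearMap.algHom_comp_convMul_distrib (Algebra.ofId k H)
      (WithConv.toConv (TensorProduct.lift r.inv)) (WithConv.toConv (TensorProduct.lift r.form))
    rw [r.inv_mul_form] at h4
    refine Eq.trans ?_ (congrArg WithConv.toConv h4).symm |>.trans ?_
    · rfl
    · ext x
      simp
  simp only [mul_assoc, h3, mul_one] at h
  have := congrArg f (LinearMap.congr_fun (congrArg WithConv.ofConv h) (x ⊗ₜ y))
  have e1 := convMul_lift_apply (LinearMap.mul' k H ∘ₗ (TensorProduct.comm k H H).toLinearMap)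
    (Algebra.linearMap k H ∘ₗ TensorProduct.lift r.form) x y
  have e2 := convMul_lift_apply (Algebra.linearMap k H ∘ₗ TensorProduct.lift r.form)
    (LinearMap.mul' k H) x y
  have e3 := (congrArg f e2.symm).trans (this.symm.trans (congrArg f e1))
  simp only [map_sw hf] at e3
  refine Eq.trans ?_ (e3.trans ?_)
  · refine sw_congr fun x₁ x₂ => sw_congr fun y₁ y₂ => ?_
    simp [← Algebra.smul_def, hf.smul']
  · refine sw_congr fun x₁ x₂ => sw_congr fun y₁ y₂ => ?_
    simp [← Algebra.commutes (r.form x₂ y₂), ← Algebra.smul_def, hf.smul']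

end Bialgebra
end UniversalRForm
end RForm
end BraidedHopf

-- Antipodes inside the r-form, and the functional θ.

namespace BraidedHopf
namespace UniversalRForm
variable {k : Type*} [Field k] {H : Type*} [Ring H] [HopfAlgebra k H] (r : UniversalRForm k H)
  {U : Type*} [AddCommGroup U] [Module k U]

local notation "Δ" => Coalgebra.comul (R := k)
local notation "ε" => Coalgebra.counit (R := k)
local notation "S" => HopfAlgebra.antipode k

/-- The functional r(-, 1) is idempotent for convolution because 1 · 1 = 1, and it is invertible
because r is; an invertible idempotent is the unit. -/
theorem form_one_right (x : H) : r.form x 1 = ε x := by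
  set f := WithConv.toConv (r.form.flip 1) with hf
  have h1 : f * f = f := by rw [hf, ← r.mul_right, one_mul]
  have h2 : f * WithConv.toConv (r.inv.flip 1) = 1 := by
    ext x
    rw [LinearMap.convMul_apply, mul'_map_eq_sw, LinearMap.convOne_apply]
    have := r.form_inv x 1
    simp (disch := fun_prop) only [sw_comul_one] at this
    exact Eq.trans rfl (this.trans (by simp))
  have h3 : f = 1 := by
    calc f = f * (f * WithConv.toConv (r.inv.flip 1)) := by rw [h2, mul_one]
      _ = 1 := by rw [← mul_assoc, h1, h2]
  have := LinearMap.congr_fun (congrArg WithConv.ofConv h3) x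
  exact this

theorem form_one_left (y : H) : r.form 1 y = ε y := by
  set f := WithConv.toConv (r.form 1) with hf
  have h1 : f * f = f := by rw [hf, ← r.mul_left, one_mul]
  have h2 : f * WithConv.toConv (r.inv 1) = 1 := by
    ext x
    rw [LinearMap.convMul_apply, mul'_map_eq_sw, LinearMap.convOne_apply]
    have := r.form_inv 1 x
    rw [sw_comul_one (k := k) (H := H) (by fun_prop) (by fun_prop)] at this
    simpa using this
  have h3 : f = 1 := by
    calc f = f * (f * WithConv.toConv (r.inv 1)) := by rw [h2, mul_one]
      _ = 1 := by rw [← mul_assoc, h1, h2]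
  have := LinearMap.congr_fun (congrArg WithConv.ofConv h3) y
  exact this

/-- `r(x₁, S y₂) r(x₂, y₁) = ε(x) ε(y)` -/
theorem form_antipode_right (x y : H) :
    (sw (Δ x) fun x₁ x₂ => sw (Δ y) fun y₁ y₂ => r.form x₁ (S y₂) * r.form x₂ y₁) =
      ε x * ε y := by
  rw [sw_comm]
  refine (sw_congr fun y₁ y₂ => (r.form_mul_right x y₁ (S y₂)).symm).trans ?_
  rw [sw_mul_antipode (f := fun h => r.form x h) (by fun_prop), form_one_right, smul_eq_mul,
    mul_comm]

theorem form_antipode_antipode_mul (x y : H) :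
    (sw (Δ x) fun x₁ x₂ => sw (Δ y) fun y₁ y₂ => r.form (S x₁) (S y₂) * r.form x₂ (S y₁)) =
      ε x * ε y := by
  have h : ∀ x₁ x₂, (sw (Δ y) fun y₁ y₂ => r.form (S x₁) (S y₂) * r.form x₂ (S y₁)) =
      r.form (S x₁ * x₂) (S y) := by
    intro x₁ x₂
    rw [form_mul_left, sw_comul_antipode (by fun_prop) (by fun_prop)]
  simp_rw [h]
  rw [sw_antipode_mul (f := fun h => r.form h (S y)) (by fun_prop), form_one_left, smul_eq_mul,
    HopfAlgebra.counit_antipode]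

/-- For the convolution that uses the opposite coproduct in the second variable, r ∘ (S ⊗ S) is a
left inverse and r a right inverse of (x, y) ↦ r(x, S y). Both sides are expanded into the same
triple product. -/
theorem form_antipode_antipode (x y : H) : r.form (S x) (S y) = r.form x y := by
  have e1 : r.form (S x) (S y) = sw (Δ x) fun x₁ x₂ => sw (Δ y) fun y₁ y₂ =>
      r.form (S x₁) (S y₂) * sw (Δ x₂) fun x₂ x₃ => sw (Δ y₁) fun y₁ y₂ =>
        r.form x₂ (S y₂) * r.form x₃ y₁ := by
    simp_rw [form_antipode_right]
    have : ∀ x₁ x₂ : H, (sw (Δ y) fun y₁ y₂ => r.form (S x₁) (S y₂) * (ε x₂ * ε y₁)) =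
        ε x₂ • r.form (S x₁) (S y) := fun x₁ x₂ => by
      rw [← sw_counit_left (k := k) (f := fun h => r.form (S x₁) (S h)) (by fun_prop) y, smul_sw]
      exact sw_congr fun a b => by simp only [smul_eq_mul]; ring
    simp_rw [this]
    exact (sw_counit_right (f := fun h => r.form (S h) (S y)) (by fun_prop) x).symm
  have e2 : r.form x y = sw (Δ x) fun x₁ x₃ => sw (Δ y) fun y₁ y₃ =>
      (sw (Δ x₁) fun x₁ x₂ => sw (Δ y₃) fun y₂ y₃ =>
        r.form (S x₁) (S y₃) * r.form x₂ (S y₂)) * r.form x₃ y₁ := by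
    simp_rw [form_antipode_antipode_mul]
    have : ∀ x₁ x₂ : H, (sw (Δ y) fun y₁ y₂ => ε x₁ * ε y₂ * r.form x₂ y₁) =
        ε x₁ • r.form x₂ y := fun x₁ x₂ => by
      rw [← sw_counit_right (k := k) (f := fun h => r.form x₂ h) (by fun_prop) y, smul_sw]
      exact sw_congr fun a b => by simp only [smul_eq_mul]; ring
    simp_rw [this]
    exact (sw_counit_left (f := fun h => r.form h y) (by fun_prop) x).symm
  rw [e1, e2]
  simp_rw [mul_sw, sw_mul]
  conv_lhs => enter [2, a, b]; rw [sw_comm]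
  conv_rhs => enter [2, a, b]; rw [sw_comm]
  rw [sw_comul_comul (B := fun x₁ x₂ x₃ => sw (Δ y) fun y₁ y₃ => sw (Δ y₃) fun y₂ y₃ =>
    r.form (S x₁) (S y₃) * r.form x₂ (S y₂) * r.form x₃ y₁) (by fun_prop) (by fun_prop)
    (by fun_prop)]
  refine sw_congr fun x₁ x₃ => sw_congr fun x₂ x₃ => ?_
  rw [← sw_comul_comul (B := fun y₁ y₂ y₃ =>
    r.form (S x₁) (S y₃) * r.form x₂ (S y₂) * r.form x₃ y₁) (by fun_prop) (by fun_prop)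
    (by fun_prop)]
  simp_rw [mul_assoc]

/-- The functional `θ(h) = r(h₁, S h₂)`. -/
def theta : H →ₗ[k] k :=
  TensorProduct.lift r.form ∘ₗ (HopfAlgebra.antipode k).lTensor H ∘ₗ Coalgebra.comul

theorem theta_apply (h : H) : r.theta h = sw (Δ h) fun a b => r.form a (S b) := by
  simp only [theta, LinearMap.comp_apply]
  rw [lift_eq_sw, sw_lTensor _ (by fun_prop) (by fun_prop)]

/-- The functional `θ'(h) = r(S² h₁, h₂)`, the convolution inverse of `θ`. -/
def thetaInv : H →ₗ[k] k :=
  TensorProduct.lift r.form ∘ₗ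
    (HopfAlgebra.antipode k ∘ₗ HopfAlgebra.antipode k).rTensor H ∘ₗ Coalgebra.comul

theorem thetaInv_apply (h : H) : r.thetaInv h = sw (Δ h) fun a b => r.form (S (S a)) b := by
  simp only [thetaInv, LinearMap.comp_apply]
  rw [lift_eq_sw, sw_rTensor _ (by fun_prop) (by fun_prop)]
  rfl

/-- The exchange rule `form_smul_mul` is applied to the pair (h₁, S h₂). On one side the product h₂
S(h₃) collapses and only θ(h) is left; on the other side the middle factors assemble to θ. -/
theorem theta_smul {f : H → U} (hf : Lin k f) (h : H) :
    (sw (Δ h) fun a b => sw (Δ b) fun b c => r.theta b • f (S c * a)) = r.theta h • f 1 := by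
  have e : (sw (Δ h) fun x y => sw (Δ x) fun x₁ x₂ => sw (Δ (S y)) fun y₁ y₂ =>
      r.form x₁ y₁ • f (x₂ * y₂)) = sw (Δ h) fun x y => sw (Δ x) fun x₁ x₂ => sw (Δ (S y))
      fun y₁ y₂ => r.form x₂ y₂ • f (y₁ * x₁) :=
    sw_congr fun x y => r.form_smul_mul hf x (S y)
  simp (disch := fun_prop) only [sw_comul_antipode] at e
  refine Eq.trans ?_ (e.symm.trans ?_)
  · rw [sw_comul_comul (B := fun x₁ x₂ y => sw (Δ y) fun y₁ y₂ =>
      r.form x₂ (S y₁) • f (S y₂ * x₁)) (by fun_prop) (by fun_prop) (by fun_prop)]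
    refine sw_congr fun a b => ?_
    rw [← sw_comul_comul (B := fun x₂ y₁ y₂ =>
      r.form x₂ (S y₁) • f (S y₂ * a)) (by fun_prop) (by fun_prop) (by fun_prop)]
    refine sw_congr fun b c => ?_
    rw [theta_apply, sw_smul_left]
  · rw [sw_comul_comul (B := fun x₁ x₂ y => sw (Δ y) fun y₁ y₂ =>
      r.form x₁ (S y₂) • f (x₂ * S y₁)) (by fun_prop) (by fun_prop) (by fun_prop), theta_apply,
      sw_smul_left]
    refine sw_congr fun a b => ?_
    rw [← sw_comul_comul (B := fun x₂ y₁ y₂ =>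
      r.form a (S y₂) • f (x₂ * S y₁)) (by fun_prop) (by fun_prop) (by fun_prop)]
    refine (sw_congr fun y z => sw_mul_antipode (f := fun w => r.form a (S z) • f w)
      (by fun_prop) y).trans ?_
    exact sw_counit_left (f := fun z => r.form a (S z) • f 1) (by fun_prop) b

/-- `h₁ θ(h₂) = θ(h₁) S² h₂` -/
theorem theta_smul_antipode_antipode {f : H → U} (hf : Lin k f) (h : H) :
    (sw (Δ h) fun a b => r.theta a • f (S (S b))) = sw (Δ h) fun a b => r.theta b • f a := by
  -- Multiplying `theta_smul` on the left by S² of one more leg w creates S²(w) S(c) = S(c S(w)),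
  -- which collapses by the antipode axiom.
  have e : (sw (Δ h) fun u w => sw (Δ u) fun a b => sw (Δ b) fun b c =>
      r.theta b • f (S (S w) * (S c * a))) = sw (Δ h) fun u w => r.theta u • f (S (S w) * 1) :=
    sw_congr fun u w => r.theta_smul (f := fun y => f (S (S w) * y)) (by fun_prop) u
  simp_rw [mul_one] at e
  rw [← e, sw_comul_comul (B := fun a b w => sw (Δ b) fun b c =>
      r.theta b • f (S (S w) * (S c * a))) (by fun_prop) (by fun_prop) (by fun_prop)]
  refine sw_congr fun a b => ?_
  rw [sw_comul_comul (B := fun b c w =>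
      r.theta b • f (S (S w) * (S c * a))) (by fun_prop) (by fun_prop) (by fun_prop)]
  simp_rw [← mul_assoc, ← HopfAlgebra.antipode_mul_antidistrib]
  refine (sw_congr fun b c => sw_mul_antipode (f := fun w => r.theta b • f (S w * a))
    (by fun_prop) c).trans ?_
  simp_rw [HopfAlgebra.antipode_one, one_mul]
  exact sw_counit_right (f := fun b => r.theta b • f a) (by fun_prop) b

/-- Here r(h₁, h₄) r(h₂, S h₃) = r(h₁, S(h₂) h₃), which collapses. Both convolution products of
`theta` and `thetaInv` are reduced to this sum. -/
theorem form_theta (h : H) : (sw (Δ h) fun a b => sw (Δ a) fun a c => r.theta c * r.form a b) =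
    ε h := by
  have : ∀ a b, (sw (Δ a) fun a c => r.theta c * r.form a b) = sw (Δ a) fun a c =>
      sw (Δ c) fun p q => r.form a b * r.form p (S q) := fun a b => sw_congr fun a c => by
    rw [theta_apply, sw_mul]; simp_rw [mul_comm]
  simp_rw [this]
  rw [sw_comul_comul (B := fun a c b => sw (Δ c) fun p q => r.form a b * r.form p (S q))
    (by fun_prop) (by fun_prop) (by fun_prop)]
  have : ∀ a b, (sw (Δ b) fun c b => sw (Δ c) fun p q => r.form a b * r.form p (S q)) =
      sw (Δ b) fun p b => sw (Δ b) fun q b => r.form a b * r.form p (S q) := fun a b =>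
    sw_comul_comul (B := fun p q b => r.form a b * r.form p (S q))
    (by fun_prop) (by fun_prop) (by fun_prop) b
  simp_rw [this]
  rw [← sw_comul_comul (B := fun a p b => sw (Δ b) fun q b => r.form a b * r.form p (S q))
    (by fun_prop) (by fun_prop) (by fun_prop)]
  have : ∀ a b, (sw (Δ a) fun a p => sw (Δ b) fun q b => r.form a b * r.form p (S q)) =
      ε b • ε a := fun a b => by
    rw [sw_comm]
    refine (sw_congr fun q b => (r.form_mul_right a (S q) b).symm).trans ?_
    rw [sw_antipode_mul (f := fun w => r.form a w) (by fun_prop), form_one_right]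
  simp_rw [this]
  exact sw_counit_right (f := fun a => ε a) (by fun_prop) h

theorem theta_thetaInv (h : H) : (sw (Δ h) fun a b => r.theta a * r.thetaInv b) = ε h := by
  simp_rw [thetaInv_apply, mul_sw]
  rw [← sw_comul_comul (B := fun a p q => r.theta a * r.form (S (S p)) q)
    (by fun_prop) (by fun_prop) (by fun_prop), ← form_theta r h]
  exact sw_congr fun a b => r.theta_smul_antipode_antipode (f := fun w => r.form w b)
    (by fun_prop) a

theorem thetaInv_theta (h : H) : (sw (Δ h) fun a b => r.thetaInv a * r.theta b) = ε h := by
  simp_rw [thetaInv_apply, sw_mul]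
  rw [sw_comul_comul (B := fun a p q => r.form (S (S a)) p * r.theta q)
    (by fun_prop) (by fun_prop) (by fun_prop), ← form_theta r h,
    sw_comul_comul (B := fun a p q => r.theta p * r.form a q)
    (by fun_prop) (by fun_prop) (by fun_prop)]
  refine sw_congr fun a b => ?_
  -- Invariance of r under S ⊗ S removes S² from both arguments once θ has been moved across.
  have := r.theta_smul_antipode_antipode (f := fun w => r.form (S (S a)) w) (by fun_prop) b
  simp only [smul_eq_mul, form_antipode_antipode] at this
  rw [this]
  exact sw_congr fun p q => mul_comm _ _

end UniversalRForm
end BraidedHopf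

-- The square of the antipode of H, bijectivity of the antipode, and the twisted form.

namespace BraidedHopf
namespace UniversalRForm
variable {k : Type*} [Field k] {H : Type*} [Ring H] [HopfAlgebra k H] (r : UniversalRForm k H)
  {U : Type*} [AddCommGroup U] [Module k U]

local notation "Δ" => Coalgebra.comul (R := k)
local notation "ε" => Coalgebra.counit (R := k)
local notation "S" => HopfAlgebra.antipode k

/-- S² is conjugation by θ: the relation h₁ θ(h₂) = θ(h₁) S²(h₂) is convolved with θ⁻¹ on the left.
-/
theorem antipode_antipode (h : H) : S (S h) = sw (Δ h) fun a b => sw (Δ b) fun b c =>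
    (r.thetaInv a * r.theta c) • b := by
  have e : ∀ a b : H, (sw (Δ b) fun b c => (r.thetaInv a * r.theta c) • b) =
      sw (Δ b) fun b c => r.thetaInv a • r.theta b • S (S c) := fun a b => by
    have := r.theta_smul_antipode_antipode (f := fun h : H => h) (by fun_prop) b
    rw [← smul_sw, this, smul_sw]
    simp_rw [smul_smul]
  simp_rw [e]
  rw [← sw_comul_comul (B := fun a b c => r.thetaInv a • r.theta b • S (S c))
    (by fun_prop) (by fun_prop) (by fun_prop)]
  have e : ∀ a b : H, (sw (Δ a) fun a c => r.thetaInv a • r.theta c • S (S b)) =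
      ε a • S (S b) := fun a b => by
    rw [← r.thetaInv_theta a, sw_smul_left]
    simp_rw [smul_smul]
  simp_rw [e]
  exact (sw_counit_left (k := k) (f := fun h : H => S (S h)) (by fun_prop) h).symm

end UniversalRForm

section Act
variable {k : Type*} [Field k] {H : Type*} [Ring H] [Bialgebra k H]
  {U : Type*} [AddCommGroup U] [Module k U]
  {V : Type*} [AddCommGroup V] [Module k V] {W : Type*} [AddCommGroup W] [Module k W]

local notation "Δ" => Coalgebra.comul (R := k)
local notation "ε" => Coalgebra.counit (R := k)
local notation "S" => HopfAlgebra.antipode k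

/-- The action `v ↦ α(v₁) v₀` of a functional `α` on `H` on an `H`-comodule. -/
def act (ρ : V →ₗ[k] V ⊗[k] H) (α : H →ₗ[k] k) : V →ₗ[k] V :=
  (TensorProduct.rid k V).toLinearMap ∘ₗ α.lTensor V ∘ₗ ρ

theorem act_apply (ρ : V →ₗ[k] V ⊗[k] H) (α : H →ₗ[k] k) (v : V) :
    act ρ α v = sw (ρ v) fun x h => α h • x := by
  simp only [act, LinearMap.comp_apply, LinearEquiv.coe_coe]
  rw [rid_eq_sw, sw_lTensor _ (by fun_prop) (by fun_prop)]

variable {ρ : V →ₗ[k] V ⊗[k] H} (hρ : IsCoaction ρ)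

include hρ in
theorem act_act (α β : H →ₗ[k] k) (v : V) :
    act ρ α (act ρ β v) = sw (ρ v) fun x h => (sw (Δ h) fun a b => α a * β b) • x := by
  have e : ∀ x : V, act ρ α x = sw (ρ x) fun x h => α h • x := act_apply ρ α
  rw [act_apply ρ β, map_sw']
  simp_rw [map_smul, e, sw_smul, sw_smul_left]
  rw [sw_coact_coact hρ (B := fun x a b => β b • α a • x) (by fun_prop) (by fun_prop)
    (by fun_prop)]
  simp_rw [smul_smul, mul_comm]

include hρ in

include hρ in
theorem act_act_of_inverse {α β : H →ₗ[k] k}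
    (h : ∀ h, (sw (Δ h) fun a b => α a * β b) = ε h) (v : V) :
    act ρ α (act ρ β v) = v := by
  rw [act_act hρ]
  simp_rw [h]
  exact sw_coact_counit hρ (f := fun v => v) (by fun_prop) v

end Act

theorem isCoaction_comul {k H : Type*} [Field k] [Ring H] [Bialgebra k H] :
    IsCoaction (Coalgebra.comul : H →ₗ[k] H ⊗[k] H) where
  coassoc := Coalgebra.coassoc
  counit := by
    ext x
    simp

namespace UniversalRForm
variable {k : Type*} [Field k] {H : Type*} [Ring H] [HopfAlgebra k H] (r : UniversalRForm k H)
  {U : Type*} [AddCommGroup U] [Module k U]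

local notation "Δ" => Coalgebra.comul (R := k)
local notation "ε" => Coalgebra.counit (R := k)
local notation "S" => HopfAlgebra.antipode k

-- By `antipode_antipode`, S² is the composite of the left and right coregular actions of θ⁻¹ and θ,
-- each invertible because θ is. Bijectivity of S² forces bijectivity of S.
include r in
theorem antipode_bijective : Function.Bijective (S : H → H) := by
  let R : (H →ₗ[k] k) → H → H := fun α h => act (Coalgebra.comul : H →ₗ[k] H ⊗[k] H) α h
  let Q : (H →ₗ[k] k) → H → H := fun α h => sw (Δ h) fun a b => α a • b
  have hQ : ∀ α β : H →ₗ[k] k, (∀ h, (sw (Δ h) fun a b => β a * α b) = ε h) →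
      ∀ h, Q α (Q β h) = h := fun α β hαβ h => by
    have lin : Lin k (Q α) := by simp only [Q]; fun_prop
    have e : Q α (Q β h) = sw (Δ h) fun a b => β a • sw (Δ b) fun b c => α b • c := by
      simp only [Q]
      rw [map_sw (f := fun t => sw (Δ t) fun b c => α b • c) (by fun_prop)]
      exact sw_congr fun a b => Lin.smul' (f := fun t => sw (Δ t) fun b c => α b • c)
        (by fun_prop) _ _
    rw [e]
    simp_rw [sw_smul]
    rw [← sw_comul_comul (B := fun a b c => β a • α b • c) (by fun_prop) (by fun_prop)
      (by fun_prop)]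
    simp_rw [smul_smul, ← sw_smul_left, hαβ]
    exact sw_counit_left (f := fun h => h) (by fun_prop) h
  have hS : ∀ h, S (S h) = R r.theta (Q r.thetaInv h) := fun h => by
    rw [r.antipode_antipode]
    simp only [R, Q]
    rw [map_sw']
    simp_rw [map_smul, act_apply, smul_sw, smul_smul]
  have hR := fun v => act_act_of_inverse (isCoaction_comul (k := k) (H := H)) r.thetaInv_theta v
  have hR' := fun v => act_act_of_inverse (isCoaction_comul (k := k) (H := H)) r.theta_thetaInv v
  have hb : Function.Bijective (fun h : H => S (S h)) := by
    refine Function.bijective_iff_has_inverse.2 ⟨fun h => Q r.theta (R r.thetaInv h), ?_, ?_⟩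
    · intro h
      simp only [hS]
      simp only [R, hR]
      exact hQ _ _ r.thetaInv_theta h
    · intro h
      simp only [hS]
      rw [hQ _ _ r.theta_thetaInv]
      exact hR' h
  exact ⟨fun x y hxy => hb.1 (congrArg (HopfAlgebra.antipode k) hxy),
    fun y => (hb.2 y).imp' S fun x hx => hx⟩

/-- The inverse of the antipode. -/
def antipodeInv : H →ₗ[k] H :=
  (LinearEquiv.ofBijective (HopfAlgebra.antipode k : H →ₗ[k] H) r.antipode_bijective).symm

@[simp] theorem antipode_antipodeInv (h : H) : S (r.antipodeInv h) = h :=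
  (LinearEquiv.ofBijective (HopfAlgebra.antipode k : H →ₗ[k] H)
    r.antipode_bijective).apply_symm_apply h

@[simp] theorem antipodeInv_antipode (h : H) : r.antipodeInv (S h) = h :=
  (LinearEquiv.ofBijective (HopfAlgebra.antipode k : H →ₗ[k] H)
    r.antipode_bijective).symm_apply_apply h

/-- Identifies the `Ring.inverse` occurring in `homCoactionAux` with the genuine inverse, so that
its value is not the default 0. -/
theorem ringInverse_antipode :
    Ring.inverse (HopfAlgebra.antipode k : Module.End k H) = r.antipodeInv := by
  have h1 : (HopfAlgebra.antipode k : Module.End k H) * r.antipodeInv = 1 :=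
    LinearMap.ext r.antipode_antipodeInv
  have h2 : r.antipodeInv * (HopfAlgebra.antipode k : Module.End k H) = 1 :=
    LinearMap.ext r.antipodeInv_antipode
  exact Ring.inverse_unit (⟨_, _, h1, h2⟩ : (Module.End k H)ˣ)

theorem antipodeInv_mul (x y : H) :
    r.antipodeInv (x * y) = r.antipodeInv y * r.antipodeInv x := by
  apply r.antipode_bijective.1
  rw [HopfAlgebra.antipode_mul_antidistrib]
  simp

theorem antipodeInv_one : r.antipodeInv 1 = 1 := by
  apply r.antipode_bijective.1
  simp [HopfAlgebra.antipode_one]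

theorem counit_antipodeInv (x : H) : ε (r.antipodeInv x) = ε x := by
  rw [← HopfAlgebra.counit_antipode, antipode_antipodeInv]

theorem sw_comul_antipodeInv {B : H → H → U} (h₁ : ∀ y, Lin k fun x => B x y)
    (h₂ : ∀ x, Lin k fun y => B x y) (x : H) :
    sw (Δ (r.antipodeInv x)) B = sw (Δ x) fun x₁ x₂ => B (r.antipodeInv x₂) (r.antipodeInv x₁) := by
  have := sw_comul_antipode (k := k) (B := fun a b => B (r.antipodeInv b) (r.antipodeInv a))
    (by fun_prop) (by fun_prop) (r.antipodeInv x)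
  simp only [antipode_antipodeInv, antipodeInv_antipode] at this
  exact this.symm

theorem sw_antipodeInv_mul {f : H → U} (hf : Lin k f) (x : H) :
    (sw (Δ x) fun x₁ x₂ => f (r.antipodeInv x₂ * x₁)) = ε x • f 1 := by
  have := sw_antipode_mul (k := k) (f := fun h => f (r.antipodeInv h)) (by fun_prop) x
  simpa only [antipodeInv_mul, antipodeInv_antipode, antipodeInv_one] using this

theorem sw_mul_antipodeInv {f : H → U} (hf : Lin k f) (x : H) :
    (sw (Δ x) fun x₁ x₂ => f (x₂ * r.antipodeInv x₁)) = ε x • f 1 := by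
  have := sw_mul_antipode (k := k) (f := fun h => f (r.antipodeInv h)) (by fun_prop) x
  simpa only [antipodeInv_mul, antipodeInv_antipode, antipodeInv_one] using this

/-- The form `(p, q) ↦ r(q₁, S(p q₂))`. -/
def twist (p : H) : H →ₗ[k] k :=
  TensorProduct.lift r.form ∘ₗ
    (HopfAlgebra.antipode k ∘ₗ LinearMap.mulLeft k p).lTensor H ∘ₗ Coalgebra.comul

theorem twist_apply (p q : H) : r.twist p q = sw (Δ q) fun a b => r.form a (S (p * b)) := by
  simp only [twist, LinearMap.comp_apply]
  rw [lift_eq_sw, sw_lTensor _ (by fun_prop) (by fun_prop)]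
  rfl

@[fun_prop] theorem lin_twist {f : U → H} (hf : Lin k f) (q : H) :
    Lin k fun u => r.twist (f u) q := by
  simp_rw [twist_apply]; fun_prop

theorem twist_one_right (p : H) : r.twist p 1 = ε p := by
  rw [twist_apply, sw_comul_one (by fun_prop) (by fun_prop), form_one_left, mul_one,
    HopfAlgebra.counit_antipode]

theorem twist_one_left (q : H) : r.twist 1 q = r.theta q := by
  rw [twist_apply, theta_apply]
  simp_rw [one_mul]

/-- Two ways to bracket a fourfold coproduct. -/
theorem _root_.BraidedHopf.sw_comul_left_left {C : Type*} [AddCommGroup C] [Module k C]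
    [Coalgebra k C] {B : C → C → C → C → U}
    (h₁ : ∀ y z w, Lin k fun x => B x y z w) (h₂ : ∀ x z w, Lin k fun y => B x y z w)
    (h₃ : ∀ x y w, Lin k fun z => B x y z w) (h₄ : ∀ x y z, Lin k fun w => B x y z w) (c : C) :
    (sw (Δ c) fun u v => sw (Δ u) fun x y => sw (Δ v) fun z w => B x y z w) =
      sw (Δ c) fun u w => sw (Δ u) fun v z => sw (Δ v) fun x y => B x y z w := by
  rw [sw_comul_comul (B := fun u z w => sw (Δ u) fun x y => B x y z w) (by fun_prop)
    (by fun_prop) (by fun_prop)]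
  exact sw_congr fun u v => sw_comm _ _ _

theorem _root_.BraidedHopf.sw_comul_mid {C : Type*} [AddCommGroup C] [Module k C]
    [Coalgebra k C] {B : C → C → C → C → U}
    (h₁ : ∀ y z w, Lin k fun x => B x y z w) (h₂ : ∀ x z w, Lin k fun y => B x y z w)
    (h₃ : ∀ x y w, Lin k fun z => B x y z w) (h₄ : ∀ x y z, Lin k fun w => B x y z w) (c : C) :
    (sw (Δ c) fun u v => sw (Δ u) fun x y => sw (Δ v) fun z w => B x y z w) =
      sw (Δ c) fun x u => sw (Δ u) fun v w => sw (Δ v) fun y z => B x y z w := by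
  rw [sw_comul_comul (B := fun x y v => sw (Δ v) fun z w => B x y z w) (by fun_prop)
    (by fun_prop) (by fun_prop)]
  refine sw_congr fun x u => ?_
  rw [sw_comul_comul (B := fun y z w => B x y z w) (by fun_prop) (by fun_prop) (by fun_prop)]

theorem form_antipode_mul_form (x y z : H) :
    (sw (Δ x) fun x₁ x₂ => sw (Δ y) fun y₁ y₂ => r.form x₁ (S y₂ * z) * r.form x₂ y₁) =
      ε y * r.form x z := by
  rw [sw_comm]
  refine (sw_congr fun y₁ y₂ => (r.form_mul_right x y₁ (S y₂ * z)).symm).trans ?_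
  simp_rw [← mul_assoc]
  rw [sw_mul_antipode (f := fun h => r.form x (h * z)) (by fun_prop), one_mul, smul_eq_mul]

/-- The cocycle-type identity behind the composition of two maps `nu`. After both sides are
expanded, the exchange rule reverses the product q₂ s₂ in the first argument of r, and the remaining
factor r(q₂, s₂) is absorbed by `form_antipode_mul_form`. -/
theorem twist_mul (p q s : H) :
    (sw (Δ q) fun q₁ q₂ => sw (Δ s) fun s₁ s₂ => r.form q₁ s₁ * r.twist p (q₂ * s₂)) =
      sw (Δ p) fun p₁ p₂ => sw (Δ q) fun q₁ q₂ => r.twist p₁ q₁ * r.twist (p₂ * q₂) s := by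
  have e1 : (sw (Δ q) fun q₁ q₂ => sw (Δ s) fun s₁ s₂ => r.form q₁ s₁ * r.twist p (q₂ * s₂)) =
      sw (Δ q) fun q q₃ => sw (Δ s) fun s s₃ => sw (Δ q) fun q₁ q₂ => sw (Δ s) fun s₁ s₂ =>
        r.form q₁ s₁ • r.form (q₂ * s₂) (S (p * (q₃ * s₃))) := by
    simp_rw [twist_apply]
    simp (disch := fun_prop) only [sw_comul_mul]
    simp_rw [mul_sw, smul_eq_mul]
    have : ∀ q₁ q₂ : H, (sw (Δ s) fun s₁ s₂ => sw (Δ q₂) fun x₁ x₂ => sw (Δ s₂) fun y₁ y₂ =>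
        r.form q₁ s₁ * r.form (x₁ * y₁) (S (p * (x₂ * y₂)))) = sw (Δ q₂) fun x₁ x₂ =>
          sw (Δ s) fun s s₃ => sw (Δ s) fun s₁ s₂ =>
            r.form q₁ s₁ * r.form (x₁ * s₂) (S (p * (x₂ * s₃))) := fun q₁ q₂ => by
      rw [sw_comm]
      refine sw_congr fun x₁ x₂ => ?_
      rw [sw_comul_comul (B := fun s₁ s₂ s₃ =>
        r.form q₁ s₁ * r.form (x₁ * s₂) (S (p * (x₂ * s₃)))) (by fun_prop) (by fun_prop)
        (by fun_prop)]
    simp_rw [this]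
    rw [← sw_comul_comul (B := fun q₁ x₁ x₂ => sw (Δ s) fun s s₃ => sw (Δ s) fun s₁ s₂ =>
            r.form q₁ s₁ * r.form (x₁ * s₂) (S (p * (x₂ * s₃)))) (by fun_prop) (by fun_prop)
        (by fun_prop)]
    exact sw_congr fun q q₃ => sw_comm _ _ _
  have e2 : ∀ q q₃ s s₃ : H, (sw (Δ q) fun q₁ q₂ => sw (Δ s) fun s₁ s₂ =>
        r.form q₁ s₁ • r.form (q₂ * s₂) (S (p * (q₃ * s₃)))) =
      sw (Δ p) fun p₁ p₂ => sw (Δ q) fun q₁ q₂ => sw (Δ s) fun s₁ s₂ =>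
        sw (Δ q₃) fun q₃ q₄ => sw (Δ s₃) fun s₃ s₄ =>
        r.form q₂ s₂ * (r.form s₁ (S (p₂ * q₄ * s₄)) * r.form q₁ (S s₃ * S (p₁ * q₃))) := by
    intro q q₃ s s₃
    rw [r.form_smul_mul (f := fun h => r.form h (S (p * (q₃ * s₃)))) (by fun_prop)]
    have : ∀ s₁ q₁ : H, r.form (s₁ * q₁) (S (p * (q₃ * s₃))) = sw (Δ p) fun p₁ p₂ =>
        sw (Δ q₃) fun q₃ q₄ => sw (Δ s₃) fun s₃ s₄ =>
          r.form s₁ (S (p₂ * q₄ * s₄)) * r.form q₁ (S s₃ * S (p₁ * q₃)) := fun s₁ q₁ => by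
      rw [form_mul_left]
      simp (disch := fun_prop) only [sw_comul_antipode, sw_comul_mul]
      simp_rw [← HopfAlgebra.antipode_mul_antidistrib, mul_assoc]
    simp_rw [this, sw_smul, smul_eq_mul]
    exact (sw_congr fun q₁ q₂ => sw_comm (Δ s) (Δ p) _).trans (sw_comm (Δ q) (Δ p) _)
  rw [e1]
  simp_rw [e2]
  refine ((sw_congr fun q q' => sw_comm (Δ s) (Δ p) _).trans (sw_comm (Δ q) (Δ p) _)).trans ?_
  refine sw_congr fun p₁ p₂ => ?_
  refine (sw_congr fun q q' => (sw_comm (Δ s) (Δ q) _).trans (sw_congr fun q₁ q₂ =>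
    (sw_congr fun s s' => sw_comm (Δ s) (Δ q') _).trans (sw_comm (Δ s) (Δ q') _))).trans ?_
  rw [sw_comul_left_left (B := fun q₁ q₂ q₃ q₄ => sw (Δ s) fun s s' => sw (Δ s) fun s₁ s₂ =>
      sw (Δ s') fun s₃ s₄ =>
        r.form q₂ s₂ * (r.form s₁ (S (p₂ * q₄ * s₄)) * r.form q₁ (S s₃ * S (p₁ * q₃))))
        (by fun_prop) (by fun_prop) (by fun_prop) (by fun_prop)]
  refine sw_congr fun u q₄ => ?_
  rw [twist_apply, twist_apply, sw_mul]
  refine sw_congr fun v q₃ => ?_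
  have : ∀ q₁ q₂ : H, (sw (Δ s) fun s s' => sw (Δ s) fun s₁ s₂ => sw (Δ s') fun s₃ s₄ =>
        r.form q₂ s₂ * (r.form s₁ (S (p₂ * q₄ * s₄)) * r.form q₁ (S s₃ * S (p₁ * q₃)))) =
      sw (Δ s) fun s₁ x => sw (Δ x) fun y s₄ => sw (Δ y) fun s₂ s₃ =>
        r.form s₁ (S (p₂ * q₄ * s₄)) * (r.form q₁ (S s₃ * S (p₁ * q₃)) * r.form q₂ s₂) :=
    fun q₁ q₂ => by
      rw [sw_comul_mid (B := fun s₁ s₂ s₃ s₄ =>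
        r.form q₂ s₂ * (r.form s₁ (S (p₂ * q₄ * s₄)) * r.form q₁ (S s₃ * S (p₁ * q₃))))
        (by fun_prop) (by fun_prop) (by fun_prop) (by fun_prop)]
      exact sw_congr fun _ _ => sw_congr fun _ _ => sw_congr fun _ _ => by ring
  simp_rw [this]
  refine (sw_comm (Δ v) (Δ s) _).trans ?_
  rw [mul_sw]
  refine sw_congr fun s₁ x => ?_
  refine (sw_comm (Δ v) (Δ x) _).trans ?_
  simp_rw [← mul_sw, form_antipode_mul_form]
  rw [← sw_counit_left (k := k) (f := fun x => r.form v (S (p₁ * q₃)) * r.form s₁ (S (p₂ * q₄ * x)))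
    (by fun_prop) x]
  exact sw_congr fun _ _ => by rw [smul_eq_mul]; ring

end UniversalRForm
end BraidedHopf

-- The two actions of H on comodules, and the calculus of a braided Hopf algebra.

namespace BraidedHopf

namespace UniversalRForm
variable {k : Type*} [Field k] {H : Type*} [Ring H] [HopfAlgebra k H] (r : UniversalRForm k H)
  {U : Type*} [AddCommGroup U] [Module k U]
  {V : Type*} [AddCommGroup V] [Module k V] {W : Type*} [AddCommGroup W] [Module k W]
  (ρ : V →ₗ[k] V ⊗[k] H) {ρW : W →ₗ[k] W ⊗[k] H}

local notation "Δ" => Coalgebra.comul (R := k)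
local notation "ε" => Coalgebra.counit (R := k)
local notation "S" => HopfAlgebra.antipode k

/-- The right action `h ↦ r(v₁, h) v₀` of `H` on a comodule. -/
def opAct : H →ₗ[k] V →ₗ[k] V :=
  bilin (k := k) (B := fun h v => sw (ρ v) fun x w => r.form w h • x) (by fun_prop) (by fun_prop)

/-- The left action `h ↦ r(h, v₁) v₀` of `H` on a comodule. -/
def homAct : H →ₗ[k] V →ₗ[k] V :=
  bilin (k := k) (B := fun h v => sw (ρ v) fun x w => r.form h w • x) (by fun_prop) (by fun_prop)

theorem opAct_apply (h : H) (v : V) : r.opAct ρ h v = sw (ρ v) fun x w => r.form w h • x := rfl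
theorem homAct_apply (h : H) (v : V) : r.homAct ρ h v = sw (ρ v) fun x w => r.form h w • x := rfl

theorem opAct_eq_act (h : H) (v : V) : r.opAct ρ h v = act ρ (r.form.flip h) v :=
  (act_apply ρ (r.form.flip h) v).symm
theorem homAct_eq_act (h : H) (v : V) : r.homAct ρ h v = act ρ (r.form h) v :=
  (act_apply ρ (r.form h) v).symm

variable {ρ}

theorem opAct_opAct (hρ : IsCoaction ρ) (g h : H) (v : V) :
    r.opAct ρ g (r.opAct ρ h v) = r.opAct ρ (h * g) v := by
  simp_rw [opAct_eq_act, act_act hρ, act_apply, LinearMap.flip_apply, form_mul_right]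

theorem homAct_homAct (hρ : IsCoaction ρ) (g h : H) (v : V) :
    r.homAct ρ g (r.homAct ρ h v) = r.homAct ρ (g * h) v := by
  simp_rw [homAct_eq_act, act_act hρ, act_apply, form_mul_left]

theorem opAct_one (hρ : IsCoaction ρ) (v : V) : r.opAct ρ 1 v = v := by
  simp_rw [opAct_apply, form_one_right]
  exact sw_coact_counit hρ (f := fun v => v) (by fun_prop) v

theorem homAct_one (hρ : IsCoaction ρ) (v : V) : r.homAct ρ 1 v = v := by
  simp_rw [homAct_apply, form_one_left]
  exact sw_coact_counit hρ (f := fun v => v) (by fun_prop) v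

theorem map_opAct {f : V →ₗ[k] W} (hf : IsColinear ρ ρW f) (h : H) (v : V) :
    f (r.opAct ρ h v) = r.opAct ρW h (f v) := by
  rw [opAct_apply, opAct_apply, hf.sw (by fun_prop) (by fun_prop), map_sw']
  simp_rw [map_smul]

theorem map_homAct {f : V →ₗ[k] W} (hf : IsColinear ρ ρW f) (h : H) (v : V) :
    f (r.homAct ρ h v) = r.homAct ρW h (f v) := by
  rw [homAct_apply, homAct_apply, hf.sw (by fun_prop) (by fun_prop), map_sw']
  simp_rw [map_smul]

theorem braiding_tmul (v : V) (w : W) : r.braiding ρ ρW (v ⊗ₜ w) =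
    sw (ρ v) fun v₀ v₁ => sw (ρW w) fun w₀ w₁ => r.form v₁ w₁ • (w₀ ⊗ₜ[k] v₀) := by
  simp only [braiding, LinearMap.comp_apply, LinearEquiv.coe_coe, map_tmul]
  rw [rid_eq_sw, sw_mapMap _ _ (by fun_prop) (by fun_prop)]
  simp_rw [lift_eq_sw, sw_smul_left]
  rw [← sw_tensorTensorTensorComm (B := fun x y z w => r.form z w • (y ⊗ₜ[k] x)) (by fun_prop)
    (by fun_prop) (by fun_prop) (by fun_prop)]
  refine sw_congr fun u h => ?_
  conv_lhs => rw [← sw_self u]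
  simp_rw [LinearEquiv.coe_coe, map_sw (f := fun u => TensorProduct.comm k V W u)
    (Lin.coe_equiv (TensorProduct.comm k V W)), smul_sw]
  exact sw_comm _ _ _

end UniversalRForm

theorem braidedMul_tmul {k A : Type*} [Field k] [Ring A] [Algebra k A]
    (c : A ⊗[k] A →ₗ[k] A ⊗[k] A) (a b x y : A) :
    braidedMul c ((a ⊗ₜ b) ⊗ₜ (x ⊗ₜ y)) = sw (c (b ⊗ₜ x)) fun p q => (a * p) ⊗ₜ[k] (q * y) := by
  simp only [braidedMul, LinearMap.comp_apply, LinearEquiv.coe_coe, assoc_tmul,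
    LinearMap.lTensor_tmul, assoc_symm_tmul, LinearMap.rTensor_tmul]
  conv_lhs => rw [← sw_self (c (b ⊗ₜ x))]
  have lin : Lin k fun t : A ⊗[k] A => TensorProduct.map (LinearMap.mul' k A) (LinearMap.mul' k A)
      ((TensorProduct.assoc k A A (A ⊗[k] A)).symm
        (a ⊗ₜ (TensorProduct.assoc k A A A (t ⊗ₜ y)))) := by fun_prop
  exact map_sw lin _ _

namespace BraidedHopfAlgebra
variable {k H A : Type u} [Field k] [Ring H] [HopfAlgebra k H] {r : UniversalRForm k H}
  [Ring A] [Algebra k A] [Coalgebra k A] (B : BraidedHopfAlgebra r A)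
  {U : Type*} [AddCommGroup U] [Module k U]
  {M : Type u} [AddCommGroup M] [Module k M] [Module A M] [IsScalarTower k A M]
  {ρ : M →ₗ[k] M ⊗[k] H}

local notation "Δ" => Coalgebra.comul (R := k)
local notation "ε" => Coalgebra.counit (R := k)
local notation "S" => HopfAlgebra.antipode k

theorem isHopfModule_self : IsHopfModule B B.coact where
  isCoaction := B.isCoaction
  smul_colinear := by
    have : lift (Algebra.lsmul k k A).toLinearMap = LinearMap.mul' k A := by ext; rfl
    rw [this]
    exact B.mul_colinear

theorem sw_coact_smul (hM : IsHopfModule B ρ) {F : M → H → U} (h₁ : ∀ y, Lin k fun x => F x y)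
    (h₂ : ∀ x, Lin k fun y => F x y) (a : A) (m : M) :
    sw (ρ (a • m)) F =
      sw (B.coact a) fun a₀ a₁ => sw (ρ m) fun m₀ m₁ => F (a₀ • m₀) (a₁ * m₁) := by
  rw [← sw_tensorCoaction (B := fun a m h => F (a • m) h) (by fun_prop) (by fun_prop)
    (by fun_prop)]
  refine (hM.smul_colinear.sw (B := F) (by fun_prop) (by fun_prop) (a ⊗ₜ m)).trans ?_
  refine sw_congr fun u h => ?_
  rw [lift_eq_sw, map_sw (f := fun x => F x h) (by fun_prop)]
  rfl

theorem sw_coact_mul {F : A → H → U} (h₁ : ∀ y, Lin k fun x => F x y)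
    (h₂ : ∀ x, Lin k fun y => F x y) (a b : A) :
    sw (B.coact (a * b)) F =
      sw (B.coact a) fun a₀ a₁ => sw (B.coact b) fun b₀ b₁ => F (a₀ * b₀) (a₁ * b₁) :=
  sw_coact_smul B B.isHopfModule_self h₁ h₂ a b

theorem coact_one : B.coact 1 = 1 ⊗ₜ 1 := by
  have := LinearMap.congr_fun B.one_colinear 1
  simpa [trivialCoaction] using this

theorem sw_coact_comul {F : A → A → H → U} (h₁ : ∀ y z, Lin k fun x => F x y z)
    (h₂ : ∀ x z, Lin k fun y => F x y z) (h₃ : ∀ x y, Lin k fun z => F x y z) (a : A) :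
    (sw (B.coact a) fun x h => sw (Δ x) fun p q => F p q h) =
      sw (Δ a) fun p q => sw (B.coact p) fun p₀ p₁ => sw (B.coact q) fun q₀ q₁ =>
        F p₀ q₀ (p₁ * q₁) := by
  have := B.comul_colinear.sw (B := fun t h => sw t fun p q => F p q h) (by fun_prop)
    (by fun_prop) a
  rw [← this]
  conv_lhs => rw [← sw_self (Δ a)]
  rw [map_sw', sw_sw (by fun_prop) (by fun_prop)]
  exact sw_congr fun p q => sw_tensorCoaction h₁ h₂ h₃ p q

theorem sw_coact_counit_smul {f : H → U} (hf : Lin k f) (a : A) :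
    (sw (B.coact a) fun x h => ε x • f h) = ε a • f 1 := by
  have := B.counit_colinear.sw (B := fun c h => c • f h) (by fun_prop) (by fun_prop) a
  rw [← this]
  exact sw_tmul (by fun_prop) (by fun_prop) _ _

/-- The braiding of a₂ past b₁ is expressed as the operator η attached to the coaction leg of a₂,
acting on b₁. This keeps all later computations free of explicit braidings. -/
theorem sw_comul_mul {F : A → A → U} (h₁ : ∀ y, Lin k fun x => F x y)
    (h₂ : ∀ x, Lin k fun y => F x y) (a b : A) :
    sw (Δ (a * b)) F = sw (Δ a) fun a₁ a₂ => sw (Δ b) fun b₁ b₂ =>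
      sw (B.coact a₂) fun x h => F (a₁ * r.homAct B.coact h b₁) (x * b₂) := by
  have := LinearMap.congr_fun B.comul_mul (a ⊗ₜ b)
  simp only [LinearMap.comp_apply, LinearMap.mul'_apply, map_tmul] at this
  rw [this]
  conv_lhs => rw [← sw_self (Δ a), ← sw_self (Δ b)]
  simp_rw [sw_tmul_right, tmul_sw, map_sw', sw_sw h₁ h₂]
  refine sw_congr fun a₁ a₂ => sw_congr fun b₁ b₂ => ?_
  rw [braidedMul_tmul, r.braiding_tmul, sw_sw h₁ h₂, sw_sw (by fun_prop) (by fun_prop)]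
  refine sw_congr (k := k) fun x h => ?_
  rw [sw_sw (by fun_prop) (by fun_prop), r.homAct_apply, mul_sw,
    map_sw (f := fun y => F y (x * b₂)) (h₁ _)]
  refine sw_congr fun y w => ?_
  have lin : Lin k fun t : A ⊗[k] A => sw t fun p q =>
      sw ((a₁ * p) ⊗ₜ[k] (q * b₂)) F := by fun_prop
  rw [lin.smul', sw_tmul (by fun_prop) (by fun_prop), sw_tmul h₁ h₂, mul_smul_comm,
    (h₁ (x * b₂)).smul']

/-- The legs of h appear in reversed order because r(h, a₁ m₁) = r(h₁, m₁) r(h₂, a₁); for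
`opAct_smul` the other product axiom of r keeps the order. -/
theorem homAct_smul (hM : IsHopfModule B ρ) (h : H) (a : A) (m : M) :
    r.homAct ρ h (a • m) = sw (Δ h) fun h₁ h₂ =>
      r.homAct B.coact h₂ a • r.homAct ρ h₁ m := by
  rw [r.homAct_apply, B.sw_coact_smul hM (by fun_prop) (by fun_prop)]
  simp_rw [r.form_mul_right, r.homAct_apply, sw_smul_left]
  have : ∀ (h₁ h₂ : H) (a₀ : A) (a₁ : H), (r.form h₂ a₁ • a₀) • (sw (ρ m) fun m₀ m₁ =>
      r.form h₁ m₁ • m₀) = sw (ρ m) fun m₀ m₁ => (r.form h₁ m₁ * r.form h₂ a₁) • a₀ • m₀ :=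
    fun h₁ h₂ a₀ a₁ => by
      rw [smul_sw]
      refine sw_congr fun m₀ m₁ => ?_
      rw [smul_algebra_smul_comm, smul_assoc, smul_smul]
  simp_rw [this]
  exact (sw_congr fun a₀ a₁ => sw_comm (ρ m) (Δ h) _).trans (sw_comm _ _ _)

theorem opAct_smul (hM : IsHopfModule B ρ) (h : H) (a : A) (m : M) :
    r.opAct ρ h (a • m) = sw (Δ h) fun h₁ h₂ =>
      r.opAct B.coact h₁ a • r.opAct ρ h₂ m := by
  rw [r.opAct_apply, B.sw_coact_smul hM (by fun_prop) (by fun_prop)]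
  simp_rw [r.form_mul_left, r.opAct_apply, sw_smul_left]
  have : ∀ (h₁ h₂ : H) (a₀ : A) (a₁ : H), (r.form a₁ h₁ • a₀) • (sw (ρ m) fun m₀ m₁ =>
      r.form m₁ h₂ • m₀) = sw (ρ m) fun m₀ m₁ => (r.form a₁ h₁ * r.form m₁ h₂) • a₀ • m₀ :=
    fun h₁ h₂ a₀ a₁ => by
      rw [smul_sw]
      refine sw_congr fun m₀ m₁ => ?_
      rw [smul_algebra_smul_comm, smul_assoc, smul_smul, mul_comm]
  simp_rw [this]
  exact (sw_congr fun a₀ a₁ => sw_comm (ρ m) (Δ h) _).trans (sw_comm _ _ _)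

theorem opAct_mul (h : H) (a b : A) : r.opAct B.coact h (a * b) = sw (Δ h) fun h₁ h₂ =>
      r.opAct B.coact h₁ a * r.opAct B.coact h₂ b :=
  B.opAct_smul B.isHopfModule_self h a b

theorem homAct_algebra_one (h : H) : r.homAct B.coact h 1 = ε h • 1 := by
  rw [r.homAct_apply, coact_one, sw_tmul (by fun_prop) (by fun_prop), r.form_one_right]

theorem opAct_algebra_one (h : H) : r.opAct B.coact h 1 = ε h • 1 := by
  rw [r.opAct_apply, coact_one, sw_tmul (by fun_prop) (by fun_prop), r.form_one_left]

theorem sw_coact_antipode {F : A → H → U} (h₁ : ∀ y, Lin k fun x => F x y)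
    (h₂ : ∀ x, Lin k fun y => F x y) (a : A) :
    sw (B.coact (B.antipode a)) F = sw (B.coact a) fun x h => F (B.antipode x) h :=
  B.antipode_colinear.sw h₁ h₂ a

theorem sw_antipode_mul {f : A → U} (hf : Lin k f) (a : A) :
    (sw (Δ a) fun x y => f (B.antipode x * y)) = ε a • f 1 := by
  have := congrArg f (LinearMap.congr_fun B.antipode_mul_id a)
  simp only [LinearMap.comp_apply] at this
  rw [mul'_eq_sw, sw_rTensor _ (by fun_prop) (by fun_prop), map_sw hf] at this
  rw [this, Algebra.linearMap_apply, Algebra.algebraMap_eq_smul_one, hf.smul']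

theorem sw_mul_antipode {f : A → U} (hf : Lin k f) (a : A) :
    (sw (Δ a) fun x y => f (x * B.antipode y)) = ε a • f 1 := by
  have := congrArg f (LinearMap.congr_fun B.id_mul_antipode a)
  simp only [LinearMap.comp_apply] at this
  rw [mul'_eq_sw, sw_lTensor _ (by fun_prop) (by fun_prop), map_sw hf] at this
  rw [this, Algebra.linearMap_apply, Algebra.algebraMap_eq_smul_one, hf.smul']

end BraidedHopfAlgebra
end BraidedHopf

-- The induced bimodule M ⊗ A.

namespace BraidedHopf

set_option linter.unusedSectionVars false

namespace BraidedHopfAlgebra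
variable {k H A : Type u} [Field k] [Ring H] [HopfAlgebra k H] {r : UniversalRForm k H}
  [Ring A] [Algebra k A] [Coalgebra k A] (B : BraidedHopfAlgebra r A)
  {U : Type*} [AddCommGroup U] [Module k U]
  {V : Type*} [AddCommGroup V] [Module k V] {ρV : V →ₗ[k] V ⊗[k] H}
  {M : Type u} [AddCommGroup M] [Module k M] [Module A M] [IsScalarTower k A M]
  {ρ : M →ₗ[k] M ⊗[k] H}

local notation "Δ" => Coalgebra.comul (R := k)
local notation "ε" => Coalgebra.counit (R := k)
local notation "S" => HopfAlgebra.antipode k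

/-- Colinearity of Δ merges the two successive operators η into one attached to the coaction of a₂.
Afterwards a₂ is only split as q ⊗ p, which allows an antipode to cancel there. -/
theorem sw_coact_comul_act (hV : IsCoaction ρV) {F : A → V → A → A → U}
    (h₁ : ∀ y z w, Lin k fun x => F x y z w) (h₂ : ∀ x z w, Lin k fun y => F x y z w)
    (h₃ : ∀ x y w, Lin k fun z => F x y z w) (h₄ : ∀ x y z, Lin k fun w => F x y z w)
    (a : A) (x : V) :
    (sw (Δ a) fun a₁ b => sw (B.coact b) fun p h => sw (Δ a₁) fun a₁₁ a₁₂ =>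
      sw (B.coact a₁₂) fun q g => F a₁₁ (r.homAct ρV g (r.homAct ρV h x)) q p) =
    sw (Δ a) fun a₁ b => sw (B.coact b) fun z h => sw (Δ z) fun q p =>
      F a₁ (r.homAct ρV h x) q p := by
  refine (sw_congr fun a₁ b => sw_comm _ _ _).trans ?_
  rw [sw_comul_comul (B := fun x₁ y z => sw (B.coact z) fun p h => sw (B.coact y) fun q g =>
    F x₁ (r.homAct ρV g (r.homAct ρV h x)) q p) (by fun_prop) (by fun_prop) (by fun_prop)]
  refine sw_congr fun a₁ b => ?_
  rw [B.sw_coact_comul (F := fun q p h => F a₁ (r.homAct ρV h x) q p) (by fun_prop) (by fun_prop)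
    (by fun_prop)]
  simp_rw [← r.homAct_homAct hV]
  exact sw_congr fun y z => sw_comm _ _ _

/-- The maps `a ⊗ x ⊗ y ↦ a₁ ⊗ η(x) ⊗ a₂ y` and `a ⊗ x ⊗ y ↦ a₁ ⊗ η(x) ⊗ S(a₂) y` are
mutually inverse. -/
theorem sw_comul_act_cancel (hV : IsCoaction ρV) {F : A → V → A → U}
    (h₁ : ∀ y z, Lin k fun x => F x y z) (h₂ : ∀ x z, Lin k fun y => F x y z)
    (h₃ : ∀ x y, Lin k fun z => F x y z) (a : A) (x : V) (y : A) :
    (sw (Δ a) fun a₁ b => sw (B.coact b) fun p h => sw (Δ a₁) fun a₁₁ a₁₂ =>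
      sw (B.coact a₁₂) fun q g => F a₁₁ (r.homAct ρV g (r.homAct ρV h x))
        (q * (B.antipode p * y))) = F a x y := by
  rw [B.sw_coact_comul_act hV (F := fun a x q p => F a x (q * (B.antipode p * y))) (by fun_prop)
    (by fun_prop) (by fun_prop) (by fun_prop)]
  simp_rw [← mul_assoc]
  have e : ∀ a₁ z : A, ∀ h : H, (sw (Δ z) fun q p => F a₁ (r.homAct ρV h x)
      (q * B.antipode p * y)) = ε z • F a₁ (r.homAct ρV h x) y := fun a₁ z h => by
    rw [B.sw_mul_antipode (f := fun w => F a₁ (r.homAct ρV h x) (w * y)) (by fun_prop), one_mul]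
  simp_rw [e]
  have e : ∀ a₁ b : A, (sw (B.coact b) fun z h => ε z • F a₁ (r.homAct ρV h x) y) =
      ε b • F a₁ x y := fun a₁ b => by
    rw [B.sw_coact_counit_smul (f := fun h => F a₁ (r.homAct ρV h x) y) (by fun_prop),
      r.homAct_one hV]
  simp_rw [e]
  exact sw_counit_right (f := fun a => F a x y) (by fun_prop) a

theorem sw_comul_act_cancel' (hV : IsCoaction ρV) {F : A → V → A → U}
    (h₁ : ∀ y z, Lin k fun x => F x y z) (h₂ : ∀ x z, Lin k fun y => F x y z)
    (h₃ : ∀ x y, Lin k fun z => F x y z) (a : A) (x : V) (y : A) :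
    (sw (Δ a) fun a₁ b => sw (B.coact b) fun p h => sw (Δ a₁) fun a₁₁ a₁₂ =>
      sw (B.coact a₁₂) fun q g => F a₁₁ (r.homAct ρV g (r.homAct ρV h x))
        (B.antipode q * (p * y))) = F a x y := by
  rw [B.sw_coact_comul_act hV (F := fun a x q p => F a x (B.antipode q * (p * y))) (by fun_prop)
    (by fun_prop) (by fun_prop) (by fun_prop)]
  simp_rw [← mul_assoc]
  have e : ∀ a₁ z : A, ∀ h : H, (sw (Δ z) fun q p => F a₁ (r.homAct ρV h x)
      (B.antipode q * p * y)) = ε z • F a₁ (r.homAct ρV h x) y := fun a₁ z h => by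
    rw [B.sw_antipode_mul (f := fun w => F a₁ (r.homAct ρV h x) (w * y)) (by fun_prop), one_mul]
  simp_rw [e]
  have e : ∀ a₁ b : A, (sw (B.coact b) fun z h => ε z • F a₁ (r.homAct ρV h x) y) =
      ε b • F a₁ x y := fun a₁ b => by
    rw [B.sw_coact_counit_smul (f := fun h => F a₁ (r.homAct ρV h x) y) (by fun_prop),
      r.homAct_one hV]
  simp_rw [e]
  exact sw_counit_right (f := fun a => F a x y) (by fun_prop) a

variable (ρ) in
/-- The left action `a · (x ⊗ y) = a₁ η(x) ⊗ a₂ y` of `A` on `M ⊗ A`. -/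
def boxAct (a : A) : M ⊗[k] A →ₗ[k] M ⊗[k] A :=
  TensorProduct.lift (bilin (k := k) (B := fun x y => sw (Δ a) fun a₁ a₂ => sw (B.coact a₂)
    fun p h => (a₁ • r.homAct ρ h x) ⊗ₜ[k] (p * y)) (by fun_prop) (by fun_prop))

theorem boxAct_tmul (a : A) (x : M) (y : A) : B.boxAct ρ a (x ⊗ₜ y) =
    sw (Δ a) fun a₁ a₂ => sw (B.coact a₂) fun p h => (a₁ • r.homAct ρ h x) ⊗ₜ[k] (p * y) := rfl

theorem lin_boxAct : Lin k fun a => B.boxAct ρ a :=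
  ⟨fun a b => by
    ext x y
    exact (show Lin k fun a => B.boxAct ρ a (x ⊗ₜ y) by
      simp only [boxAct_tmul]; fun_prop).add' a b,
  fun c a => by
    ext x y
    exact (show Lin k fun a => B.boxAct ρ a (x ⊗ₜ y) by
      simp only [boxAct_tmul]; fun_prop).smul' c a⟩

theorem boxAct_one (hM : IsCoaction ρ) : B.boxAct ρ 1 = LinearMap.id := by
  ext x y
  change B.boxAct ρ 1 (x ⊗ₜ y) = x ⊗ₜ y
  rw [boxAct_tmul, B.comul_one, sw_tmul (by fun_prop) (by fun_prop), coact_one,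
    sw_tmul (by fun_prop) (by fun_prop), r.homAct_one hM, one_smul, one_mul]

/-- Associativity is the braided multiplicativity of Δ: the operator that moves a₂ past b₁ in Δ(a b)
is the one produced by `homAct_smul` when a₂ passes b₁ in M. -/
theorem boxAct_mul (hM : IsHopfModule B ρ) (a b : A) :
    B.boxAct ρ (a * b) = B.boxAct ρ a ∘ₗ B.boxAct ρ b := by
  ext x y
  change B.boxAct ρ (a * b) (x ⊗ₜ y) = B.boxAct ρ a (B.boxAct ρ b (x ⊗ₜ y))
  rw [boxAct_tmul, boxAct_tmul, B.sw_comul_mul (by fun_prop) (by fun_prop)]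
  simp_rw [map_sw', boxAct_tmul, B.homAct_smul hM, smul_sw, sw_tmul_right,
    r.homAct_homAct hM.isCoaction]
  rw [sw_comm (Δ a) (Δ b)]
  refine sw_congr fun b₁ b₂ => ?_
  rw [sw_comm (B.coact b₂) (Δ a)]
  refine sw_congr fun a₁ a₂ => ?_
  rw [sw_comm (B.coact b₂) (B.coact a₂)]
  simp (disch := fun_prop) only [B.sw_coact_mul]
  rw [sw_coact_coact B.isCoaction (B := fun p g h => sw (B.coact b₂) fun q w =>
    ((a₁ * r.homAct B.coact h b₁) • r.homAct ρ (g * w) x) ⊗ₜ[k] (p * q * y)) (by fun_prop)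
    (by fun_prop) (by fun_prop)]
  refine sw_congr fun p h => (sw_comm (Δ h) (B.coact b₂) _).trans ?_
  simp_rw [mul_assoc, mul_smul]

/-- The right action of `A` on `M ⊗ A`. -/
def boxActRight (b : Aᵐᵒᵖ) : M ⊗[k] A →ₗ[k] M ⊗[k] A :=
  (LinearMap.mulRight k b.unop).lTensor M

theorem boxActRight_tmul (b : Aᵐᵒᵖ) (x : M) (y : A) :
    boxActRight (k := k) b (x ⊗ₜ[k] y) = x ⊗ₜ (y * b.unop) := rfl

/-- The `A`-bimodule structure on `M ⊗ A`. -/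
def boxHom (hM : IsHopfModule B ρ) : A ⊗[k] Aᵐᵒᵖ →ₐ[k] Module.End k (M ⊗[k] A) :=
  Algebra.TensorProduct.lift
    (AlgHom.ofLinearMap B.lin_boxAct.toLin (B.boxAct_one hM.isCoaction) (B.boxAct_mul hM))
    (AlgHom.ofLinearMap
      (show Lin k fun b : Aᵐᵒᵖ => (boxActRight b : Module.End k (M ⊗[k] A)) from
        ⟨fun a b => by ext x y; simp [boxActRight_tmul, mul_add, tmul_add],
          fun c a => by ext x y; simp [boxActRight_tmul]⟩).toLin
      (by ext x y; simp [boxActRight_tmul]) (fun a b => by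
        ext x y; simp [boxActRight_tmul, mul_assoc]))
    (fun a b => by
      refine LinearMap.ext fun t => ?_
      change B.boxAct ρ a (boxActRight b t) = boxActRight b (B.boxAct ρ a t)
      rw [← LinearMap.comp_apply, ← LinearMap.comp_apply]
      congr 1
      ext x y
      change B.boxAct ρ a (boxActRight b (x ⊗ₜ y)) = boxActRight b (B.boxAct ρ a (x ⊗ₜ y))
      rw [boxActRight_tmul, boxAct_tmul, boxAct_tmul]
      simp_rw [map_sw', boxActRight_tmul, mul_assoc])

/-- The `A`-bimodule `M ⊗ A` with left action `a · (x ⊗ y) = a₁ η(x) ⊗ a₂ y` and right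
multiplication. -/
def Box (_ : IsHopfModule B ρ) : Type u := M ⊗[k] A

namespace Box
variable (hM : IsHopfModule B ρ)

instance : AddCommGroup (Box B hM) := inferInstanceAs (AddCommGroup (M ⊗[k] A))
instance : Module k (Box B hM) := inferInstanceAs (Module k (M ⊗[k] A))
instance : Module (A ⊗[k] Aᵐᵒᵖ) (Box B hM) :=
  Module.compHom (M ⊗[k] A) (B.boxHom hM).toRingHom
instance : IsScalarTower k (A ⊗[k] Aᵐᵒᵖ) (Box B hM) :=
  ⟨fun c t x => LinearMap.congr_fun (map_smul (B.boxHom hM) c t) x⟩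

theorem tmul_smul (a : A) (b : Aᵐᵒᵖ) (x : Box B hM) :
    (a ⊗ₜ[k] b) • x = (B.boxAct ρ a (boxActRight b x) : M ⊗[k] A) := rfl

/-- A linear map out of `M ⊗ A` compatible with both actions is a map of bimodules. -/
def linearMap {N : Type*} [AddCommGroup N] [Module k N] [Module (A ⊗[k] Aᵐᵒᵖ) N]
    [IsScalarTower k (A ⊗[k] Aᵐᵒᵖ) N] (f : M ⊗[k] A →ₗ[k] N)
    (hl : ∀ a x y, f (B.boxAct ρ a (x ⊗ₜ y)) = (a ⊗ₜ[k] (1 : Aᵐᵒᵖ)) • f (x ⊗ₜ y))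
    (hr : ∀ b x y, f (x ⊗ₜ (y * b)) = ((1 : A) ⊗ₜ[k] MulOpposite.op b) • f (x ⊗ₜ y)) :
    Box B hM →ₗ[A ⊗[k] Aᵐᵒᵖ] N where
  toFun := f
  map_add' := map_add f
  map_smul' t x := by
    have hl' : ∀ (a : A) (t : M ⊗[k] A), f (B.boxAct ρ a t) = (a ⊗ₜ[k] (1 : Aᵐᵒᵖ)) • f t :=
      fun a t => by
        induction t with
        | zero => simp
        | tmul x y => exact hl a x y
        | add x y hx hy => simp only [map_add, smul_add, hx, hy]
    have hr' : ∀ (b : Aᵐᵒᵖ) (t : M ⊗[k] A), f (boxActRight b t) = ((1 : A) ⊗ₜ[k] b) • f t :=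
      fun b t => by
        induction t with
        | zero => simp
        | tmul x y => exact hr b.unop x y
        | add x y hx hy => simp only [map_add, smul_add, hx, hy]
    have key : ∀ (t : A ⊗[k] Aᵐᵒᵖ) (x : M ⊗[k] A), f (B.boxHom hM t x) = t • f x := fun t x => by
      induction t with
      | zero =>
        rw [map_zero, LinearMap.zero_apply, map_zero]
        exact (zero_smul (A ⊗[k] Aᵐᵒᵖ) (f x)).symm
      | tmul a b =>
        change f (B.boxAct ρ a (boxActRight b x)) = _
        rw [hl', hr', smul_smul, Algebra.TensorProduct.tmul_mul_tmul, mul_one, one_mul]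
      | add s t hs ht => simp only [map_add, add_smul, LinearMap.add_apply, hs, ht]
    exact key t x

variable {B hM}
variable {N : Type u} [AddCommGroup N] [Module k N] [Module A N] [IsScalarTower k A N]
  {ρN : N →ₗ[k] N ⊗[k] H} {hN : IsHopfModule B ρN}

theorem tmul_one_smul (a : A) (x : Box B hM) :
    (a ⊗ₜ[k] (1 : Aᵐᵒᵖ)) • x = (B.boxAct ρ a x : M ⊗[k] A) := by
  have : (boxActRight (1 : Aᵐᵒᵖ) : M ⊗[k] A →ₗ[k] M ⊗[k] A) = LinearMap.id := by
    ext x y; simp [boxActRight_tmul]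
  exact (tmul_smul B hM a 1 x).trans (congrArg (B.boxAct ρ a) (LinearMap.congr_fun this x))

theorem one_tmul_smul (b : Aᵐᵒᵖ) (x : Box B hM) :
    ((1 : A) ⊗ₜ[k] b) • x = (boxActRight (k := k) b x : M ⊗[k] A) :=
  (tmul_smul B hM 1 b x).trans (LinearMap.congr_fun (B.boxAct_one hM.isCoaction) _)

/-- The map of bimodules `M ⊗ A → N ⊗ A` induced by a colinear `A`-linear map `M → N`. -/
def map (f : M →ₗ[A] N) (hf : IsColinear ρ ρN (f.restrictScalars k)) :
    Box B hM →ₗ[A ⊗[k] Aᵐᵒᵖ] Box B hN :=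
  have hl : ∀ a x y, (f.restrictScalars k).rTensor A (B.boxAct ρ a (x ⊗ₜ y)) =
      B.boxAct ρN a (f x ⊗ₜ y) := fun a x y => by
    have e : ∀ h x, f (r.homAct ρ h x) = r.homAct ρN h (f x) := fun h x => r.map_homAct hf h x
    rw [boxAct_tmul, boxAct_tmul]
    simp_rw [map_sw', LinearMap.rTensor_tmul, LinearMap.restrictScalars_apply, map_smul, e]
  linearMap B hM (N := Box B hN) ((f.restrictScalars k).rTensor A : M ⊗[k] A →ₗ[k] N ⊗[k] A)
    (fun a x y => (hl a x y).trans (tmul_one_smul (hM := hN) a _).symm)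
    (fun b x y => (one_tmul_smul (hM := hN) (MulOpposite.op b) (f x ⊗ₜ[k] y : N ⊗[k] A)).symm)

end Box

section Free
variable {W : Type*} [AddCommGroup W] [Module k W] {ρW : W →ₗ[k] W ⊗[k] H}

theorem isCoaction_tensor (hV : IsCoaction ρV) (hW : IsCoaction ρW) :
    IsCoaction (tensorCoaction ρV ρW) where
  coassoc := by
    ext v w
    change TensorProduct.assoc k _ H H ((tensorCoaction ρV ρW).rTensor H
      (tensorCoaction ρV ρW (v ⊗ₜ w))) = Coalgebra.comul.lTensor _ (tensorCoaction ρV ρW (v ⊗ₜ w))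
    rw [tensorCoaction_tmul]
    simp_rw [map_sw', LinearMap.rTensor_tmul, LinearMap.lTensor_tmul, tensorCoaction_tmul,
      sw_tmul_right, map_sw (Lin.coe_equiv (TensorProduct.assoc k (V ⊗[k] W) H H)), assoc_tmul]
    have e : ∀ (x : V) (h : H), (sw (ρW w) fun y g => (x ⊗ₜ[k] y) ⊗ₜ[k] Coalgebra.comul (R := k)
        (h * g)) = sw (Δ h) fun h₁ h₂ => sw (ρW w) fun y g => sw (ρW y) fun y g' =>
          (x ⊗ₜ[k] y) ⊗ₜ[k] ((h₁ * g') ⊗ₜ[k] (h₂ * g)) := fun x h => by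
      symm
      refine (sw_comm _ _ _).trans ((sw_congr fun y g => sw_comm _ _ _).trans ?_)
      rw [sw_coact_coact hW (B := fun y g g' => sw (Δ h) fun h₁ h₂ =>
        (x ⊗ₜ[k] y) ⊗ₜ[k] ((h₁ * g) ⊗ₜ[k] (h₂ * g'))) (by fun_prop) (by fun_prop) (by fun_prop)]
      symm
      refine sw_congr fun y g => ?_
      conv_lhs => rw [← sw_self (Δ (h * g))]
      rw [BraidedHopf.sw_comul_mul (k := k) (by fun_prop) (by fun_prop), tmul_sw]
      simp_rw [tmul_sw]
      exact sw_comm _ _ _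
    simp_rw [e]
    rw [← sw_coact_coact hV (B := fun x h₁ h₂ => sw (ρW w) fun y g => sw (ρW y) fun y g' =>
      (x ⊗ₜ[k] y) ⊗ₜ[k] ((h₁ * g') ⊗ₜ[k] (h₂ * g))) (by fun_prop) (by fun_prop) (by fun_prop)]
    exact sw_congr fun _ _ => sw_comm _ _ _
  counit := by
    ext v w
    change TensorProduct.rid k _ (Coalgebra.counit.lTensor _ (tensorCoaction ρV ρW (v ⊗ₜ w))) = _
    rw [tensorCoaction_tmul]
    simp_rw [map_sw', LinearMap.lTensor_tmul,
      map_sw (Lin.coe_equiv (TensorProduct.rid k (V ⊗[k] W))),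
      rid_tmul, Bialgebra.counit_mul, mul_smul, ← smul_sw]
    simp (disch := fun_prop) only [sw_coact_counit hW]
    exact sw_coact_counit hV (f := fun v => v ⊗ₜ[k] w) (by fun_prop) v

theorem homAct_tmul (h : H) (v : V) (w : W) : r.homAct (tensorCoaction ρV ρW) h (v ⊗ₜ w) =
      sw (Δ h) fun h₁ h₂ => r.homAct ρV h₂ v ⊗ₜ[k] r.homAct ρW h₁ w := by
  rw [r.homAct_apply, tensorCoaction_tmul]
  simp_rw [r.homAct_apply, sw_tmul_right, tmul_sw]
  rw [sw_sw (by fun_prop) (by fun_prop), sw_comm]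
  refine sw_congr fun v₀ v₁ => ?_
  rw [sw_sw (by fun_prop) (by fun_prop), sw_comm]
  refine sw_congr fun w₀ w₁ => ?_
  rw [sw_tmul (by fun_prop) (by fun_prop), r.form_mul_right, sw_smul_left]
  refine sw_congr fun h₁ h₂ => ?_
  simp only [TensorProduct.tmul_smul, ← TensorProduct.smul_tmul', smul_smul]

variable {V : Type u} [AddCommGroup V] [Module k V] {ρV : V →ₗ[k] V ⊗[k] H}

theorem isHopfModule_tensor (hV : IsCoaction ρV) :
    IsHopfModule B (M := A ⊗[k] V) (tensorCoaction B.coact ρV) where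
  isCoaction := isCoaction_tensor B.isCoaction hV
  smul_colinear := by
    ext a b v
    change tensorCoaction B.coact ρV ((a * b) ⊗ₜ v) = LinearMap.rTensor H
      (TensorProduct.lift (Algebra.lsmul k k (A ⊗[k] V)).toLinearMap)
      (tensorCoaction B.coact (tensorCoaction B.coact ρV) (a ⊗ₜ (b ⊗ₜ v)))
    rw [tensorCoaction_tmul, tensorCoaction_tmul,
      B.sw_coact_mul (U := (A ⊗[k] V) ⊗[k] H) (by fun_prop) (by fun_prop)]
    simp_rw [map_sw', LinearMap.rTensor_tmul, tensorCoaction_tmul]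
    simp (disch := fun_prop) only [sw_sw, sw_tmul]
    simp_rw [mul_assoc]
    rfl

/-- The map `(a ⊗ b) ⊗ v ↦ a · ((1 ⊗ v) ⊗ 1) · b`. -/
def boxFreeMap (hV : IsCoaction ρV) :
    (A ⊗[k] Aᵐᵒᵖ) ⊗[k] V →ₗ[A ⊗[k] Aᵐᵒᵖ] Box B (B.isHopfModule_tensor hV) :=
  TensorProduct.AlgebraTensorModule.lift
    (LinearMap.toSpanSingleton (A ⊗[k] Aᵐᵒᵖ) (V →ₗ[k] Box B (B.isHopfModule_tensor hV))
      ((TensorProduct.mk k (A ⊗[k] V) A).flip 1 ∘ₗ TensorProduct.mk k A V 1 :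
      V →ₗ[k] (A ⊗[k] V) ⊗[k] A))

theorem boxFreeMap_tmul (hV : IsCoaction ρV) (a : A) (b : Aᵐᵒᵖ) (v : V) :
    B.boxFreeMap hV ((a ⊗ₜ b) ⊗ₜ v) =
      (sw (Δ a) fun a₁ a₂ => sw (B.coact a₂) fun p h =>
        (a₁ ⊗ₜ[k] r.homAct ρV h v) ⊗ₜ[k] (p * b.unop) : (A ⊗[k] V) ⊗[k] A) := by
  change B.boxAct (tensorCoaction B.coact ρV) a
    (boxActRight b ((1 ⊗ₜ[k] v) ⊗ₜ[k] (1 : A))) = _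
  rw [boxActRight_tmul, boxAct_tmul]
  refine sw_congr fun a₁ a₂ => sw_congr fun p h => ?_
  rw [homAct_tmul, one_mul]
  simp_rw [homAct_algebra_one, ← TensorProduct.smul_tmul']
  have e : (sw (Δ h) fun h₁ h₂ => ε h₂ • (1 : A) ⊗ₜ[k] r.homAct ρV h₁ v) =
      (1 : A) ⊗ₜ[k] r.homAct ρV h v :=
    sw_counit_right (f := fun h => (1 : A) ⊗ₜ[k] r.homAct ρV h v) (by fun_prop) h
  rw [e]
  change ((a₁ • (1 : A)) ⊗ₜ[k] r.homAct ρV h v) ⊗ₜ[k] (p * b.unop) = _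
  rw [smul_eq_mul, mul_one]

variable (ρV) in
/-- The inverse of `boxFreeMap`. -/
def boxFreeInv : (A ⊗[k] V) ⊗[k] A →ₗ[k] (A ⊗[k] Aᵐᵒᵖ) ⊗[k] V :=
  (show Lin k fun t => sw t fun u y => sw u fun a v => sw (Δ a) fun a₁ a₂ => sw (B.coact a₂)
    fun p h => (a₁ ⊗ₜ[k] MulOpposite.opLinearEquiv k (B.antipode p * y)) ⊗ₜ[k] r.homAct ρV h v
      by fun_prop).toLin

theorem boxFreeInv_tmul (a : A) (v : V) (y : A) : B.boxFreeInv ρV ((a ⊗ₜ v) ⊗ₜ y) =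
    sw (Δ a) fun a₁ a₂ => sw (B.coact a₂) fun p h =>
      (a₁ ⊗ₜ[k] MulOpposite.opLinearEquiv k (B.antipode p * y)) ⊗ₜ[k] r.homAct ρV h v := by
  simp only [boxFreeInv, Lin.toLin_apply]
  rw [sw_tmul (by fun_prop) (by fun_prop), sw_tmul (by fun_prop) (by fun_prop)]

/-- The antipode undoes the left action on the generators (1 ⊗ v) ⊗ 1, as in the classical
identification of A ⊗ A with itself by a ⊗ y ↦ a₁ ⊗ a₂ y. -/
theorem boxFreeMap_bijective (hV : IsCoaction ρV) : Function.Bijective (B.boxFreeMap hV) := by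
  let f : (A ⊗[k] Aᵐᵒᵖ) ⊗[k] V →ₗ[k] (A ⊗[k] V) ⊗[k] A := (B.boxFreeMap hV).restrictScalars k
  have hf : ∀ (a y : A) (v : V), f ((a ⊗ₜ MulOpposite.opLinearEquiv k y) ⊗ₜ v) =
      sw (Δ a) fun a₁ a₂ => sw (B.coact a₂) fun p h =>
        (a₁ ⊗ₜ[k] r.homAct ρV h v) ⊗ₜ[k] (p * y) := fun a y v => B.boxFreeMap_tmul hV a _ v
  have h1 : f ∘ₗ B.boxFreeInv ρV = LinearMap.id := by
    ext a v y
    change f (B.boxFreeInv ρV ((a ⊗ₜ v) ⊗ₜ y)) = (a ⊗ₜ v) ⊗ₜ y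
    rw [boxFreeInv_tmul]
    simp_rw [map_sw', hf]
    exact B.sw_comul_act_cancel hV (F := fun a v y => (a ⊗ₜ[k] v) ⊗ₜ[k] y) (by fun_prop)
      (by fun_prop) (by fun_prop) a v y
  have h2 : B.boxFreeInv ρV ∘ₗ f = LinearMap.id := by
    ext a y v
    change B.boxFreeInv ρV (f ((a ⊗ₜ MulOpposite.opLinearEquiv k y.unop) ⊗ₜ v)) = (a ⊗ₜ y) ⊗ₜ v
    rw [hf]
    simp_rw [map_sw', boxFreeInv_tmul]
    exact B.sw_comul_act_cancel' hV (F := fun a v y =>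
      (a ⊗ₜ[k] MulOpposite.opLinearEquiv k y) ⊗ₜ[k] v) (by fun_prop)
      (by fun_prop) (by fun_prop) a v y.unop
  exact Function.bijective_iff_has_inverse.2
    ⟨B.boxFreeInv ρV, LinearMap.congr_fun h2, LinearMap.congr_fun h1⟩

/-- The bimodule attached to `A ⊗ V` is free on `V`. -/
def boxFreeEquiv (hV : IsCoaction ρV) :
    (A ⊗[k] Aᵐᵒᵖ) ⊗[k] V ≃ₗ[A ⊗[k] Aᵐᵒᵖ] Box B (B.isHopfModule_tensor hV) :=
  LinearEquiv.ofBijective _ (B.boxFreeMap_bijective hV)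

end Free

/-- The zigzag identity writes every v as a combination of the finitely many first components of
δ(1). -/
theorem _root_.BraidedHopf.HasLeftDual.finite {V : Type u} [AddCommGroup V] [Module k V]
    {ρV : V →ₗ[k] V ⊗[k] H} (h : HasLeftDual ρV) : Module.Finite k V := by
  classical
  obtain ⟨D, _, _, ρD, e, δ, -, -, -, h, -⟩ := h
  obtain ⟨s, hs⟩ := TensorProduct.exists_finset (δ 1)
  refine ⟨⟨s.image Prod.fst, ?_⟩⟩
  rw [eq_top_iff]
  intro v _
  have := LinearMap.congr_fun h v
  simp only [LinearMap.comp_apply, LinearEquiv.coe_coe, lid_symm_apply, LinearMap.rTensor_tmul,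
    hs, sum_tmul, map_sum, assoc_tmul, LinearMap.lTensor_tmul, rid_tmul, LinearMap.id_apply] at this
  rw [← this]
  refine Submodule.sum_mem _ fun p hp => Submodule.smul_mem _ _ (Submodule.subset_span ?_)
  simpa using ⟨p.2, hp⟩

/-- The functor `Box` preserves retractions by colinear maps, and `boxFreeEquiv` makes Box(A ⊗ V)
free on the finite-dimensional space V. -/
theorem box_finite_projective (hM : IsHopfModule B ρ) (h : IsFiniteRelativeProjective B ρ) :
    Module.Finite (A ⊗[k] Aᵐᵒᵖ) (Box B hM) ∧ Module.Projective (A ⊗[k] Aᵐᵒᵖ) (Box B hM) := by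
  obtain ⟨V, _, _, ρV, i, p, hV, hd, hi, hp, hip⟩ := h
  have := hd.finite
  have e : Module.Finite (A ⊗[k] Aᵐᵒᵖ) ((A ⊗[k] Aᵐᵒᵖ) ⊗[k] V) := inferInstance
  have e' : Module.Projective (A ⊗[k] Aᵐᵒᵖ) ((A ⊗[k] Aᵐᵒᵖ) ⊗[k] V) := inferInstance
  have f1 := Module.Finite.equiv (B.boxFreeEquiv hV)
  have f2 := Module.Projective.of_equiv (B.boxFreeEquiv hV)
  let i' : Box B hM →ₗ[A ⊗[k] Aᵐᵒᵖ] Box B (B.isHopfModule_tensor hV) := Box.map i hi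
  let p' : Box B (B.isHopfModule_tensor hV) →ₗ[A ⊗[k] Aᵐᵒᵖ] Box B hM := Box.map p hp
  have hip' : p' ∘ₗ i' = LinearMap.id := by
    refine LinearMap.ext fun x => ?_
    change ((p.restrictScalars k).rTensor A ∘ₗ (i.restrictScalars k).rTensor A) x = x
    rw [← LinearMap.rTensor_comp]
    have : p.restrictScalars k ∘ₗ i.restrictScalars k = LinearMap.id :=
      LinearMap.ext fun x => LinearMap.congr_fun hip x
    rw [this, LinearMap.rTensor_id]
    rfl
  exact ⟨Module.Finite.of_surjective p' fun x => ⟨i' x, LinearMap.congr_fun hip' x⟩,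
    Module.Projective.of_split i' p' hip'⟩

end BraidedHopfAlgebra
end BraidedHopf

-- Antimultiplicativity of the antipode of A, and the map ν.

namespace BraidedHopf

set_option linter.unusedSectionVars false

namespace BraidedHopfAlgebra
variable {k H A : Type u} [Field k] [Ring H] [HopfAlgebra k H] {r : UniversalRForm k H}
  [Ring A] [Algebra k A] [Coalgebra k A] (B : BraidedHopfAlgebra r A)
  {U : Type*} [AddCommGroup U] [Module k U]

local notation "Δ" => Coalgebra.comul (R := k)
local notation "ε" => Coalgebra.counit (R := k)
local notation "S" => HopfAlgebra.antipode k

/-- `a ⊗ y ↦ a₁ ⊗ S(a₂) y`. -/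
def comulAntipode : A ⊗[k] A →ₗ[k] A ⊗[k] A :=
  (show Lin k fun t => sw t fun a y => sw (Δ a) fun a₁ a₂ => a₁ ⊗ₜ[k] (B.antipode a₂ * y)
    by fun_prop).toLin

theorem comulAntipode_tmul (a y : A) : B.comulAntipode (a ⊗ₜ y) =
    sw (Δ a) fun a₁ a₂ => a₁ ⊗ₜ[k] (B.antipode a₂ * y) := by
  simp only [comulAntipode, Lin.toLin_apply]
  rw [sw_tmul (by fun_prop) (by fun_prop)]

/-- `a ⊗ y ↦ a₁ ⊗ a₂ y`. -/
def comulMul : A ⊗[k] A →ₗ[k] A ⊗[k] A :=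
  (show Lin k fun t => sw t fun a y => sw (Δ a) fun a₁ a₂ => a₁ ⊗ₜ[k] (a₂ * y)
    by fun_prop).toLin

theorem comulMul_tmul (a y : A) : comulMul (k := k) (a ⊗ₜ y) =
    sw (Δ a) fun a₁ a₂ => a₁ ⊗ₜ[k] (a₂ * y) := by
  simp only [comulMul, Lin.toLin_apply]
  rw [sw_tmul (by fun_prop) (by fun_prop)]

theorem comulMul_comulAntipode (t : A ⊗[k] A) : comulMul (B.comulAntipode t) = t := by
  rw [← LinearMap.comp_apply, ← LinearMap.id_apply (R := k) t, ← LinearMap.comp_apply]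
  congr 1
  ext a y
  change comulMul (B.comulAntipode (a ⊗ₜ y)) = a ⊗ₜ y
  simp_rw [comulAntipode_tmul, map_sw', comulMul_tmul, ← mul_assoc]
  rw [sw_comul_comul (B := fun x z w => x ⊗ₜ[k] (z * B.antipode w * y)) (by fun_prop)
    (by fun_prop) (by fun_prop)]
  have e : ∀ a₁ b : A, (sw (Δ b) fun z w => a₁ ⊗ₜ[k] (z * B.antipode w * y)) =
      ε b • a₁ ⊗ₜ[k] y := fun a₁ b => by
    rw [B.sw_mul_antipode (f := fun z => a₁ ⊗ₜ[k] (z * y)) (by fun_prop), one_mul]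
  simp_rw [e]
  exact sw_counit_right (f := fun a => a ⊗ₜ[k] y) (by fun_prop) a

theorem comulAntipode_comulMul (t : A ⊗[k] A) : B.comulAntipode (comulMul t) = t := by
  rw [← LinearMap.comp_apply, ← LinearMap.id_apply (R := k) t, ← LinearMap.comp_apply]
  congr 1
  ext a y
  change B.comulAntipode (comulMul (a ⊗ₜ y)) = a ⊗ₜ y
  simp_rw [comulMul_tmul, map_sw', comulAntipode_tmul, ← mul_assoc]
  rw [sw_comul_comul (B := fun x z w => x ⊗ₜ[k] (B.antipode z * w * y)) (by fun_prop)
    (by fun_prop) (by fun_prop)]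
  have e : ∀ a₁ b : A, (sw (Δ b) fun z w => a₁ ⊗ₜ[k] (B.antipode z * w * y)) =
      ε b • a₁ ⊗ₜ[k] y := fun a₁ b => by
    rw [B.sw_antipode_mul (f := fun z => a₁ ⊗ₜ[k] (z * y)) (by fun_prop), one_mul]
  simp_rw [e]
  exact sw_counit_right (f := fun a => a ⊗ₜ[k] y) (by fun_prop) a

/-- The bijection a ⊗ y ↦ a₁ ⊗ a₂ y turns multiplication on the first factor into the box action.
Read through the inverse, which contains the antipode, this yields the behaviour of c₁ ⊗ S(c₂) under
products. -/
theorem comulMul_mul (a : A) (t : A ⊗[k] A) :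
    comulMul ((LinearMap.mulLeft k a).rTensor A t) = B.boxAct B.coact a (comulMul t) := by
  simp only [← LinearMap.comp_apply]
  congr 1
  ext c y
  change comulMul ((a * c) ⊗ₜ y) = B.boxAct B.coact a (comulMul (c ⊗ₜ y))
  rw [comulMul_tmul, comulMul_tmul, B.sw_comul_mul (by fun_prop) (by fun_prop), map_sw']
  simp_rw [boxAct_tmul, mul_assoc]
  exact sw_comm _ _ _

theorem comulAntipode_boxAct (a : A) (t : A ⊗[k] A) :
    B.comulAntipode (B.boxAct B.coact a t) =
      (LinearMap.mulLeft k a).rTensor A (B.comulAntipode t) := by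
  conv_lhs => rw [← B.comulMul_comulAntipode t, ← comulMul_mul, comulAntipode_comulMul]

/-- The twisted multiplicativity of `c ↦ c₁ ⊗ S(c₂)`. -/
theorem sw_comul_mul_antipode {F : A → A → U} (h₁ : ∀ y, Lin k fun x => F x y)
    (h₂ : ∀ x, Lin k fun y => F x y) (a c : A) :
    (sw (Δ (a * c)) fun x y => F x (B.antipode y)) = sw (Δ a) fun a₁ b =>
      sw (B.coact b) fun p h => sw (Δ (r.homAct B.coact h c)) fun x y =>
        F (a₁ * x) (B.antipode y * B.antipode p) := by
  have e : ∀ (a c z : A), (sw (Δ c) fun x y => F (a * x) (B.antipode y * z)) =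
      sw (Δ a) fun a₁ b => sw (B.coact b) fun p h =>
        sw (Δ (a₁ * r.homAct B.coact h c)) fun x y => F x (B.antipode y * (p * z)) :=
    fun a c z => by
      have := congrArg (fun t => sw t F) (B.comulAntipode_boxAct a (c ⊗ₜ z))
      simp only [boxAct_tmul, map_sw', comulAntipode_tmul, LinearMap.rTensor_tmul] at this
      simp (disch := fun_prop) only [sw_sw, sw_tmul] at this
      exact this.symm
  simp_rw [e]
  have := B.sw_comul_act_cancel B.isCoaction (F := fun a c z => sw (Δ (a * c)) fun x y =>
    F x (B.antipode y * z)) (by fun_prop) (by fun_prop) (by fun_prop) a c 1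
  simp only [mul_one] at this
  exact this.symm

/-- The antipode is braided antimultiplicative: `S(a c) = r(a₁, c₁) S(c₀) S(a₀)`. -/
theorem antipode_mul (a c : A) : B.antipode (a * c) = sw (B.coact a) fun p h =>
    B.antipode (r.homAct B.coact h c) * B.antipode p := by
  have := B.sw_comul_mul_antipode (F := fun x y => ε x • y) (by fun_prop) (by fun_prop) a c
  rw [sw_counit_left (f := fun y => B.antipode y) (by fun_prop)] at this
  rw [this]
  simp_rw [B.counit_mul, mul_smul, ← smul_sw]
  have e : ∀ (p : A) (h : H), (sw (Δ (r.homAct B.coact h c)) fun x y =>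
      ε x • (B.antipode y * B.antipode p)) = B.antipode (r.homAct B.coact h c) * B.antipode p :=
    fun p h => sw_counit_left (f := fun y => B.antipode y * B.antipode p) (by fun_prop) _
  simp_rw [e]
  exact sw_counit_left (f := fun b => sw (B.coact b) fun p h =>
    B.antipode (r.homAct B.coact h c) * B.antipode p) (by fun_prop) a

theorem antipode_one : B.antipode 1 = 1 := by
  have := B.sw_antipode_mul (f := fun x => x) (by fun_prop) 1
  rw [B.comul_one, sw_tmul (by fun_prop) (by fun_prop), B.counit_one, mul_one, one_smul] at this
  exact this

/-- `sw`-form of `S(a c) = r(a₁, c₁) S(c₀) S(a₀)`. -/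
theorem sw_form_antipode {f : A → U} (hf : Lin k f) (a c : A) :
    (sw (B.coact a) fun p h => sw (B.coact c) fun q g =>
      r.form h g • f (B.antipode q * B.antipode p)) = f (B.antipode (a * c)) := by
  rw [antipode_mul, map_sw hf]
  simp_rw [r.homAct_apply, map_sw', sw_mul, map_sw hf, map_smul, smul_mul_assoc, hf.smul']

/-- The map `a ↦ a₀₁ ⊗ T(Y(a₀₂))`, where `T` is the operator attached to `S(a₁)`. -/
def nu (Y : A →ₗ[k] A) : A →ₗ[k] A ⊗[k] A :=
  (show Lin k fun a => sw (B.coact a) fun a₀ h => sw (Δ a₀) fun x y =>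
    x ⊗ₜ[k] r.opAct B.coact (S h) (Y y) by fun_prop).toLin

theorem sw_nu {Y : A →ₗ[k] A} {F : A → A → U} (h₁ : ∀ y, Lin k fun x => F x y)
    (h₂ : ∀ x, Lin k fun y => F x y) (a : A) :
    sw (B.nu Y a) F = sw (B.coact a) fun a₀ h => sw (Δ a₀) fun x y =>
      F x (r.opAct B.coact (S h) (Y y)) := by
  simp only [nu, Lin.toLin_apply]
  simp (disch := fun_prop) only [sw_sw, sw_tmul]

/-- Colinearity of Δ and Y turns the operator T into a scalar `twist` in the coaction legs of the
two factors, so that composites of maps ν reduce to identities in H. -/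
theorem sw_nu_twist {Y : A →ₗ[k] A} (hY : IsColinear B.coact B.coact Y)
    {F : A → A → U} (h₁ : ∀ y, Lin k fun x => F x y)
    (h₂ : ∀ x, Lin k fun y => F x y) (a : A) :
    sw (B.nu Y a) F = sw (Δ a) fun p s => sw (B.coact p) fun p₀ p₁ =>
      sw (B.coact s) fun s₀ s₁ => r.twist p₁ s₁ • F p₀ (Y s₀) := by
  rw [B.sw_nu h₁ h₂, B.sw_coact_comul (F := fun x y h => F x (r.opAct B.coact (S h) (Y y)))
    (by fun_prop) (by fun_prop) (by fun_prop)]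
  refine sw_congr fun p s => sw_congr fun p₀ p₁ => ?_
  have e : ∀ q₀ q₁, F p₀ (r.opAct B.coact (S (p₁ * q₁)) (Y q₀)) =
      sw (B.coact q₀) fun y z => r.form z (S (p₁ * q₁)) • F p₀ (Y y) := fun q₀ q₁ => by
    rw [← r.map_opAct hY, r.opAct_apply, map_sw', map_sw (h₂ p₀)]
    simp_rw [map_smul, (h₂ p₀).smul']
  simp_rw [e]
  rw [sw_coact_coact B.isCoaction (B := fun y z w => r.form z (S (p₁ * w)) • F p₀ (Y y))
    (by fun_prop) (by fun_prop) (by fun_prop)]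
  simp_rw [r.twist_apply, sw_smul_left]

theorem nu_one : B.nu B.antipode 1 = 1 ⊗ₜ 1 := by
  conv_lhs => rw [← sw_self (B.nu B.antipode 1)]
  rw [B.sw_nu (by fun_prop) (by fun_prop), coact_one, sw_tmul (by fun_prop) (by fun_prop),
    B.comul_one, sw_tmul (by fun_prop) (by fun_prop), B.antipode_one, HopfAlgebra.antipode_one,
    r.opAct_one B.isCoaction]

end BraidedHopfAlgebra
end BraidedHopf

-- Products and composites of the maps ν.

namespace BraidedHopf

set_option linter.unusedSectionVars false

namespace BraidedHopfAlgebra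
variable {k H A : Type u} [Field k] [Ring H] [HopfAlgebra k H] {r : UniversalRForm k H}
  [Ring A] [Algebra k A] [Coalgebra k A] (B : BraidedHopfAlgebra r A)
  {U : Type*} [AddCommGroup U] [Module k U]
  {V : Type*} [AddCommGroup V] [Module k V] {ρV : V →ₗ[k] V ⊗[k] H}

local notation "Δ" => Coalgebra.comul (R := k)
local notation "ε" => Coalgebra.counit (R := k)
local notation "S" => HopfAlgebra.antipode k

/-- `T(c₂) T(S c₁) = ε(c)`, `T(S c₂) T(c₁) = ε(c)`. -/
theorem sw_opAct_opAct_antipode (hV : IsCoaction ρV) (h : H) (v : V) {f : V → U} (hf : Lin k f) :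
    (sw (Δ h) fun x y => f (r.opAct ρV y (r.opAct ρV (S x) v))) = ε h • f v := by
  simp_rw [r.opAct_opAct hV]
  rw [BraidedHopf.sw_antipode_mul (f := fun h => f (r.opAct ρV h v)) (by fun_prop),
    r.opAct_one hV]

theorem sw_opAct_antipode_opAct (hV : IsCoaction ρV) (h : H) (v : V) {f : V → U} (hf : Lin k f) :
    (sw (Δ h) fun x y => f (r.opAct ρV (S y) (r.opAct ρV x v))) = ε h • f v := by
  simp_rw [r.opAct_opAct hV]
  rw [BraidedHopf.sw_mul_antipode (f := fun h => f (r.opAct ρV h v)) (by fun_prop),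
    r.opAct_one hV]

theorem sw_coact_form {f : V → U} (hf : Lin k f) (h : H) (v : V) :
    (sw (ρV v) fun x g => r.form g h • f x) = f (r.opAct ρV h v) := by
  rw [r.opAct_apply, map_sw hf]
  simp_rw [hf.smul']

/-- `ν(a₀ c)` with the operator of `a₁` applied to the second leg is `a₁ ν(c) S(a₂)`. -/
theorem sw_nu_mul {F : A → A → U} (h₁ : ∀ y, Lin k fun x => F x y)
    (h₂ : ∀ x, Lin k fun y => F x y) (a c : A) :
    (sw (B.coact a) fun a₀ h => sw (B.nu B.antipode (a₀ * c)) fun x y =>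
      F x (r.opAct B.coact h y)) =
    sw (Δ a) fun a₁ a₂ => sw (B.nu B.antipode c) fun x y => F (a₁ * x) (y * B.antipode a₂) := by
  have e1 : ∀ a₀ h, (sw (B.nu B.antipode (a₀ * c)) fun x y => F x (r.opAct B.coact h y)) =
      sw (B.coact a₀) fun b g => sw (B.coact c) fun c₀ c₁ => sw (Δ (b * c₀)) fun x y =>
        F x (r.opAct B.coact h (r.opAct B.coact (S g) (r.opAct B.coact (S c₁) (B.antipode y)))) :=
    fun a₀ h => by
      rw [B.sw_nu (by fun_prop) (by fun_prop), B.sw_coact_mul (by fun_prop) (by fun_prop)]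
      simp_rw [HopfAlgebra.antipode_mul_antidistrib, ← r.opAct_opAct B.isCoaction (S _) (S _)]
  simp_rw [e1]
  rw [sw_coact_coact B.isCoaction (B := fun b g h => sw (B.coact c) fun c₀ c₁ => sw (Δ (b * c₀))
    fun x y => F x (r.opAct B.coact h (r.opAct B.coact (S g) (r.opAct B.coact (S c₁)
      (B.antipode y))))) (by fun_prop) (by fun_prop) (by fun_prop)]
  -- The operators of the two coaction legs of a cancel; only the operator of c survives.
  have e2 : ∀ b g, (sw (Δ g) fun g h => sw (B.coact c) fun c₀ c₁ => sw (Δ (b * c₀))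
    fun x y => F x (r.opAct B.coact h (r.opAct B.coact (S g) (r.opAct B.coact (S c₁)
      (B.antipode y))))) = ε g • sw (B.coact c) fun c₀ c₁ => sw (Δ (b * c₀)) fun x y =>
        F x (r.opAct B.coact (S c₁) (B.antipode y)) := fun b g => by
    rw [sw_comm, sw_smul]
    refine sw_congr fun c₀ c₁ => ?_
    rw [sw_comm, sw_smul]
    exact sw_congr fun x y => sw_opAct_opAct_antipode B.isCoaction g _ (h₂ x)
  simp_rw [e2]
  rw [sw_coact_counit B.isCoaction (f := fun b => sw (B.coact c) fun c₀ c₁ => sw (Δ (b * c₀))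
    fun x y => F x (r.opAct B.coact (S c₁) (B.antipode y))) (by fun_prop)]
  -- The braiding in `sw_comul_mul_antipode` makes a leg of c act on S(b). Distributing the operator
  -- of S(c₁) over the product supplies an inverse operator on that factor, and the two cancel
  -- below.
  have e3 : ∀ c₀ c₁, (sw (Δ (a * c₀)) fun x y => F x (r.opAct B.coact (S c₁) (B.antipode y))) =
      sw (Δ a) fun a₁ b => sw (B.coact c₀) fun u g => sw (Δ u) fun x y => sw (Δ c₁) fun d₁ d₂ =>
        F (a₁ * x) (r.opAct B.coact (S d₂) (B.antipode y) *
          r.opAct B.coact (S d₁) (r.opAct B.coact g (B.antipode b))) :=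
    fun c₀ c₁ => by
      rw [B.sw_comul_mul_antipode (F := fun x y => F x (r.opAct B.coact (S c₁) y)) (by fun_prop)
        (by fun_prop)]
      refine sw_congr fun a₁ b => ?_
      have e : ∀ h, (r.homAct B.coact h c₀) = sw (B.coact c₀) fun u g => r.form h g • u :=
        fun h => r.homAct_apply _ _ _
      simp_rw [e]
      simp (disch := fun_prop) only [map_sw', sw_sw]
      refine (sw_comm _ _ _).trans (sw_congr fun u g => ?_)
      have e : ∀ p h, (sw (Δ (r.form h g • u)) fun x y =>
          F (a₁ * x) (r.opAct B.coact (S c₁) (B.antipode y * B.antipode p))) = r.form h g •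
          sw (Δ u) fun x y => F (a₁ * x) (r.opAct B.coact (S c₁) (B.antipode y * B.antipode p)) :=
        fun p h => Lin.smul' (f := fun u => sw (Δ u) fun x y =>
          F (a₁ * x) (r.opAct B.coact (S c₁) (B.antipode y * B.antipode p))) (by fun_prop) _ _
      simp_rw [e]
      rw [sw_coact_form (f := fun p => sw (Δ u) fun x y =>
        F (a₁ * x) (r.opAct B.coact (S c₁) (B.antipode y * B.antipode p))) (by fun_prop)]
      refine sw_congr fun x y => ?_
      rw [B.opAct_mul, map_sw (h₂ (a₁ * x)),
        sw_comul_antipode (k := k) (by fun_prop) (by fun_prop), r.map_opAct B.antipode_colinear]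
  simp_rw [e3]
  refine (sw_comm _ _ _).trans (sw_congr fun a₁ b => ?_)
  rw [sw_coact_coact B.isCoaction (B := fun u g h => sw (Δ u) fun x y => sw (Δ h) fun d₁ d₂ =>
        F (a₁ * x) (r.opAct B.coact (S d₂) (B.antipode y) *
          r.opAct B.coact (S d₁) (r.opAct B.coact g (B.antipode b)))) (by fun_prop) (by fun_prop)
          (by fun_prop), B.sw_nu (by fun_prop) (by fun_prop)]
  refine sw_congr fun u C => (sw_comm _ _ _).trans (sw_congr fun x y => ?_)
  rw [← sw_comul_comul (B := fun g d₁ d₂ => F (a₁ * x) (r.opAct B.coact (S d₂) (B.antipode y) *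
          r.opAct B.coact (S d₁) (r.opAct B.coact g (B.antipode b)))) (by fun_prop) (by fun_prop)
          (by fun_prop)]
  have e : ∀ D d₂ : H, (sw (Δ D) fun g d₁ => F (a₁ * x) (r.opAct B.coact (S d₂) (B.antipode y) *
          r.opAct B.coact (S d₁) (r.opAct B.coact g (B.antipode b)))) = ε D •
          F (a₁ * x) (r.opAct B.coact (S d₂) (B.antipode y) * B.antipode b) := fun D d₂ =>
    sw_opAct_antipode_opAct B.isCoaction D (B.antipode b)
      (f := fun z => F (a₁ * x) (r.opAct B.coact (S d₂) (B.antipode y) * z)) (by fun_prop)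
  simp_rw [e]
  exact sw_counit_left (f := fun d => F (a₁ * x) (r.opAct B.coact (S d) (B.antipode y) *
    B.antipode b)) (by fun_prop) C

/-- The hypothesis says that Y and Z are inverse for a braided opposite convolution. It is satisfied
by S and S² in either order, and it makes the second legs of the two maps ν multiply to 1. -/
theorem sw_nu_nu {Y Z : A →ₗ[k] A} (hY : IsColinear B.coact B.coact Y)
    (hZ : IsColinear B.coact B.coact Z)
    (hYZ : ∀ w : A, (sw (Δ w) fun q s => sw (B.coact q) fun q₀ q₁ => sw (B.coact s) fun s₀ s₁ =>
      r.form q₁ s₁ • (Y s₀ * Z q₀)) = ε w • 1)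
    {F : A → A → U} (h₁ : ∀ y, Lin k fun x => F x y) (h₂ : ∀ x, Lin k fun y => F x y) (a : A) :
    (sw (B.nu Y a) fun u y => sw (B.nu Z u) fun v z => F v (y * z)) = F a 1 := by
  rw [B.sw_nu_twist hY (by fun_prop) (by fun_prop)]
  simp (disch := fun_prop) only [B.sw_nu_twist hZ]
  simp_rw [smul_sw, smul_smul]
  have e1 : ∀ p s, (sw (B.coact p) fun p₀ p₁ => sw (B.coact s) fun s₀ s₁ =>
      sw (Δ p₀) fun x q => sw (B.coact x) fun x₀ x₁ => sw (B.coact q) fun q₀ q₁ =>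
        (r.twist p₁ s₁ * r.twist x₁ q₁) • F x₀ (Y s₀ * Z q₀)) =
      sw (Δ p) fun x q => sw (B.coact x) fun x₀ x₁ => sw (B.coact q) fun q' q₂ =>
        sw (B.coact q') fun q₀ q₁ => sw (B.coact s) fun s' s₂ => sw (B.coact s') fun s₀ s₁ =>
          (r.form q₁ s₁ * r.twist x₁ (q₂ * s₂)) • F x₀ (Y s₀ * Z q₀) := by
    intro p s
    refine (sw_congr fun p₀ p₁ => sw_comm _ _ _).trans ?_
    rw [B.sw_coact_comul (F := fun x q p₁ => sw (B.coact s) fun s₀ s₁ => sw (B.coact x)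
      fun x₀ x₁ => sw (B.coact q) fun q₀ q₁ =>
        (r.twist p₁ s₁ * r.twist x₁ q₁) • F x₀ (Y s₀ * Z q₀)) (by fun_prop) (by fun_prop)
        (by fun_prop)]
    refine sw_congr fun x q => ?_
    have e2 : ∀ x' g, (sw (B.coact q) fun q' h => sw (B.coact s) fun s₀ s₁ => sw (B.coact x')
        fun x₀ x₁ => sw (B.coact q') fun q₀ q₁ =>
        (r.twist (g * h) s₁ * r.twist x₁ q₁) • F x₀ (Y s₀ * Z q₀)) = sw (B.coact x')
        fun x₀ x₁ => sw (B.coact q) fun q₀ Q => sw (B.coact s) fun s₀ s₁ => sw (Δ Q) fun q₁ h =>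
        (r.twist (g * h) s₁ * r.twist x₁ q₁) • F x₀ (Y s₀ * Z q₀) := fun x' g => by
      refine ((sw_congr fun q' h => sw_comm _ _ _).trans (sw_comm _ _ _)).trans
        (sw_congr fun x₀ x₁ => ?_)
      refine (sw_congr fun q' h => sw_comm _ _ _).trans ?_
      rw [sw_coact_coact B.isCoaction (B := fun q₀ q₁ h => sw (B.coact s) fun s₀ s₁ =>
        (r.twist (g * h) s₁ * r.twist x₁ q₁) • F x₀ (Y s₀ * Z q₀)) (by fun_prop) (by fun_prop)
        (by fun_prop)]
      exact sw_congr fun _ _ => sw_comm _ _ _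
    simp_rw [e2]
    rw [sw_coact_coact B.isCoaction (B := fun x₀ x₁ g => sw (B.coact q) fun q₀ Q =>
      sw (B.coact s) fun s₀ s₁ => sw (Δ Q) fun q₁ h =>
        (r.twist (g * h) s₁ * r.twist x₁ q₁) • F x₀ (Y s₀ * Z q₀)) (by fun_prop) (by fun_prop)
        (by fun_prop)]
    refine sw_congr fun x₀ X => ?_
    refine (sw_comm _ _ _).trans ?_
    rw [sw_coact_coact B.isCoaction (B := fun q₀ q₁ q₂ => sw (B.coact s) fun s' s₂ =>
      sw (B.coact s') fun s₀ s₁ => (r.form q₁ s₁ * r.twist X (q₂ * s₂)) • F x₀ (Y s₀ * Z q₀))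
      (by fun_prop) (by fun_prop) (by fun_prop)]
    refine sw_congr fun q₀ Q => ?_
    refine (sw_comm _ _ _).trans ?_
    symm
    have e3 : ∀ q₁ q₂, (sw (B.coact s) fun s' s₂ =>
      sw (B.coact s') fun s₀ s₁ => (r.form q₁ s₁ * r.twist X (q₂ * s₂)) • F x₀ (Y s₀ * Z q₀)) =
        sw (B.coact s) fun s₀ s₁ => sw (Δ s₁) fun s₁ s₂ =>
          (r.form q₁ s₁ * r.twist X (q₂ * s₂)) • F x₀ (Y s₀ * Z q₀) := fun q₁ q₂ =>
      sw_coact_coact B.isCoaction (B := fun s₀ s₁ s₂ =>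
        (r.form q₁ s₁ * r.twist X (q₂ * s₂)) • F x₀ (Y s₀ * Z q₀)) (by fun_prop) (by fun_prop)
        (by fun_prop) s
    simp_rw [e3]
    refine (sw_comm _ _ _).trans (sw_congr fun s₀ s₁ => ?_)
    -- `twist_mul` trades the two twists for one twist in the product q₂ s₂ and the braiding factor
    -- r(q₁, s₁) required by `hYZ`.
    simp_rw [← sw_smul_left, r.twist_mul, mul_comm (r.twist (_ * _) _)]
  simp_rw [e1]
  rw [sw_comul_comul (B := fun x q s => sw (B.coact x) fun x₀ x₁ => sw (B.coact q) fun q' q₂ =>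
        sw (B.coact q') fun q₀ q₁ => sw (B.coact s) fun s' s₂ => sw (B.coact s') fun s₀ s₁ =>
          (r.form q₁ s₁ * r.twist x₁ (q₂ * s₂)) • F x₀ (Y s₀ * Z q₀)) (by fun_prop) (by fun_prop)
      (by fun_prop)]
  have e4 : ∀ x w, (sw (Δ w) fun q s => sw (B.coact x) fun x₀ x₁ => sw (B.coact q) fun q' q₂ =>
        sw (B.coact q') fun q₀ q₁ => sw (B.coact s) fun s' s₂ => sw (B.coact s') fun s₀ s₁ =>
          (r.form q₁ s₁ * r.twist x₁ (q₂ * s₂)) • F x₀ (Y s₀ * Z q₀)) = ε w • F x 1 := by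
    intro x w
    refine (sw_comm _ _ _).trans ?_
    have e5 : ∀ x₀ x₁, (sw (Δ w) fun q s => sw (B.coact q) fun q' q₂ =>
        sw (B.coact q') fun q₀ q₁ => sw (B.coact s) fun s' s₂ => sw (B.coact s') fun s₀ s₁ =>
          (r.form q₁ s₁ * r.twist x₁ (q₂ * s₂)) • F x₀ (Y s₀ * Z q₀)) =
          ε w • ε x₁ • F x₀ 1 := by
      intro x₀ x₁
      refine (sw_congr fun q s => sw_congr fun q' q₂ => sw_comm _ _ _).trans ?_
      have e6 := B.sw_coact_comul (F := fun q' s' g => sw (B.coact q') fun q₀ q₁ =>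
        sw (B.coact s') fun s₀ s₁ =>
          (r.form q₁ s₁ * r.twist x₁ g) • F x₀ (Y s₀ * Z q₀)) (by fun_prop) (by fun_prop)
        (by fun_prop) w
      refine e6.symm.trans ?_
      have e7 : ∀ w' g, (sw (Δ w') fun q' s' => sw (B.coact q') fun q₀ q₁ =>
          sw (B.coact s') fun s₀ s₁ => (r.form q₁ s₁ * r.twist x₁ g) • F x₀ (Y s₀ * Z q₀)) =
          ε w' • r.twist x₁ g • F x₀ 1 := fun w' g => by
        have := congrArg (fun t => r.twist x₁ g • F x₀ t) (hYZ w')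
        simp only [map_sw (h₂ x₀), smul_sw, (h₂ x₀).smul'] at this
        rw [smul_comm, ← this]
        simp_rw [smul_smul, mul_comm]
      simp_rw [e7]
      -- Once `hYZ` has collapsed the product, only the counit of w' is left; colinearity of the
      -- counit sets g = 1, where the twist is trivial.
      rw [B.sw_coact_counit_smul (f := fun g => r.twist x₁ g • F x₀ 1) (by fun_prop),
        r.twist_one_right]
    simp_rw [e5]
    rw [← sw_smul, sw_coact_counit B.isCoaction (f := fun x => F x 1) (by fun_prop)]
  simp_rw [e4]
  exact sw_counit_right (f := fun x => F x 1) (by fun_prop) a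

end BraidedHopfAlgebra
end BraidedHopf

-- Untwisting: A-linear maps versus twisted linear maps.

namespace BraidedHopf

set_option linter.unusedSectionVars false

namespace BraidedHopfAlgebra
variable {k H A : Type u} [Field k] [Ring H] [HopfAlgebra k H] {r : UniversalRForm k H}
  [Ring A] [Algebra k A] [Coalgebra k A] (B : BraidedHopfAlgebra r A)
  {U : Type*} [AddCommGroup U] [Module k U]
  {V : Type*} [AddCommGroup V] [Module k V] {ρV : V →ₗ[k] V ⊗[k] H}
  {M : Type u} [AddCommGroup M] [Module k M] [Module A M] [IsScalarTower k A M]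
  {ρ : M →ₗ[k] M ⊗[k] H}

local notation "Δ" => Coalgebra.comul (R := k)
local notation "ε" => Coalgebra.counit (R := k)
local notation "S" => HopfAlgebra.antipode k

/-- The square of the antipode. -/
abbrev antipodeSq : A →ₗ[k] A := B.antipode ∘ₗ B.antipode

theorem antipodeSq_colinear : IsColinear B.coact B.coact B.antipodeSq := by
  unfold IsColinear
  rw [← LinearMap.comp_assoc, B.antipode_colinear, LinearMap.comp_assoc, B.antipode_colinear,
    ← LinearMap.comp_assoc, ← LinearMap.rTensor_comp]

/-- The inner sum is S(q S(s)) by braided antimultiplicativity, so the antipode axiom, followed by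
S, gives the claim. -/
theorem antipodeSq_antipode (w : A) : (sw (Δ w) fun q s => sw (B.coact q) fun q₀ q₁ =>
    sw (B.coact s) fun s₀ s₁ => r.form q₁ s₁ • (B.antipodeSq s₀ * B.antipode q₀)) = ε w • 1 := by
  have e : ∀ q s, (sw (B.coact q) fun q₀ q₁ => sw (B.coact s) fun s₀ s₁ =>
      r.form q₁ s₁ • (B.antipodeSq s₀ * B.antipode q₀)) = B.antipode (q * B.antipode s) :=
    fun q s => by
      rw [← B.sw_form_antipode (f := fun x => x) (by fun_prop)]
      simp (disch := fun_prop) only [B.sw_coact_antipode]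
      rfl
  simp_rw [e]
  rw [B.sw_mul_antipode (f := fun x => B.antipode x) (by fun_prop), antipode_one]

theorem antipode_antipodeSq (w : A) : (sw (Δ w) fun q s => sw (B.coact q) fun q₀ q₁ =>
    sw (B.coact s) fun s₀ s₁ => r.form q₁ s₁ • (B.antipode s₀ * B.antipodeSq q₀)) = ε w • 1 := by
  have e : ∀ q s, (sw (B.coact q) fun q₀ q₁ => sw (B.coact s) fun s₀ s₁ =>
      r.form q₁ s₁ • (B.antipode s₀ * B.antipodeSq q₀)) = B.antipode (B.antipode q * s) :=
    fun q s => by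
      rw [← B.sw_form_antipode (f := fun x => x) (by fun_prop)]
      simp (disch := fun_prop) only [B.sw_coact_antipode]
      rfl
  simp_rw [e]
  rw [B.sw_antipode_mul (f := fun x => B.antipode x) (by fun_prop), antipode_one]

variable (ρV) in
/-- The operator `F ↦ (x ↦ ν(a) · (1 ⊗ b) for F(x₀) = a ⊗ b)`, twisted by the action of `x₁`. -/
def hatNu (Y : A →ₗ[k] A) (F : V →ₗ[k] A ⊗[k] A) : V →ₗ[k] A ⊗[k] A :=
  (show Lin k fun x => sw (ρV x) fun x₀ h => sw (F x₀) fun a b => sw (B.nu Y a) fun u v =>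
    u ⊗ₜ[k] (b * r.opAct B.coact h v) by fun_prop).toLin

theorem sw_hatNu {G : A → A → U} (h₁ : ∀ y, Lin k fun x => G x y)
    (h₂ : ∀ x, Lin k fun y => G x y) (Y : A →ₗ[k] A) (F : V →ₗ[k] A ⊗[k] A) (x : V) :
    sw (B.hatNu ρV Y F x) G = sw (ρV x) fun x₀ h => sw (F x₀) fun a b => sw (B.nu Y a) fun u v =>
      G u (b * r.opAct B.coact h v) := by
  simp only [hatNu, Lin.toLin_apply]
  simp (disch := fun_prop) only [sw_sw, sw_tmul]

/-- The operators T are multiplicative along the coproduct of H. The two factors coming from Y and Z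
thus merge into one T applied to a product, which `sw_nu_nu` evaluates to 1. -/
theorem hatNu_hatNu (hV : IsCoaction ρV) {Y Z : A →ₗ[k] A} (hY : IsColinear B.coact B.coact Y)
    (hZ : IsColinear B.coact B.coact Z)
    (hYZ : ∀ w : A, (sw (Δ w) fun q s => sw (B.coact q) fun q₀ q₁ => sw (B.coact s) fun s₀ s₁ =>
      r.form q₁ s₁ • (Y s₀ * Z q₀)) = ε w • 1) (F : V →ₗ[k] A ⊗[k] A) :
    B.hatNu ρV Z (B.hatNu ρV Y F) = F := by
  ext x
  conv_lhs => rw [← sw_self (B.hatNu ρV Z (B.hatNu ρV Y F) x)]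
  conv_rhs => rw [← sw_self (F x)]
  rw [B.sw_hatNu (by fun_prop) (by fun_prop)]
  simp (disch := fun_prop) only [B.sw_hatNu]
  rw [sw_coact_coact hV (B := fun x g h => sw (F x) fun a b => sw (B.nu Y a) fun u y =>
    sw (B.nu Z u) fun v z => v ⊗ₜ[k] (b * r.opAct B.coact g y * r.opAct B.coact h z))
    (by fun_prop) (by fun_prop) (by fun_prop)]
  rw [← sw_coact_counit hV (f := fun x => sw (F x) fun a b => a ⊗ₜ[k] b) (by fun_prop)]
  refine sw_congr fun x h => ?_
  refine (sw_comm _ _ _).trans ?_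
  rw [sw_smul]
  refine sw_congr fun a b => ?_
  have := B.sw_nu_nu hY hZ hYZ (F := fun v y => v ⊗ₜ[k] (b * r.opAct B.coact h y)) (by fun_prop)
    (by fun_prop) a
  rw [B.opAct_algebra_one, mul_smul_comm, mul_one, TensorProduct.tmul_smul] at this
  rw [← this]
  refine (sw_comm _ _ _).trans (sw_congr fun u y => (sw_comm _ _ _).trans (sw_congr fun v z => ?_))
  rw [B.opAct_mul, mul_sw, tmul_sw]
  simp_rw [mul_assoc]

theorem hatNu_injective (hV : IsCoaction ρV) :
    Function.Injective (B.hatNu ρV B.antipode) := fun F G h => by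
  have := congrArg (B.hatNu ρV B.antipodeSq) h
  rwa [B.hatNu_hatNu hV B.antipode_colinear B.antipodeSq_colinear B.antipode_antipodeSq,
    B.hatNu_hatNu hV B.antipode_colinear B.antipodeSq_colinear B.antipode_antipodeSq] at this

theorem hatNu_comp {W : Type*} [AddCommGroup W] [Module k W] {ρW : W →ₗ[k] W ⊗[k] H}
    {f : V →ₗ[k] W} (hf : IsColinear ρV ρW f) (Y : A →ₗ[k] A) (F : W →ₗ[k] A ⊗[k] A) :
    B.hatNu ρV Y (F ∘ₗ f) = B.hatNu ρW Y F ∘ₗ f := by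
  ext x
  conv_lhs => rw [← sw_self (B.hatNu ρV Y (F ∘ₗ f) x)]
  conv_rhs => rw [LinearMap.comp_apply, ← sw_self (B.hatNu ρW Y F (f x))]
  rw [B.sw_hatNu (by fun_prop) (by fun_prop), B.sw_hatNu (by fun_prop) (by fun_prop),
    hf.sw (by fun_prop) (by fun_prop)]
  rfl

/-- No linearity of `F` over A is assumed: the left side is what `hatNu` would give if F(a x) were a
F(x). Hence the identity serves both directions of the correspondence. -/
theorem hatNu_smul {G : A → A → U} (h₁ : ∀ y, Lin k fun x => G x y)
    (h₂ : ∀ x, Lin k fun y => G x y) (hV : IsCoaction ρV) (F : V →ₗ[k] A ⊗[k] A) (a : A) (x : V) :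
    (sw (B.coact a) fun a₀ g => sw (ρV x) fun x₀ h => sw (F x₀) fun c d =>
      sw (B.nu B.antipode (a₀ * c)) fun u v => G u (d * r.opAct B.coact (g * h) v)) =
    sw (Δ a) fun a₁ b => sw (B.coact b) fun p g =>
      sw (B.hatNu ρV B.antipode F (r.homAct ρV g x)) fun u v => G (a₁ * u) (v * B.antipode p) := by
  have e1 : (sw (B.coact a) fun a₀ g => sw (ρV x) fun x₀ h => sw (F x₀) fun c d =>
      sw (B.nu B.antipode (a₀ * c)) fun u v => G u (d * r.opAct B.coact (g * h) v)) =
      sw (ρV x) fun x₀ h => sw (F x₀) fun c d => sw (Δ a) fun a₁ b => sw (B.nu B.antipode c)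
        fun u v => G (a₁ * u) (d * r.opAct B.coact h (v * B.antipode b)) := by
    refine (sw_comm _ _ _).trans (sw_congr fun x₀ h => (sw_comm _ _ _).trans
      (sw_congr fun c d => ?_))
    simp_rw [← r.opAct_opAct B.isCoaction]
    exact B.sw_nu_mul (F := fun u v => G u (d * r.opAct B.coact h v)) (by fun_prop) (by fun_prop)
      a c
  rw [e1]
  have e2 : ∀ a₁ b, (sw (B.coact b) fun p g => sw (B.hatNu ρV B.antipode F (r.homAct ρV g x))
      fun u v => G (a₁ * u) (v * B.antipode p)) = sw (ρV x) fun x₀ h => sw (F x₀) fun c d =>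
        sw (B.nu B.antipode c) fun u v =>
        G (a₁ * u) (d * r.opAct B.coact h (v * B.antipode b)) := fun a₁ b => by
    have e3 : ∀ p g, (sw (B.hatNu ρV B.antipode F (r.homAct ρV g x))
        fun u v => G (a₁ * u) (v * B.antipode p)) = sw (ρV x) fun x₀ h => r.form g h •
          sw (B.hatNu ρV B.antipode F x₀) fun u v => G (a₁ * u) (v * B.antipode p) :=
      fun p g => by
        rw [r.homAct_apply]
        simp (disch := fun_prop) only [map_sw', sw_sw]
        refine sw_congr fun x₀ h => ?_
        rw [map_smul]
        exact Lin.smul' (f := fun t => sw t fun u v => G (a₁ * u) (v * B.antipode p))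
          (by fun_prop) _ _
    simp_rw [e3]
    refine (sw_comm _ _ _).trans ?_
    have e4 : ∀ x₀ h, (sw (B.coact b) fun p g => r.form g h •
          sw (B.hatNu ρV B.antipode F x₀) fun u v => G (a₁ * u) (v * B.antipode p)) =
        sw (ρV x₀) fun x₀ g => sw (F x₀) fun c d => sw (B.nu B.antipode c) fun u v =>
          G (a₁ * u) (d * r.opAct B.coact g v * r.opAct B.coact h (B.antipode b)) :=
      fun x₀ h => by
        rw [sw_coact_form (f := fun p => sw (B.hatNu ρV B.antipode F x₀) fun u v =>
          G (a₁ * u) (v * B.antipode p)) (by fun_prop), B.sw_hatNu (by fun_prop) (by fun_prop),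
          r.map_opAct B.antipode_colinear]
    simp_rw [e4]
    rw [sw_coact_coact hV (B := fun x₀ g h => sw (F x₀) fun c d => sw (B.nu B.antipode c) fun u v =>
          G (a₁ * u) (d * r.opAct B.coact g v * r.opAct B.coact h (B.antipode b))) (by fun_prop)
      (by fun_prop) (by fun_prop)]
    refine sw_congr fun x₀ h => (sw_comm _ _ _).trans (sw_congr fun c d => (sw_comm _ _ _).trans
      (sw_congr fun u v => ?_))
    rw [B.opAct_mul, mul_sw, map_sw (h₂ _)]
    simp_rw [mul_assoc]
  simp_rw [e2]
  symm
  exact (sw_comm _ _ _).trans (sw_congr fun x₀ h => sw_comm _ _ _)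

/-- `F` is `A`-linear for the action of `A` on the left factor of `A ⊗ A`. -/
def IsLeftLinear (F : M →ₗ[k] A ⊗[k] A) : Prop :=
  ∀ (a : A) (x : M), F (a • x) = (LinearMap.mulLeft k a).rTensor A (F x)

variable (ρ) in
/-- `φ(a x) = a₁ φ(η(x)) S(a₂)` for the outer bimodule structure of `A ⊗ A`. -/
def IsTwistedLinear (φ : M →ₗ[k] A ⊗[k] A) : Prop :=
  ∀ (a : A) (x : M), φ (a • x) = sw (Δ a) fun a₁ b => sw (B.coact b) fun p g =>
    sw (φ (r.homAct ρ g x)) fun u v => (a₁ * u) ⊗ₜ[k] (v * B.antipode p)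

theorem IsLeftLinear.hatNu (hM : IsHopfModule B ρ) {F : M →ₗ[k] A ⊗[k] A} (hF : IsLeftLinear F) :
    B.IsTwistedLinear ρ (B.hatNu ρ B.antipode F) := fun a x => by
  rw [← B.hatNu_smul (G := fun u v => u ⊗ₜ[k] v) (by fun_prop) (by fun_prop) hM.isCoaction]
  conv_lhs => rw [← sw_self (B.hatNu ρ B.antipode F (a • x))]
  rw [B.sw_hatNu (by fun_prop) (by fun_prop), B.sw_coact_smul hM (by fun_prop) (by fun_prop)]
  refine sw_congr fun a₀ g => sw_congr fun x₀ h => ?_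
  rw [hF, sw_rTensor _ (by fun_prop) (by fun_prop)]
  rfl

/-- The maps a ⊗ x ↦ F(a x) and a ⊗ x ↦ a F(x) live on the comodule A ⊗ M. Twisted linearity says
that they have the same image under `hatNu`, and `hatNu` is injective there. -/
theorem isLeftLinear_of_hatNu (hM : IsHopfModule B ρ) {F : M →ₗ[k] A ⊗[k] A}
    (hF : B.IsTwistedLinear ρ (B.hatNu ρ B.antipode F)) : IsLeftLinear F := by
  let F₁ : A ⊗[k] M →ₗ[k] A ⊗[k] A := F ∘ₗ TensorProduct.lift (Algebra.lsmul k k M).toLinearMap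
  let F₂ : A ⊗[k] M →ₗ[k] A ⊗[k] A :=
    (show Lin k fun t => sw t fun a x => sw (F x) fun c d => (a * c) ⊗ₜ[k] d by fun_prop).toLin
  have hF₂ : ∀ a x, F₂ (a ⊗ₜ x) = sw (F x) fun c d => (a * c) ⊗ₜ[k] d := fun a x => by
    simp only [F₂, Lin.toLin_apply]
    rw [sw_tmul (by fun_prop) (by fun_prop)]
  have hco := isCoaction_tensor B.isCoaction hM.isCoaction
  have e : B.hatNu (tensorCoaction B.coact ρ) B.antipode F₁ =
      B.hatNu (tensorCoaction B.coact ρ) B.antipode F₂ := by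
    rw [B.hatNu_comp hM.smul_colinear]
    ext a x
    change B.hatNu ρ B.antipode F (a • x) =
      B.hatNu (tensorCoaction B.coact ρ) B.antipode F₂ (a ⊗ₜ x)
    conv_rhs => rw [← sw_self (B.hatNu (tensorCoaction B.coact ρ) B.antipode F₂ (a ⊗ₜ x))]
    rw [hF a x, ← B.hatNu_smul (G := fun u v => u ⊗ₜ[k] v) (by fun_prop) (by fun_prop)
      hM.isCoaction, B.sw_hatNu (by fun_prop) (by fun_prop), tensorCoaction_tmul]
    simp (disch := fun_prop) only [sw_sw, sw_tmul, hF₂]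
  intro a x
  have := LinearMap.congr_fun (B.hatNu_injective hco e) (a ⊗ₜ x)
  rw [hF₂] at this
  rw [rTensor_eq_sw]
  exact this

end BraidedHopfAlgebra
end BraidedHopf

-- The dual of the induced bimodule.

namespace BraidedHopf

set_option linter.unusedSectionVars false

/-- The map `a ↦ a ⊗ ξ`. -/
def tensorRight {k A X : Type*} [Field k] [Ring A] [Algebra k A] [AddCommGroup X] [Module k X]
    (ξ : X) : A →ₗ[A] A ⊗[k] X where
  toFun a := a ⊗ₜ ξ
  map_add' a b := add_tmul a b ξ
  map_smul' a b := (TensorProduct.smul_tmul' a b ξ).symm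

@[simp] theorem tensorRight_apply {k A X : Type*} [Field k] [Ring A] [Algebra k A]
    [AddCommGroup X] [Module k X] (ξ : X) (a : A) : tensorRight (k := k) ξ a = a ⊗ₜ ξ := rfl

namespace BraidedHopfAlgebra
variable {k H A : Type u} [Field k] [Ring H] [HopfAlgebra k H] {r : UniversalRForm k H}
  [Ring A] [Algebra k A] [Coalgebra k A] (B : BraidedHopfAlgebra r A)
  {U : Type*} [AddCommGroup U] [Module k U]
  {V : Type*} [AddCommGroup V] [Module k V] {ρV : V →ₗ[k] V ⊗[k] H}
  {M : Type u} [AddCommGroup M] [Module k M] [Module A M] [IsScalarTower k A M]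
  {ρ : M →ₗ[k] M ⊗[k] H} {hM : IsHopfModule B ρ}

local notation "Δ" => Coalgebra.comul (R := k)
local notation "ε" => Coalgebra.counit (R := k)
local notation "S" => HopfAlgebra.antipode k
local notation "op" => MulOpposite.opLinearEquiv k

/-- The element `x ⊗ y` of the bimodule `M ⊗ A`. -/
def Box.mk (hM : IsHopfModule B ρ) (x : M) (y : A) : Box B hM := (x ⊗ₜ[k] y : M ⊗[k] A)

theorem Box.map_mk {N : Type u} [AddCommGroup N] [Module k N] [Module A N] [IsScalarTower k A N]
    {ρN : N →ₗ[k] N ⊗[k] H} {hN : IsHopfModule B ρN} (d : M →ₗ[A] N)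
    (hd : IsColinear ρ ρN (d.restrictScalars k)) (x : M) (y : A) :
    Box.map d hd (Box.mk B hM x y) = Box.mk B hN (d x) y := rfl

theorem Box.mk_eq_smul (x : M) (y : A) :
    Box.mk B hM x y = ((1 : A) ⊗ₜ[k] MulOpposite.op y) • Box.mk B hM x 1 := by
  refine Eq.trans ?_ (Box.one_tmul_smul (hM := hM) _ _).symm
  change (x ⊗ₜ[k] y : M ⊗[k] A) = boxActRight (MulOpposite.op y) (x ⊗ₜ[k] (1 : A))
  rw [boxActRight_tmul, one_mul]
  rfl

/-- The map of bimodules `x ⊗ y ↦ φ(x) (1 ⊗ y)` attached to a twisted linear `φ`. -/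
def boxLift (φ : M →ₗ[k] A ⊗[k] A) (hφ : B.IsTwistedLinear ρ φ) :
    Box B hM →ₗ[A ⊗[k] Aᵐᵒᵖ] A ⊗[k] Aᵐᵒᵖ :=
  have hf : ∀ x y, (show Lin k fun t => sw t fun x y => sw (φ x) fun u v => u ⊗ₜ[k] op (v * y)
      by fun_prop).toLin (x ⊗ₜ y) = sw (φ x) fun u v => u ⊗ₜ[k] op (v * y) := fun x y => by
    rw [Lin.toLin_apply, sw_tmul (by fun_prop) (by fun_prop)]
  Box.linearMap B hM (N := A ⊗[k] Aᵐᵒᵖ)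
    (show Lin k fun t => sw t fun x y => sw (φ x) fun u v => u ⊗ₜ[k] op (v * y)
      by fun_prop).toLin
    (fun a x y => by
      rw [boxAct_tmul]
      simp_rw [map_sw', hf]
      have e : ∀ a₁ p h, (sw (φ (a₁ • r.homAct ρ h x)) fun u v => u ⊗ₜ[k] op (v * (p * y))) =
          sw (Δ a₁) fun a₁ b => sw (B.coact b) fun q g => sw (φ (r.homAct ρ g (r.homAct ρ h x)))
            fun u v => (a₁ * u) ⊗ₜ[k] op (v * (B.antipode q * (p * y))) := fun a₁ p h => by
        rw [hφ]
        simp (disch := fun_prop) only [sw_sw, sw_tmul]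
        simp_rw [mul_assoc]
      simp_rw [e]
      -- The antipode produced by twisted linearity cancels the factor p that the left action puts
      -- into A.
      rw [B.sw_comul_act_cancel' hM.isCoaction (F := fun a x y => sw (φ x) fun u v =>
        (a * u) ⊗ₜ[k] op (v * y)) (by fun_prop) (by fun_prop) (by fun_prop), smul_eq_mul, mul_sw]
      simp_rw [Algebra.TensorProduct.tmul_mul_tmul, one_mul])
    (fun b x y => by
      rw [hf, hf, smul_eq_mul, mul_sw]
      simp_rw [Algebra.TensorProduct.tmul_mul_tmul, one_mul, ← mul_assoc]
      rfl)

theorem boxLift_tmul (φ : M →ₗ[k] A ⊗[k] A) (hφ : B.IsTwistedLinear ρ φ) (x : M) (y : A) :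
    (B.boxLift φ hφ : Box B hM →ₗ[A ⊗[k] Aᵐᵒᵖ] A ⊗[k] Aᵐᵒᵖ) (Box.mk B hM x y) =
      sw (φ x) fun u v => u ⊗ₜ[k] op (v * y) :=
  sw_tmul (B := fun x y => sw (φ x) fun u v => u ⊗ₜ[k] op (v * y)) (by fun_prop) (by fun_prop) x y

theorem boxLift_tmul_one (φ : M →ₗ[k] A ⊗[k] A) (hφ : B.IsTwistedLinear ρ φ) (x : M) :
    (B.boxLift φ hφ : Box B hM →ₗ[A ⊗[k] Aᵐᵒᵖ] A ⊗[k] Aᵐᵒᵖ) (Box.mk B hM x 1) =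
      (op).lTensor A (φ x) := by
  rw [boxLift_tmul]
  simp_rw [mul_one]
  exact (lTensor_eq_sw (op).toLinearMap (φ x)).symm

theorem box_hom_ext {N : Type*} [AddCommGroup N] [Module (A ⊗[k] Aᵐᵒᵖ) N]
    {f g : Box B hM →ₗ[A ⊗[k] Aᵐᵒᵖ] N}
    (h : ∀ x : M, f (Box.mk B hM x 1) = g (Box.mk B hM x 1)) : f = g := by
  have key : ∀ t : M ⊗[k] A, f t = g t := fun t => by
    induction t with
    | zero => exact (map_zero f).trans (map_zero g).symm
    | tmul x y =>
      change f (Box.mk B hM x y) = g (Box.mk B hM x y)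
      rw [Box.mk_eq_smul, map_smul, map_smul, h]
    | add s t hs ht =>
      exact (map_add f s t).trans ((congrArg₂ _ hs ht).trans (map_add g s t).symm)
  exact LinearMap.ext key

/-- The map φ is the restriction of g to M ⊗ 1, which generates the bimodule. -/
theorem exists_boxLift (g : Box B hM →ₗ[A ⊗[k] Aᵐᵒᵖ] A ⊗[k] Aᵐᵒᵖ) :
    ∃ (φ : M →ₗ[k] A ⊗[k] A) (hφ : B.IsTwistedLinear ρ φ), g = B.boxLift φ hφ := by
  let g' : M ⊗[k] A →ₗ[k] A ⊗[k] Aᵐᵒᵖ := g.restrictScalars k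
  have hgl : ∀ a t, g' (B.boxAct ρ a t) = (a ⊗ₜ 1) * g' t := fun a t =>
    (congrArg g (Box.tmul_one_smul (hM := hM) a t).symm).trans (map_smul g _ _)
  have hgr : ∀ b t, g' (boxActRight (op b) t) = (1 ⊗ₜ op b) * g' t := fun b t =>
    (congrArg g (Box.one_tmul_smul (hM := hM) (op b) t).symm).trans (map_smul g _ _)
  let φ : M →ₗ[k] A ⊗[k] A := ((op).symm.lTensor A).toLinearMap ∘ₗ g' ∘ₗ
    (TensorProduct.mk k M A).flip 1
  have hφ : ∀ x, g' (x ⊗ₜ 1) = (op).lTensor A (φ x) := fun x =>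
    (((op).lTensor A).apply_symm_apply (g' (x ⊗ₜ 1))).symm
  have hφ' : ∀ x y, g' (x ⊗ₜ y) = sw (φ x) fun u v => u ⊗ₜ[k] op (v * y) := fun x y => by
    have e : (x ⊗ₜ[k] y : M ⊗[k] A) = boxActRight (op y) (x ⊗ₜ[k] (1 : A)) := by
      rw [boxActRight_tmul, one_mul]; rfl
    rw [e, hgr, hφ]
    change _ * (op).toLinearMap.lTensor A (φ x) = _
    rw [lTensor_eq_sw, mul_sw]
    simp_rw [Algebra.TensorProduct.tmul_mul_tmul, one_mul]
    rfl
  have hφt : B.IsTwistedLinear ρ φ := fun a x => by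
    apply ((op).lTensor A).injective
    rw [← hφ]
    -- This rewrites (a x) ⊗ 1 as a₁ · (η(x) ⊗ S(a₂)), to which the bimodule linearity of g applies.
    have := B.sw_comul_act_cancel hM.isCoaction (F := fun a x y => g' ((a • x) ⊗ₜ y)) (by fun_prop)
      (by fun_prop) (by fun_prop) a x 1
    rw [← this]
    have e : ∀ a₁ p h, (sw (Δ a₁) fun a₁₁ a₁₂ => sw (B.coact a₁₂) fun q g =>
        g' ((a₁₁ • r.homAct ρ g (r.homAct ρ h x)) ⊗ₜ[k] (q * (B.antipode p * 1)))) =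
        sw (φ (r.homAct ρ h x)) fun u v => (a₁ * u) ⊗ₜ[k] op (v * B.antipode p) :=
      fun a₁ p h => by
        have := hgl a₁ (r.homAct ρ h x ⊗ₜ (B.antipode p))
        rw [boxAct_tmul, hφ', mul_sw] at this
        simp_rw [map_sw', Algebra.TensorProduct.tmul_mul_tmul, one_mul] at this
        rw [← this]
        simp_rw [mul_one]
    simp_rw [e]
    change _ = (op).toLinearMap.lTensor A _
    simp_rw [map_sw']
    rfl
  refine ⟨φ, hφt, B.box_hom_ext fun x => ?_⟩
  rw [boxLift_tmul_one]
  exact hφ x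

/-- The bimodule map `M ⊗ A → A ⊗ A` attached to an `A`-linear map `F : M → A ⊗ A`. -/
def boxDual (hM : IsHopfModule B ρ) (F : M →ₗ[A] A ⊗[k] A) :
    Box B hM →ₗ[A ⊗[k] Aᵐᵒᵖ] A ⊗[k] Aᵐᵒᵖ :=
  B.boxLift (B.hatNu ρ B.antipode (F.restrictScalars k))
    (IsLeftLinear.hatNu B hM fun a x => by
      rw [LinearMap.restrictScalars_apply, map_smul]
      rfl)

theorem boxDual_tmul_one (F : M →ₗ[A] A ⊗[k] A) (x : M) :
    B.boxDual hM F (Box.mk B hM x 1) =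
      (op).lTensor A (B.hatNu ρ B.antipode (F.restrictScalars k) x) :=
  B.boxLift_tmul_one _ _ x

theorem boxDual_injective : Function.Injective (B.boxDual hM) := fun F G h => by
  have : B.hatNu ρ B.antipode (F.restrictScalars k) =
      B.hatNu ρ B.antipode (G.restrictScalars k) := by
    ext x
    apply ((op).lTensor A).injective
    rw [← boxDual_tmul_one B (hM := hM), ← boxDual_tmul_one B (hM := hM), h]
  have := B.hatNu_injective hM.isCoaction this
  exact LinearMap.ext fun x => LinearMap.congr_fun this x

/-- The preimage is `hatNu` for S² applied to φ; it is A-linear because applying `hatNu` for S gives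
back the twisted linear φ. -/
theorem boxDual_surjective : Function.Surjective (B.boxDual hM) := fun g => by
  obtain ⟨φ, hφ, rfl⟩ := B.exists_boxLift g
  have e : B.hatNu ρ B.antipode (B.hatNu ρ B.antipodeSq φ) = φ :=
    B.hatNu_hatNu hM.isCoaction B.antipodeSq_colinear B.antipode_colinear B.antipodeSq_antipode φ
  have hF : IsLeftLinear (B.hatNu ρ B.antipodeSq φ) :=
    B.isLeftLinear_of_hatNu hM (by rwa [e])
  refine ⟨⟨⟨B.hatNu ρ B.antipodeSq φ, map_add _⟩, hF⟩, B.box_hom_ext fun x => ?_⟩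
  rw [boxDual_tmul_one, boxLift_tmul_one]
  exact congrArg ((op).lTensor A) (LinearMap.congr_fun e x)

/-- Naturality in colinear maps is what makes `boxDual` an isomorphism of cochain complexes when
applied to a resolution. -/
theorem boxDual_comp {N : Type u} [AddCommGroup N] [Module k N] [Module A N] [IsScalarTower k A N]
    {ρN : N →ₗ[k] N ⊗[k] H} {hN : IsHopfModule B ρN} (d : M →ₗ[A] N)
    (hd : IsColinear ρ ρN (d.restrictScalars k)) (F : N →ₗ[A] A ⊗[k] A) :
    B.boxDual hM (F ∘ₗ d) = B.boxDual hN F ∘ₗ Box.map d hd :=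
  B.box_hom_ext fun x => by
    rw [boxDual_tmul_one, LinearMap.comp_apply, Box.map_mk, boxDual_tmul_one]
    congr 1
    exact LinearMap.congr_fun (B.hatNu_comp hd B.antipode (F.restrictScalars k)) x

theorem hatNu_add (F G : V →ₗ[k] A ⊗[k] A) (Y : A →ₗ[k] A) :
    B.hatNu ρV Y (F + G) = B.hatNu ρV Y F + B.hatNu ρV Y G := by
  ext x
  have e : ∀ F : V →ₗ[k] A ⊗[k] A, B.hatNu ρV Y F x = sw (ρV x) fun x₀ h => sw (F x₀)
      fun a b => sw (B.nu Y a) fun u v => u ⊗ₜ[k] (b * r.opAct B.coact h v) := fun F => rfl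
  rw [LinearMap.add_apply, e, e, e]
  exact Lin.add' (f := fun F : V →ₗ[k] A ⊗[k] A => sw (ρV x) fun x₀ h => sw (F x₀)
      fun a b => sw (B.nu Y a) fun u v => u ⊗ₜ[k] (b * r.opAct B.coact h v)) (by fun_prop) F G

theorem boxDual_add (F G : M →ₗ[A] A ⊗[k] A) :
    B.boxDual hM (F + G) = B.boxDual hM F + B.boxDual hM G :=
  B.box_hom_ext fun x => by
    rw [LinearMap.add_apply, boxDual_tmul_one, boxDual_tmul_one, boxDual_tmul_one, ← map_add,
      ← LinearMap.add_apply, ← hatNu_add]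
    rfl

end BraidedHopfAlgebra
end BraidedHopf

-- The coaction κ on homomorphisms.

namespace BraidedHopf

set_option linter.unusedSectionVars false

namespace BraidedHopfAlgebra
variable {k H A : Type u} [Field k] [Ring H] [HopfAlgebra k H] {r : UniversalRForm k H}
  [Ring A] [Algebra k A] [Coalgebra k A] (B : BraidedHopfAlgebra r A)
  {U : Type*} [AddCommGroup U] [Module k U]
  {M : Type u} [AddCommGroup M] [Module k M] [Module A M] [IsScalarTower k A M]
  {ρ : M →ₗ[k] M ⊗[k] H} {hM : IsHopfModule B ρ}
  {N : Type u} [AddCommGroup N] [Module k N] [Module A N] [IsScalarTower k A N]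
  {ρN : N →ₗ[k] N ⊗[k] H} {hN : IsHopfModule B ρN}
  {L : Type u} [AddCommGroup L] [Module k L] [Module A L] [IsScalarTower k A L]
  {ρL : L →ₗ[k] L ⊗[k] H} {hL : IsHopfModule B ρL}

local notation "Δ" => Coalgebra.comul (R := k)
local notation "ε" => Coalgebra.counit (R := k)
local notation "S" => HopfAlgebra.antipode k
local notation "op" => MulOpposite.opLinearEquiv k

/-- The map `x ↦ f(x₀)₀ ⊗ S⁻¹(x₁) f(x₀)₁` attached to an `A`-linear map `f`. -/
def homCoact (hM : IsHopfModule B ρ) (hN : IsHopfModule B ρN) (f : M →ₗ[A] N) :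
    M →ₗ[A] N ⊗[k] H :=
  let F : M →ₗ[k] N ⊗[k] H := (show Lin k fun x => sw (ρ x) fun x₀ x₁ =>
    sw (ρN (f.restrictScalars k x₀)) fun y₀ y₁ => y₀ ⊗ₜ[k] (r.antipodeInv x₁ * y₁)
      by fun_prop).toLin
  { F with
    map_smul' := fun a x => by
      change (sw (ρ (a • x)) fun x₀ x₁ => sw (ρN (f.restrictScalars k x₀)) fun y₀ y₁ =>
        y₀ ⊗ₜ[k] (r.antipodeInv x₁ * y₁)) = a • sw (ρ x) fun x₀ x₁ =>
          sw (ρN (f.restrictScalars k x₀)) fun y₀ y₁ => y₀ ⊗ₜ[k] (r.antipodeInv x₁ * y₁)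
      rw [B.sw_coact_smul hM (by fun_prop) (by fun_prop), smul_sw, sw_comm]
      refine sw_congr fun x₀ x₁ => ?_
      simp_rw [LinearMap.restrictScalars_apply, map_smul]
      simp (disch := fun_prop) only [B.sw_coact_smul hN]
      rw [sw_coact_coact B.isCoaction (B := fun a g h => sw (ρN (f x₀)) fun y₀ y₁ =>
        (a • y₀) ⊗ₜ[k] (r.antipodeInv (h * x₁) * (g * y₁))) (by fun_prop) (by fun_prop)
        (by fun_prop)]
      -- The coaction of a enters once through S⁻¹ and once directly; S⁻¹(h₂) h₁ collapses, which is
      -- why κ(f) is A-linear for A acting on the first factor only.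
      have e : ∀ (b : A) (h : H), (sw (Δ h) fun g h => sw (ρN (f x₀)) fun y₀ y₁ =>
          (b • y₀) ⊗ₜ[k] (r.antipodeInv (h * x₁) * (g * y₁))) = ε h • sw (ρN (f x₀))
            fun y₀ y₁ => (b • y₀) ⊗ₜ[k] (r.antipodeInv x₁ * y₁) := fun b h => by
        refine (sw_comm _ _ _).trans ?_
        rw [sw_smul]
        refine sw_congr fun y₀ y₁ => ?_
        have := r.sw_antipodeInv_mul (f := fun t => (b • y₀) ⊗ₜ[k] (r.antipodeInv x₁ * t * y₁))
          (by fun_prop) h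
        rw [mul_one] at this
        rw [← this]
        simp_rw [r.antipodeInv_mul, mul_assoc]
      simp_rw [e]
      rw [sw_coact_counit B.isCoaction (f := fun a => sw (ρN (f x₀)) fun y₀ y₁ =>
        (a • y₀) ⊗ₜ[k] (r.antipodeInv x₁ * y₁)) (by fun_prop), smul_sw]
      rfl }

theorem homCoact_apply (f : M →ₗ[A] N) (x : M) : B.homCoact hM hN f x = sw (ρ x) fun x₀ x₁ =>
    sw (ρN (f x₀)) fun y₀ y₁ => y₀ ⊗ₜ[k] (r.antipodeInv x₁ * y₁) := rfl

theorem sw_homCoact {G : N → H → U} (h₁ : ∀ y, Lin k fun x => G x y)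
    (h₂ : ∀ x, Lin k fun y => G x y) (f : M →ₗ[A] N) (x : M) :
    sw (B.homCoact hM hN f x) G = sw (ρ x) fun x₀ x₁ => sw (ρN (f.restrictScalars k x₀))
      fun y₀ y₁ => G y₀ (r.antipodeInv x₁ * y₁) := by
  rw [homCoact_apply]
  simp (disch := fun_prop) only [sw_sw, sw_tmul]
  rfl

theorem homCoact_comp (f : N →ₗ[A] L) (d : M →ₗ[A] N)
    (hd : IsColinear ρ ρN (d.restrictScalars k)) :
    B.homCoact hM hL (f ∘ₗ d) = B.homCoact hN hL f ∘ₗ d := by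
  ext x
  have := hd.sw (B := fun x₀ x₁ => sw (ρL (f.restrictScalars k x₀)) fun y₀ y₁ =>
    y₀ ⊗ₜ[k] (r.antipodeInv x₁ * y₁)) (by fun_prop) (by fun_prop) x
  exact this.symm

theorem homCoact_add (f g : M →ₗ[A] N) :
    B.homCoact hM hN (f + g) = B.homCoact hM hN f + B.homCoact hM hN g := by
  ext x
  exact Lin.add' (f := fun F : M →ₗ[k] N => sw (ρ x) fun x₀ x₁ => sw (ρN (F x₀)) fun y₀ y₁ =>
    y₀ ⊗ₜ[k] (r.antipodeInv x₁ * y₁)) (by fun_prop) (f.restrictScalars k) (g.restrictScalars k)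

theorem homCoact_smul (c : k) (f : M →ₗ[A] N) :
    B.homCoact hM hN (c • f) = c • B.homCoact hM hN f := by
  ext x
  exact Lin.smul' (f := fun F : M →ₗ[k] N => sw (ρ x) fun x₀ x₁ => sw (ρN (F x₀)) fun y₀ y₁ =>
    y₀ ⊗ₜ[k] (r.antipodeInv x₁ * y₁)) (by fun_prop) c (f.restrictScalars k)

/-- `κ` composed with a colinear map `p`. -/
theorem homCoact_colinear_comp (f : M →ₗ[A] N) (p : N →ₗ[A] L)
    (hp : IsColinear ρN ρL (p.restrictScalars k)) :
    B.homCoact hM hL (p ∘ₗ f) =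
      TensorProduct.AlgebraTensorModule.map p LinearMap.id ∘ₗ B.homCoact hM hN f := by
  ext x
  change (sw (ρ x) fun x₀ x₁ => sw (ρL (p.restrictScalars k (f x₀))) fun y₀ y₁ =>
    y₀ ⊗ₜ[k] (r.antipodeInv x₁ * y₁)) = (p.restrictScalars k).rTensor H (B.homCoact hM hN f x)
  rw [homCoact_apply]
  simp_rw [map_sw', LinearMap.rTensor_tmul]
  exact sw_congr fun x₀ x₁ => hp.sw (by fun_prop) (by fun_prop) _

/-- The map `n ⊗ h ↦ (1 ⊗ h) F(n)`. -/
def mulCoact {X : Type u} [AddCommGroup X] [Module k X] [Module A X] [IsScalarTower k A X]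
    (F : N →ₗ[A] X ⊗[k] H) : N ⊗[k] H →ₗ[A] X ⊗[k] H :=
  TensorProduct.AlgebraTensorModule.lift
    { toFun := fun n =>
        (show Lin k fun h => sw (F.restrictScalars k n) fun y g => y ⊗ₜ[k] (h * g)
          by fun_prop).toLin
      map_add' := fun m n => by
        ext h
        exact Lin.add' (f := fun n => sw (F.restrictScalars k n) fun y g => y ⊗ₜ[k] (h * g))
          (by fun_prop) m n
      map_smul' := fun a n => by
        ext h
        change (sw (F (a • n)) fun y g => y ⊗ₜ[k] (h * g)) =
          a • sw (F n) fun y g => y ⊗ₜ[k] (h * g)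
        rw [map_smul, smul_sw]
        have : a • F n = (Algebra.lsmul k k X a).rTensor H (F n) := rfl
        rw [this, sw_rTensor _ (by fun_prop) (by fun_prop)]
        rfl }

theorem mulCoact_tmul {X : Type u} [AddCommGroup X] [Module k X] [Module A X]
    [IsScalarTower k A X] (F : N →ₗ[A] X ⊗[k] H) (n : N) (h : H) :
    mulCoact F (n ⊗ₜ h) = sw (F n) fun y g => y ⊗ₜ[k] (h * g) := rfl

/-- `κ` of a composite. -/
theorem homCoact_comp' (φ : M →ₗ[A] N) (f : N →ₗ[A] L) :
    B.homCoact hM hL (f ∘ₗ φ) = mulCoact (B.homCoact hN hL f) ∘ₗ B.homCoact hM hN φ := by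
  ext x
  rw [LinearMap.comp_apply, homCoact_apply, homCoact_apply]
  have lin : Lin k fun t => mulCoact (B.homCoact hN hL f) t :=
    Lin.coe ((mulCoact (B.homCoact hN hL f)).restrictScalars k)
  simp_rw [map_sw lin, mulCoact_tmul]
  refine sw_congr fun x₀ x₁ => ?_
  have e : ∀ (y : N) (h : H), (sw (B.homCoact hN hL f y) fun y g => y ⊗ₜ[k] (h * g)) =
      sw (ρN y) fun y g => sw (ρL (f.restrictScalars k y)) fun z₀ z₁ =>
        z₀ ⊗ₜ[k] (h * (r.antipodeInv g * z₁)) := fun y h =>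
    B.sw_homCoact (by fun_prop) (by fun_prop) _ _
  simp_rw [e]
  rw [sw_coact_coact hN.isCoaction (B := fun y₀ g h => sw (ρL (f.restrictScalars k y₀))
    fun z₀ z₁ => z₀ ⊗ₜ[k] (r.antipodeInv x₁ * h * (r.antipodeInv g * z₁))) (by fun_prop)
    (by fun_prop) (by fun_prop)]
  refine (sw_coact_counit hN.isCoaction (f := fun y => sw (ρL (f.restrictScalars k y))
    fun z₀ z₁ => z₀ ⊗ₜ[k] (r.antipodeInv x₁ * z₁)) (by fun_prop) (φ x₀)).symm.trans ?_
  refine sw_congr fun y h => ?_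
  rw [sw_smul]
  symm
  refine (sw_comm _ _ _).trans (sw_congr fun z₀ z₁ => ?_)
  have := r.sw_mul_antipodeInv (f := fun t => z₀ ⊗ₜ[k] (r.antipodeInv x₁ * t * z₁))
    (by fun_prop) h
  rw [mul_one] at this
  rw [← this]
  simp_rw [mul_assoc]

/-- Coassociativity of `κ`. -/
theorem homCoact_homCoact (hNH : IsHopfModule B (tensorCoaction ρN (trivialCoaction k H H)))
    (f : M →ₗ[A] N) (x : M) : B.homCoact hM hNH (B.homCoact hM hN f) x =
      sw (B.homCoact hM hN f x) fun n h => sw (Δ h) fun g h => (n ⊗ₜ[k] h) ⊗ₜ[k] g := by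
  rw [homCoact_apply]
  have e1 : ∀ (n : N) (t g : H), (sw (tensorCoaction ρN (trivialCoaction k H H) (n ⊗ₜ t))
      fun y₀ y₁ => y₀ ⊗ₜ[k] (g * y₁)) =
      sw (ρN n) fun n₀ n₁ => (n₀ ⊗ₜ[k] t) ⊗ₜ[k] (g * n₁) := fun n t g => by
    rw [tensorCoaction_tmul]
    simp (disch := fun_prop) only [sw_sw, sw_tmul, trivialCoaction, LinearMap.flip_apply,
      TensorProduct.mk_apply]
    simp_rw [mul_one]
  have e2 : ∀ x₀ x₁, (sw (tensorCoaction ρN (trivialCoaction k H H) (B.homCoact hM hN f x₀))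
      fun y₀ y₁ => y₀ ⊗ₜ[k] (r.antipodeInv x₁ * y₁)) = sw (ρ x₀) fun x₀ g =>
        sw (ρN (f.restrictScalars k x₀)) fun n t => sw (ρN n) fun n₀ n₁ =>
          (n₀ ⊗ₜ[k] (r.antipodeInv g * t)) ⊗ₜ[k] (r.antipodeInv x₁ * n₁) := fun x₀ x₁ => by
    conv_lhs => rw [← sw_self (B.homCoact hM hN f x₀)]
    simp_rw [map_sw']
    simp (disch := fun_prop) only [sw_sw, e1]
    rw [B.sw_homCoact (by fun_prop) (by fun_prop)]
  simp_rw [e2]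
  rw [sw_coact_coact hM.isCoaction (B := fun x₀ g h =>
        sw (ρN (f.restrictScalars k x₀)) fun n t => sw (ρN n) fun n₀ n₁ =>
          (n₀ ⊗ₜ[k] (r.antipodeInv g * t)) ⊗ₜ[k] (r.antipodeInv h * n₁)) (by fun_prop)
    (by fun_prop) (by fun_prop), B.sw_homCoact (by fun_prop) (by fun_prop)]
  refine sw_congr fun x₀ h => ?_
  have e3 : ∀ g h, (sw (ρN (f.restrictScalars k x₀)) fun n t => sw (ρN n) fun n₀ n₁ =>
          (n₀ ⊗ₜ[k] (r.antipodeInv g * t)) ⊗ₜ[k] (r.antipodeInv h * n₁)) =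
      sw (ρN (f.restrictScalars k x₀)) fun n t => sw (Δ t) fun s t =>
          (n ⊗ₜ[k] (r.antipodeInv g * t)) ⊗ₜ[k] (r.antipodeInv h * s) := fun g h =>
    sw_coact_coact hN.isCoaction (B := fun n s t =>
          (n ⊗ₜ[k] (r.antipodeInv g * t)) ⊗ₜ[k] (r.antipodeInv h * s)) (by fun_prop)
    (by fun_prop) (by fun_prop) _
  simp_rw [e3]
  refine (sw_comm _ _ _).trans (sw_congr fun n t => ?_)
  rw [BraidedHopf.sw_comul_mul (k := k) (by fun_prop) (by fun_prop),
    r.sw_comul_antipodeInv (by fun_prop) (by fun_prop)]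

end BraidedHopfAlgebra
end BraidedHopf

-- The two one-sided actions of A, transported through the duality.

namespace BraidedHopf

set_option linter.unusedSectionVars false

namespace BraidedHopfAlgebra
variable {k H A : Type u} [Field k] [Ring H] [HopfAlgebra k H] {r : UniversalRForm k H}
  [Ring A] [Algebra k A] [Coalgebra k A] (B : BraidedHopfAlgebra r A)
  {U : Type*} [AddCommGroup U] [Module k U]
  {M : Type u} [AddCommGroup M] [Module k M] [Module A M] [IsScalarTower k A M]
  {ρ : M →ₗ[k] M ⊗[k] H} {hM : IsHopfModule B ρ}

local notation "Δ" => Coalgebra.comul (R := k)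
local notation "ε" => Coalgebra.counit (R := k)
local notation "S" => HopfAlgebra.antipode k
local notation "op" => MulOpposite.opLinearEquiv k

/-- A linear map `L` on `A` is determined by `a ↦ (1 ⊗ T)(L(a₀))`, with `T` the operator of
`a₁`. -/
theorem ext_of_opAct {L L' : A →ₗ[k] A ⊗[k] A} (h : ∀ a, (sw (B.coact a) fun a₀ g =>
    (r.opAct B.coact g).lTensor A (L a₀)) = sw (B.coact a) fun a₀ g =>
    (r.opAct B.coact g).lTensor A (L' a₀)) : L = L' := by
  have key : ∀ (L : A →ₗ[k] A ⊗[k] A) (a : A), L a = sw (B.coact a) fun a₀ g =>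
      (r.opAct B.coact (S g)).lTensor A (sw (B.coact a₀) fun a₀ g =>
        (r.opAct B.coact g).lTensor A (L a₀)) := fun L a => by
    have e : ∀ (f g : A →ₗ[k] A) (t : A ⊗[k] A), f.lTensor A (g.lTensor A t) =
        sw t fun x y => x ⊗ₜ[k] f (g y) := fun f g t => by
      rw [lTensor_eq_sw, sw_lTensor _ (by fun_prop) (by fun_prop)]
    simp_rw [map_sw', e]
    rw [sw_coact_coact B.isCoaction (B := fun a g h => sw (L a) fun x y => x ⊗ₜ[k]
      r.opAct B.coact (S h) (r.opAct B.coact g y)) (by fun_prop) (by fun_prop) (by fun_prop)]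
    conv_lhs => rw [← sw_self (L a)]
    refine (sw_coact_counit B.isCoaction (f := fun a => sw (L a) fun x y => x ⊗ₜ[k] y)
      (by fun_prop) a).symm.trans (sw_congr fun a h => ?_)
    rw [sw_smul]
    symm
    refine (sw_comm _ _ _).trans (sw_congr fun x y => ?_)
    exact sw_opAct_antipode_opAct B.isCoaction h y (f := fun y => x ⊗ₜ[k] y) (by fun_prop)
  ext a
  rw [key L a, key L' a]
  simp_rw [h]

/-- Right multiplication by w on the first leg of ν(c) is absorbed into the argument of ν. By
`ext_of_opAct` it suffices to compare both sides after applying T; then `sw_nu_mul` pulls c out of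
ν, and what remains is `sw_nu_nu` for S² and S. -/
theorem sw_nu_nu_antipodeSq {F : A → A → U} (h₁ : ∀ y, Lin k fun x => F x y)
    (h₂ : ∀ x, Lin k fun y => F x y) (c w : A) :
    (sw (B.coact c) fun c₀ c₁ => sw (B.nu B.antipodeSq w) fun u v =>
      sw (B.nu B.antipode (c₀ * u)) fun y z => F y (r.opAct B.coact (S c₁) v * z)) =
    sw (B.nu B.antipode c) fun y z => F (y * w) z := by
  let L : A →ₗ[k] A ⊗[k] A := (show Lin k fun c => sw (B.coact c) fun c₀ c₁ =>
    sw (B.nu B.antipodeSq w) fun u v => sw (B.nu B.antipode (c₀ * u)) fun y z =>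
      y ⊗ₜ[k] (r.opAct B.coact (S c₁) v * z) by fun_prop).toLin
  let L' : A →ₗ[k] A ⊗[k] A := (show Lin k fun c => sw (B.nu B.antipode c) fun y z =>
    (y * w) ⊗ₜ[k] z by fun_prop).toLin
  have hL : ∀ c, L c = sw (B.coact c) fun c₀ c₁ =>
    sw (B.nu B.antipodeSq w) fun u v => sw (B.nu B.antipode (c₀ * u)) fun y z =>
      y ⊗ₜ[k] (r.opAct B.coact (S c₁) v * z) := fun c => rfl
  have hL' : ∀ c, L' c = sw (B.nu B.antipode c) fun y z => (y * w) ⊗ₜ[k] z := fun c => rfl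
  have e : L = L' := by
    refine B.ext_of_opAct fun a => ?_
    simp_rw [hL, hL', map_sw', LinearMap.lTensor_tmul]
    rw [sw_coact_coact B.isCoaction (B := fun a g h => sw (B.nu B.antipodeSq w) fun u v =>
      sw (B.nu B.antipode (a * u)) fun y z =>
        y ⊗ₜ[k] r.opAct B.coact h (r.opAct B.coact (S g) v * z)) (by fun_prop) (by fun_prop)
      (by fun_prop)]
    have e1 : ∀ a h, (sw (Δ h) fun g h => sw (B.nu B.antipodeSq w) fun u v =>
        sw (B.nu B.antipode (a * u)) fun y z =>
          y ⊗ₜ[k] r.opAct B.coact h (r.opAct B.coact (S g) v * z)) =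
        sw (B.nu B.antipodeSq w) fun u v => sw (B.nu B.antipode (a * u)) fun y z =>
          y ⊗ₜ[k] (v * r.opAct B.coact h z) := fun a h => by
      refine (sw_comm _ _ _).trans (sw_congr fun u v => (sw_comm _ _ _).trans
        (sw_congr fun y z => ?_))
      simp_rw [B.opAct_mul, tmul_sw]
      rw [← sw_comul_comul (B := fun g h h' => y ⊗ₜ[k] (r.opAct B.coact h
        (r.opAct B.coact (S g) v) * r.opAct B.coact h' z)) (by fun_prop) (by fun_prop)
        (by fun_prop)]
      have e2 : ∀ g h, (sw (Δ g) fun g g' => y ⊗ₜ[k] (r.opAct B.coact g'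
        (r.opAct B.coact (S g) v) * r.opAct B.coact h z)) =
          ε g • y ⊗ₜ[k] (v * r.opAct B.coact h z) := fun g h =>
        sw_opAct_opAct_antipode B.isCoaction g v (f := fun v => y ⊗ₜ[k] (v * r.opAct B.coact h z))
          (by fun_prop)
      simp_rw [e2]
      exact sw_counit_left (f := fun h => y ⊗ₜ[k] (v * r.opAct B.coact h z)) (by fun_prop) h
    simp_rw [e1]
    have e3 := fun u v => B.sw_nu_mul (F := fun y z => y ⊗ₜ[k] (v * z))
      (by fun_prop) (by fun_prop) a u
    refine (sw_comm _ _ _).trans ((sw_congr e3).trans ?_)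
    -- With c = 1 and ν(1) = 1 ⊗ 1 the right-hand side becomes a₁ w ⊗ S(a₂).
    have e4 := B.sw_nu_mul (F := fun y z => (y * w) ⊗ₜ[k] z) (by fun_prop) (by fun_prop) a 1
    rw [nu_one] at e4
    simp (disch := fun_prop) only [sw_tmul, mul_one, one_mul] at e4
    rw [e4]
    refine (sw_comm _ _ _).trans (sw_congr fun a₁ a₂ => ?_)
    simp_rw [← mul_assoc]
    have := B.sw_nu_nu B.antipodeSq_colinear B.antipode_colinear B.antipodeSq_antipode
      (F := fun y z => (a₁ * y) ⊗ₜ[k] (z * B.antipode a₂)) (by fun_prop) (by fun_prop) w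
    rw [one_mul] at this
    exact this
  have := congrArg (fun t => sw t F) (LinearMap.congr_fun e c)
  simp only [hL, hL'] at this
  simp (disch := fun_prop) only [sw_sw, sw_tmul] at this
  exact this

/-- The map `c ⊗ h ↦ c ν(w)₁ ⊗ T(ν(w)₂)`, with `T` the operator of `S(h)` and `ν` attached to the
square of the antipode. -/
def nuMul (w : A) : A ⊗[k] H →ₗ[A] A ⊗[k] A :=
  TensorProduct.AlgebraTensorModule.lift
    { toFun := fun c =>
        (show Lin k fun h => sw (B.nu B.antipodeSq w) fun u v =>
          (c * u) ⊗ₜ[k] r.opAct B.coact (S h) v by fun_prop).toLin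
      map_add' := fun m n => by
        ext h
        exact Lin.add' (f := fun c => sw (B.nu B.antipodeSq w) fun u v =>
          (c * u) ⊗ₜ[k] r.opAct B.coact (S h) v) (by fun_prop) m n
      map_smul' := fun a c => by
        ext h
        change (sw (B.nu B.antipodeSq w) fun u v =>
          (a * c * u) ⊗ₜ[k] r.opAct B.coact (S h) v) = a • sw (B.nu B.antipodeSq w) fun u v =>
          (c * u) ⊗ₜ[k] r.opAct B.coact (S h) v
        rw [smul_sw]
        simp_rw [mul_assoc]
        rfl }

theorem nuMul_tmul (w c : A) (h : H) : B.nuMul w (c ⊗ₜ h) = sw (B.nu B.antipodeSq w) fun u v =>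
    (c * u) ⊗ₜ[k] r.opAct B.coact (S h) v := rfl

/-- The action of w ⊗ 1 on the dual class of f cannot be expressed through f alone, since `hatNu`
involves the coaction of M; the correction is exactly the H-leg of κ(f). This is how the group-like
element enters the Nakayama automorphism. -/
theorem boxDual_nuMul (f : M →ₗ[A] A) (w : A) :
    B.boxDual hM (B.nuMul w ∘ₗ B.homCoact hM B.isHopfModule_self f) =
      LinearMap.toSpanSingleton (A ⊗[k] Aᵐᵒᵖ) (A ⊗[k] Aᵐᵒᵖ) (w ⊗ₜ 1) ∘ₗ
        B.boxDual hM (tensorRight (k := k) (1 : A) ∘ₗ f) := by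
  refine B.box_hom_ext fun x => ?_
  rw [LinearMap.comp_apply, boxDual_tmul_one, boxDual_tmul_one, LinearMap.toSpanSingleton_apply,
    smul_eq_mul]
  have e1 : (op).lTensor A
      (B.hatNu ρ B.antipode ((tensorRight (k := k) (1 : A) ∘ₗ f).restrictScalars k) x) *
      (w ⊗ₜ 1) = (op).lTensor A (sw (B.hatNu ρ B.antipode
        ((tensorRight (k := k) (1 : A) ∘ₗ f).restrictScalars k) x) fun u v => (u * w) ⊗ₜ[k] v) := by
    change (op).toLinearMap.lTensor A _ * _ = (op).toLinearMap.lTensor A _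
    rw [lTensor_eq_sw, sw_mul, map_sw']
    refine sw_congr fun u v => ?_
    rw [Algebra.TensorProduct.tmul_mul_tmul, mul_one]
    rfl
  rw [e1]
  congr 1
  conv_lhs => rw [← sw_self (B.hatNu ρ B.antipode _ x)]
  rw [B.sw_hatNu (by fun_prop) (by fun_prop), B.sw_hatNu (by fun_prop) (by fun_prop)]
  have e2 : ∀ x₀ h, (sw (((B.nuMul w ∘ₗ B.homCoact hM B.isHopfModule_self f).restrictScalars k) x₀)
      fun a b => sw (B.nu B.antipode a) fun y z => y ⊗ₜ[k] (b * r.opAct B.coact h z)) =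
      sw (ρ x₀) fun x₀ g => sw (B.coact (f.restrictScalars k x₀)) fun c c' =>
        sw (B.nu B.antipodeSq w) fun u v => sw (B.nu B.antipode (c * u)) fun y z =>
          y ⊗ₜ[k] (r.opAct B.coact g (r.opAct B.coact (S c') v) * r.opAct B.coact h z) :=
    fun x₀ h => by
      change sw (B.nuMul w (B.homCoact hM B.isHopfModule_self f x₀)) _ = _
      rw [homCoact_apply]
      have lin : Lin k fun t => B.nuMul w t := Lin.coe ((B.nuMul w).restrictScalars k)
      simp_rw [map_sw lin, nuMul_tmul]
      simp (disch := fun_prop) only [sw_sw, sw_tmul]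
      -- The antipode in `nuMul` undoes the S⁻¹ in κ and leaves an operator of the coaction leg g of
      -- x₀.
      simp_rw [HopfAlgebra.antipode_mul_antidistrib, r.antipode_antipodeInv,
        r.opAct_opAct B.isCoaction]
      rfl
  simp_rw [e2]
  rw [sw_coact_coact hM.isCoaction (B := fun x₀ g h => sw (B.coact (f.restrictScalars k x₀))
    fun c c' => sw (B.nu B.antipodeSq w) fun u v => sw (B.nu B.antipode (c * u)) fun y z =>
      y ⊗ₜ[k] (r.opAct B.coact g (r.opAct B.coact (S c') v) * r.opAct B.coact h z)) (by fun_prop)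
      (by fun_prop) (by fun_prop)]
  refine sw_congr fun x₀ h => ?_
  have e3 : sw (((tensorRight (k := k) (1 : A) ∘ₗ f).restrictScalars k) x₀) (fun a b =>
      sw (B.nu B.antipode a) fun u v => (u * w) ⊗ₜ[k] (b * r.opAct B.coact h v)) =
      sw (B.nu B.antipode (f x₀)) fun u v => (u * w) ⊗ₜ[k] r.opAct B.coact h v := by
    change sw (f x₀ ⊗ₜ[k] (1 : A)) _ = _
    rw [sw_tmul (by fun_prop) (by fun_prop)]
    simp_rw [one_mul]
  rw [e3, ← B.sw_nu_nu_antipodeSq (F := fun y z => y ⊗ₜ[k] r.opAct B.coact h z) (by fun_prop)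
    (by fun_prop)]
  refine (sw_comm _ _ _).trans (sw_congr fun c c' => (sw_comm _ _ _).trans (sw_congr fun u v =>
    (sw_comm _ _ _).trans (sw_congr fun y z => ?_)))
  rw [B.opAct_mul, tmul_sw]

theorem boxDual_tensorRight (f : M →ₗ[A] A) (ξ b : A) :
    B.boxDual hM (tensorRight (k := k) (b * ξ) ∘ₗ f) =
      LinearMap.toSpanSingleton (A ⊗[k] Aᵐᵒᵖ) (A ⊗[k] Aᵐᵒᵖ) (1 ⊗ₜ MulOpposite.op b) ∘ₗ
        B.boxDual hM (tensorRight (k := k) ξ ∘ₗ f) := by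
  refine B.box_hom_ext fun x => ?_
  rw [LinearMap.comp_apply, boxDual_tmul_one, boxDual_tmul_one, LinearMap.toSpanSingleton_apply,
    smul_eq_mul]
  have e1 : (op).lTensor A
      (B.hatNu ρ B.antipode ((tensorRight (k := k) ξ ∘ₗ f).restrictScalars k) x) *
      (1 ⊗ₜ MulOpposite.op b) = (op).lTensor A (sw (B.hatNu ρ B.antipode
        ((tensorRight (k := k) ξ ∘ₗ f).restrictScalars k) x) fun u v => u ⊗ₜ[k] (b * v)) := by
    change (op).toLinearMap.lTensor A _ * _ = (op).toLinearMap.lTensor A _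
    rw [lTensor_eq_sw, sw_mul, map_sw']
    refine sw_congr fun u v => ?_
    rw [Algebra.TensorProduct.tmul_mul_tmul, mul_one]
    rfl
  rw [e1]
  congr 1
  conv_lhs => rw [← sw_self (B.hatNu ρ B.antipode _ x)]
  rw [B.sw_hatNu (by fun_prop) (by fun_prop), B.sw_hatNu (by fun_prop) (by fun_prop)]
  refine sw_congr fun x₀ h => ?_
  change sw (f x₀ ⊗ₜ[k] (b * ξ)) _ = sw (f x₀ ⊗ₜ[k] ξ) _
  rw [sw_tmul (by fun_prop) (by fun_prop), sw_tmul (by fun_prop) (by fun_prop)]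
  simp_rw [mul_assoc]

end BraidedHopfAlgebra
end BraidedHopf

-- The Nakayama map.

namespace BraidedHopf

set_option linter.unusedSectionVars false

namespace BraidedHopfAlgebra
variable {k H A : Type u} [Field k] [Ring H] [HopfAlgebra k H] {r : UniversalRForm k H}
  [Ring A] [Algebra k A] [Coalgebra k A] (B : BraidedHopfAlgebra r A)
  {U : Type*} [AddCommGroup U] [Module k U]
  (ψ : A →ₐ[k] k) (g : Hˣ)

local notation "Δ" => Coalgebra.comul (R := k)
local notation "ε" => Coalgebra.counit (R := k)
local notation "S" => HopfAlgebra.antipode k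

/-- The winding map `a ↦ ψ(a₁) a₂`. -/
def winding (ψ : A →ₗ[k] k) : A →ₗ[k] A :=
  (show Lin k fun a => sw (Δ a) fun p s => ψ p • s by fun_prop).toLin

theorem winding_apply (ψ : A →ₗ[k] k) (a : A) :
    winding ψ a = sw (Δ a) fun p s => ψ p • s := rfl

theorem winding_winding {χ ψ : A →ₗ[k] k} (h : ∀ a, (sw (Δ a) fun p s => ψ p * χ s) = ε a)
    (a : A) : winding χ (winding ψ a) = a := by
  rw [winding_apply ψ, map_sw']
  simp_rw [map_smul, winding_apply, smul_sw]
  rw [← sw_comul_comul (B := fun p s t => ψ p • χ s • t) (by fun_prop) (by fun_prop)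
    (by fun_prop)]
  simp_rw [smul_smul, ← sw_smul_left, h]
  exact sw_counit_left (f := fun t => t) (by fun_prop) a

/-- A character has the convolution inverse ψ ∘ S, and winding by it is the inverse map. -/
theorem winding_bijective (B : BraidedHopfAlgebra r A) (ψ : A →ₐ[k] k) :
    Function.Bijective (winding ψ.toLinearMap) := by
  refine Function.bijective_iff_has_inverse.2
    ⟨winding (ψ.toLinearMap ∘ₗ B.antipode), winding_winding fun a => ?_,
      winding_winding fun a => ?_⟩
  · have := B.sw_mul_antipode (f := fun x => ψ.toLinearMap x) (by fun_prop) a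
    simpa using this
  · have := B.sw_antipode_mul (f := fun x => ψ.toLinearMap x) (by fun_prop) a
    simpa using this

/-- Since r(h₁, S(h₂) g⁻¹) = r(h₁, g⁻¹) θ(h₂), the map factors as S² after T for g⁻¹, after the
action of θ, after winding by ψ. Each factor is invertible when S is bijective. -/
theorem nakayamaMap_apply (a : A) : nakayamaMap B ψ g a = B.antipodeSq
    (r.opAct B.coact ((g⁻¹ : Hˣ) : H) (act B.coact r.theta (winding ψ.toLinearMap a))) := by
  let α : H →ₗ[k] k := TensorProduct.lift r.form ∘ₗ
    (LinearMap.mulRight k ((g⁻¹ : Hˣ) : H) ∘ₗ HopfAlgebra.antipode k).lTensor H ∘ₗ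
      Coalgebra.comul (R := k)
  have h1 : nakayamaMap B ψ g a =
      TensorProduct.lid k A (TensorProduct.map ψ.toLinearMap (B.antipodeSq ∘ₗ act B.coact α)
        (Δ a)) := rfl
  have hα : ∀ h, α h = sw (Δ h) fun x y => r.form x ((g⁻¹ : Hˣ) : H) * r.theta y := fun h => by
    change TensorProduct.lift r.form ((LinearMap.mulRight k ((g⁻¹ : Hˣ) : H) ∘ₗ
      HopfAlgebra.antipode k).lTensor H (Δ h)) = _
    rw [lift_eq_sw, sw_lTensor _ (by fun_prop) (by fun_prop)]
    simp_rw [LinearMap.comp_apply, LinearMap.mulRight_apply, r.form_mul_right, r.theta_apply,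
      mul_sw]
    exact sw_comul_comul (B := fun x y z => r.form x ((g⁻¹ : Hˣ) : H) * r.form y (S z))
      (by fun_prop) (by fun_prop) (by fun_prop) h
  have hact : ∀ s, act B.coact α s = r.opAct B.coact ((g⁻¹ : Hˣ) : H) (act B.coact r.theta s) :=
    fun s => by
      rw [r.opAct_eq_act, act_act B.isCoaction, act_apply]
      simp_rw [hα]
      rfl
  rw [h1, map_eq_sw, map_sw (f := fun t => TensorProduct.lid k A t) (by fun_prop), winding_apply]
  simp_rw [map_sw', TensorProduct.lid_tmul, map_smul, LinearMap.comp_apply, hact]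

theorem nakayamaMap_bijective (hS : Function.Bijective B.antipode) :
    Function.Bijective (nakayamaMap B ψ g) := by
  have h1 : Function.Bijective (r.opAct B.coact ((g⁻¹ : Hˣ) : H)) := by
    refine Function.bijective_iff_has_inverse.2
      ⟨r.opAct B.coact (g : H), fun x => ?_, fun x => ?_⟩ <;>
    simp [r.opAct_opAct B.isCoaction, r.opAct_one B.isCoaction]
  have h2 : Function.Bijective (act B.coact r.theta) :=
    Function.bijective_iff_has_inverse.2 ⟨act B.coact r.thetaInv,
      act_act_of_inverse B.isCoaction r.thetaInv_theta,
      act_act_of_inverse B.isCoaction r.theta_thetaInv⟩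
  have := (hS.comp hS).comp (h1.comp (h2.comp (B.winding_bijective ψ)))
  convert this using 1
  ext a
  exact B.nakayamaMap_apply ψ g a

theorem sw_coact_character
    (hψ : ∀ a, TensorProduct.lid k H (ψ.toLinearMap.rTensor H (B.coact a)) = ψ a • (1 : H))
    {f : H → U} (hf : Lin k f) (a : A) :
    (sw (B.coact a) fun x h => ψ.toLinearMap x • f h) = ψ.toLinearMap a • f 1 := by
  have := congrArg f (hψ a)
  rw [lid_eq_sw, sw_rTensor _ (by fun_prop) (by fun_prop), map_sw hf, hf.smul'] at this
  simp only [hf.smul'] at this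
  exact this

/-- Colinearity of ψ sets the coaction leg of the first factor of ν equal to 1, where the twist
degenerates to θ; and S(g) = g⁻¹ for a group-like g. -/
theorem sw_nu_character
    (hψ : ∀ a, TensorProduct.lid k H (ψ.toLinearMap.rTensor H (B.coact a)) = ψ a • (1 : H))
    (hg : IsGroupLikeElem k (g : H)) (w : A) :
    (sw (B.nu B.antipodeSq w) fun u v => ψ.toLinearMap u • r.opAct B.coact (S (g : H)) v) =
      nakayamaMap B ψ g w := by
  have hSg : S (g : H) = ((g⁻¹ : Hˣ) : H) :=
    Units.eq_inv_of_mul_eq_one_left hg.mul_antipode_cancel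
  rw [nakayamaMap_apply, hSg, B.sw_nu_twist B.antipodeSq_colinear (by fun_prop) (by fun_prop),
    winding_apply]
  simp_rw [map_sw', map_smul]
  refine sw_congr fun p s => ?_
  have e : ∀ p₀ p₁, (sw (B.coact s) fun s₀ s₁ => r.twist p₁ s₁ • ψ.toLinearMap p₀ •
      r.opAct B.coact ((g⁻¹ : Hˣ) : H) (B.antipodeSq s₀)) = ψ.toLinearMap p₀ • sw (B.coact s)
        fun s₀ s₁ => r.twist p₁ s₁ •
        r.opAct B.coact ((g⁻¹ : Hˣ) : H) (B.antipodeSq s₀) := fun p₀ p₁ => by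
    rw [smul_sw]
    exact sw_congr fun s₀ s₁ => smul_comm _ _ _
  simp_rw [e]
  rw [B.sw_coact_character ψ hψ (f := fun p₁ => sw (B.coact s) fun s₀ s₁ => r.twist p₁ s₁ •
    r.opAct B.coact ((g⁻¹ : Hˣ) : H) (B.antipodeSq s₀)) (by fun_prop), act_apply]
  simp_rw [map_sw', map_smul, r.twist_one_left, r.map_opAct B.antipodeSq_colinear]

end BraidedHopfAlgebra
end BraidedHopf

namespace BraidedHopf

/-! ### Cocycles and coboundaries with values in a module -/

section Cochains

variable {R : Type*} [Ring R] {C D : ChainComplex (ModuleCat.{u} R) ℕ} {n : ℕ}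
  {N : Type*} [AddCommGroup N] [Module R N] {N' : Type*} [AddCommGroup N'] [Module R N']

/-- `f : C_n → N` is a cocycle of the complex `Hom(C, N)`. -/
def IsCocycle (C : ChainComplex (ModuleCat.{u} R) ℕ) {n : ℕ} (f : C.X n →ₗ[R] N) : Prop :=
  f ∘ₗ (C.d (n + 1) n).hom = 0

/-- `f : C_n → N` is a coboundary of the complex `Hom(C, N)`. -/
def IsCoboundary (C : ChainComplex (ModuleCat.{u} R) ℕ) {n : ℕ} (f : C.X n →ₗ[R] N) : Prop :=
  ∃ (j : ℕ) (s : C.X j →ₗ[R] N), s ∘ₗ (C.d n j).hom = f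

theorem IsCocycle.add {f g : C.X n →ₗ[R] N} (hf : IsCocycle C f) (hg : IsCocycle C g) :
    IsCocycle C (f + g) := by
  rw [IsCocycle, LinearMap.add_comp, hf, hg, add_zero]

theorem IsCocycle.sub {f g : C.X n →ₗ[R] N} (hf : IsCocycle C f) (hg : IsCocycle C g) :
    IsCocycle C (f - g) := by
  rw [IsCocycle, LinearMap.sub_comp, hf, hg, sub_zero]

theorem IsCocycle.comp {f : C.X n →ₗ[R] N} (hf : IsCocycle C f) (p : N →ₗ[R] N') :
    IsCocycle C (p ∘ₗ f) := by
  rw [IsCocycle, LinearMap.comp_assoc, hf, LinearMap.comp_zero]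

theorem IsCocycle.comp_chainMap {f : C.X n →ₗ[R] N} (hf : IsCocycle C f) (φ : D ⟶ C) :
    IsCocycle D (f ∘ₗ (φ.f n).hom) := by
  have := congrArg ModuleCat.Hom.hom (φ.comm (n + 1) n)
  rw [ModuleCat.hom_comp, ModuleCat.hom_comp] at this
  rw [IsCocycle, LinearMap.comp_assoc, ← this, ← LinearMap.comp_assoc, hf, LinearMap.zero_comp]

theorem IsCoboundary.zero : IsCoboundary C (0 : C.X n →ₗ[R] N) :=
  ⟨n, 0, LinearMap.zero_comp _⟩

/-- Makes the free index in `IsCoboundary` harmless: any index other than n - 1 contributes only 0.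
In degree 0 the coboundaries are therefore zero, with no separate definition. -/
theorem d_eq_zero_or (C : ChainComplex (ModuleCat.{u} R) ℕ) (n j : ℕ) :
    C.d n j = 0 ∨ j + 1 = n := by
  by_cases h : j + 1 = n
  · exact Or.inr h
  · exact Or.inl (C.shape _ _ h)

theorem IsCoboundary.add {f g : C.X n →ₗ[R] N} (hf : IsCoboundary C f) (hg : IsCoboundary C g) :
    IsCoboundary C (f + g) := by
  obtain ⟨i, s, rfl⟩ := hf
  obtain ⟨j, t, rfl⟩ := hg
  rcases d_eq_zero_or C n i with hi | hi
  · exact ⟨j, t, by simp [hi]⟩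
  rcases d_eq_zero_or C n j with hj | hj
  · exact ⟨i, s, by simp [hj]⟩
  obtain rfl : i = j := by lia
  exact ⟨i, s + t, LinearMap.add_comp _ _ _⟩

theorem IsCoboundary.comp {f : C.X n →ₗ[R] N} (hf : IsCoboundary C f) (p : N →ₗ[R] N') :
    IsCoboundary C (p ∘ₗ f) := by
  obtain ⟨i, s, rfl⟩ := hf
  exact ⟨i, p ∘ₗ s, rfl⟩

theorem IsCoboundary.neg {f : C.X n →ₗ[R] N} (hf : IsCoboundary C f) : IsCoboundary C (-f) := by
  obtain ⟨i, s, rfl⟩ := hf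
  exact ⟨i, -s, LinearMap.neg_comp _ _⟩

theorem IsCoboundary.sum {ι : Type*} (s : Finset ι) {f : ι → (C.X n →ₗ[R] N)}
    (hf : ∀ i ∈ s, IsCoboundary C (f i)) : IsCoboundary C (∑ i ∈ s, f i) :=
  Finset.sum_induction f _ (fun _ _ => .add) .zero hf

theorem IsCoboundary.comp_chainMap {f : C.X n →ₗ[R] N} (hf : IsCoboundary C f) (φ : D ⟶ C) :
    IsCoboundary D (f ∘ₗ (φ.f n).hom) := by
  obtain ⟨i, s, rfl⟩ := hf
  refine ⟨i, s ∘ₗ (φ.f i).hom, ?_⟩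
  have := congrArg ModuleCat.Hom.hom (φ.comm n i)
  rw [ModuleCat.hom_comp, ModuleCat.hom_comp] at this
  rw [LinearMap.comp_assoc, LinearMap.comp_assoc, this]

/-- `f` and `g` are cohomologous if their difference is a coboundary. -/
def Cohomologous (C : ChainComplex (ModuleCat.{u} R) ℕ) {n : ℕ} (f g : C.X n →ₗ[R] N) : Prop :=
  IsCoboundary C (f - g)

theorem Cohomologous.symm {f g : C.X n →ₗ[R] N} (h : Cohomologous C f g) :
    Cohomologous C g f := by
  have := h.neg
  rwa [neg_sub] at this

theorem Cohomologous.trans {f g h : C.X n →ₗ[R] N} (h₁ : Cohomologous C f g)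
    (h₂ : Cohomologous C g h) : Cohomologous C f h := by
  have := h₁.add h₂
  rwa [sub_add_sub_cancel] at this

theorem Cohomologous.comp {f g : C.X n →ₗ[R] N} (h : Cohomologous C f g) (p : N →ₗ[R] N') :
    Cohomologous C (p ∘ₗ f) (p ∘ₗ g) := by
  have := IsCoboundary.comp h p
  rwa [LinearMap.comp_sub] at this

theorem Cohomologous.comp_chainMap {f g : C.X n →ₗ[R] N} (h : Cohomologous C f g) (φ : D ⟶ C) :
    Cohomologous D (f ∘ₗ (φ.f n).hom) (g ∘ₗ (φ.f n).hom) := by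
  have := IsCoboundary.comp_chainMap h φ
  rwa [LinearMap.sub_comp] at this

end Cochains

/-! ### Classes in `Ext` -/

section Ext

variable {R : Type u} [Ring R] {M : ModuleCat.{u} R} (P : ProjectiveResolution M) {n : ℕ}
  {N : Type u} [AddCommGroup N] [Module R N] {N' : Type u} [AddCommGroup N'] [Module R N']

/-- The class in `Ext^n(M, N)` of a cocycle. -/
def extOf (f : P.complex.X n →ₗ[R] N) (hf : IsCocycle P.complex f) :
    Abelian.Ext M (ModuleCat.of R N) n :=
  P.extMk (ModuleCat.ofHom f) (n + 1) rfl (ModuleCat.hom_ext hf)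

theorem extOf_congr {f g : P.complex.X n →ₗ[R] N} (h : f = g) (hf : IsCocycle P.complex f)
    (hg : IsCocycle P.complex g) : extOf P f hf = extOf P g hg := by
  subst h
  rfl

theorem extOf_surjective (e : Abelian.Ext M (ModuleCat.of R N) n) :
    ∃ (f : P.complex.X n →ₗ[R] N) (hf : IsCocycle P.complex f), extOf P f hf = e := by
  obtain ⟨f, hf, rfl⟩ := P.extMk_surjective e (n + 1) rfl
  exact ⟨f.hom, congrArg ModuleCat.Hom.hom hf, rfl⟩

/-- A cocycle of degree 0 with vanishing class would factor through the term of the resolution in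
cohomological degree 1, which is zero. -/
theorem extMk_zero_eq_zero {Y : ModuleCat.{u} R} (f : P.complex.X 0 ⟶ Y)
    (hf : P.complex.d 1 0 ≫ f = 0) (h : P.extMk f 1 rfl hf = 0) : f = 0 := by
  rw [← P.extEquivCohomologyClass.apply_eq_iff_eq, P.extEquivCohomologyClass_extMk,
    P.extEquivCohomologyClass_zero, CochainComplex.HomComplex.CohomologyClass.mk_eq_zero_iff,
    CochainComplex.HomComplex.Cocycle.toSingleMk_mem_coboundaries_iff _ _ _ _ _ 1 (by lia)] at h
  obtain ⟨g, hg⟩ := h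
  have hz : Limits.IsZero (P.cochainComplex.X 1) :=
    P.cochainComplex.isZero_of_isStrictlyLE 0 1
  rw [hz.eq_of_src g 0, Limits.comp_zero] at hg
  exact (cancel_epi (P.cochainComplexXIso (-(0 : ℕ)) 0 rfl).hom).1
    (hg.symm.trans Limits.comp_zero.symm)

theorem extOf_eq_zero_iff {f : P.complex.X n →ₗ[R] N} (hf : IsCocycle P.complex f) :
    extOf P f hf = 0 ↔ IsCoboundary P.complex f := by
  cases n with
  | zero =>
    constructor
    · intro h
      have := congrArg ModuleCat.Hom.hom (extMk_zero_eq_zero P _ _ h)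
      rw [ModuleCat.hom_ofHom] at this
      rw [this]
      exact .zero
    · rintro ⟨j, s, rfl⟩
      have : P.complex.d 0 j = 0 := P.complex.shape _ _ (by simp)
      simp only [extOf, this, ModuleCat.hom_zero, LinearMap.comp_zero]
      exact P.extMk_zero _ _
  | succ p =>
    rw [extOf, P.extMk_eq_zero_iff _ _ _ _ p rfl]
    constructor
    · rintro ⟨g, hg⟩
      exact ⟨p, g.hom, congrArg ModuleCat.Hom.hom hg⟩
    · rintro ⟨j, s, rfl⟩
      rcases d_eq_zero_or P.complex (p + 1) j with hj | hj
      · refine ⟨0, ?_⟩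
        simp [hj]
      · obtain rfl : j = p := by lia
        exact ⟨ModuleCat.ofHom s, rfl⟩

theorem extOf_eq_iff {f g : P.complex.X n →ₗ[R] N} (hf : IsCocycle P.complex f)
    (hg : IsCocycle P.complex g) : extOf P f hf = extOf P g hg ↔ Cohomologous P.complex f g := by
  rw [Cohomologous, ← extOf_eq_zero_iff P (hf.sub hg), ← sub_eq_zero, extOf, extOf,
    P.sub_extMk]
  rfl

theorem extOf_add {f g : P.complex.X n →ₗ[R] N} (hf : IsCocycle P.complex f)
    (hg : IsCocycle P.complex g) (hfg : IsCocycle P.complex (f + g)) :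
    extOf P (f + g) hfg = extOf P f hf + extOf P g hg :=
  (P.add_extMk _ _ _ _ _ _).symm

theorem extOf_comp {f : P.complex.X n →ₗ[R] N} (hf : IsCocycle P.complex f) (p : N →ₗ[R] N') :
    (extOf P f hf).comp (Abelian.Ext.mk₀ (ModuleCat.ofHom p)) (add_zero n) =
      extOf P (p ∘ₗ f) (hf.comp p) :=
  P.extMk_comp_mk₀ _ _ _ _ _

/-- Lets one class be represented on different resolutions; the chain map has to lift only the
identity of M. -/
theorem extOf_comp_chainMap (Q : ProjectiveResolution M) (φ : Q.complex ⟶ P.complex)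
    (hφ : φ.f 0 ≫ P.π.f 0 = Q.π.f 0) {f : P.complex.X n →ₗ[R] N} (hf : IsCocycle P.complex f) :
    extOf Q (f ∘ₗ (φ.f n).hom) (hf.comp_chainMap φ) = extOf P f hf := by
  have := ProjectiveResolution.mk₀_comp_extMk (R := P) (R' := Q) (ModuleCat.ofHom f) (n + 1) rfl
    (ModuleCat.hom_ext hf) (g := 𝟙 M) ⟨φ, hφ.trans (by
      rw [CategoryTheory.Functor.map_id]; exact (Category.comp_id _).symm)⟩
  rw [Abelian.Ext.mk₀_id_comp] at this
  exact this.symm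

theorem subsingleton_ext_iff : Subsingleton (Abelian.Ext M (ModuleCat.of R N) n) ↔
    ∀ f : P.complex.X n →ₗ[R] N, IsCocycle P.complex f → IsCoboundary P.complex f := by
  refine ⟨fun _ f hf => (extOf_eq_zero_iff P hf).1 (Subsingleton.elim _ _), fun h => ?_⟩
  refine subsingleton_of_forall_eq 0 fun e => ?_
  obtain ⟨f, hf, rfl⟩ := extOf_surjective P e
  exact (extOf_eq_zero_iff P hf).2 (h f hf)

end Ext

section ExtAlgebra

variable {k R : Type u} [Field k] [Ring R] [Algebra k R] {M : ModuleCat.{u} R}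
  (P : ProjectiveResolution M) {n : ℕ}
  {N : Type u} [AddCommGroup N] [Module k N] [Module R N] [IsScalarTower k R N]

theorem IsCocycle.smul {C : ChainComplex (ModuleCat.{u} R) ℕ} {f : C.X n →ₗ[R] N} (c : k)
    (hf : IsCocycle C f) : IsCocycle C (c • f) := by
  rw [IsCocycle, LinearMap.smul_comp, hf, smul_zero]

theorem IsCoboundary.smul {C : ChainComplex (ModuleCat.{u} R) ℕ} {f : C.X n →ₗ[R] N} (c : k)
    (hf : IsCoboundary C f) : IsCoboundary C (c • f) := by
  obtain ⟨i, s, rfl⟩ := hf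
  exact ⟨i, c • s, LinearMap.smul_comp _ _ _⟩

theorem Cohomologous.smul {C : ChainComplex (ModuleCat.{u} R) ℕ} {f g : C.X n →ₗ[R] N} (c : k)
    (h : Cohomologous C f g) : Cohomologous C (c • f) (c • g) := by
  have := IsCoboundary.smul c h
  rwa [smul_sub] at this

theorem extOf_smul {f : P.complex.X n →ₗ[R] R} (c : k) (hf : IsCocycle P.complex f) :
    extOf P (c • f) (hf.smul c) = c • extOf P f hf := by
  rw [Abelian.Ext.smul_eq_comp_mk₀, extOf, extOf, P.extMk_comp_mk₀]
  congr 1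
  ext x
  exact Algebra.smul_def c (f x)

theorem extRightMul_extOf {f : P.complex.X n →ₗ[R] R} (hf : IsCocycle P.complex f) (x : R) :
    extRightMul (extOf P f hf) x =
      extOf P (LinearMap.toSpanSingleton R R x ∘ₗ f) (hf.comp _) :=
  extOf_comp P hf _

end ExtAlgebra

end BraidedHopf

namespace BraidedHopf

/-! ### Cocycles with values in a free module -/

section FreeCoefficients

variable {k A : Type u} [Field k] [Ring A] [Algebra k A]
  {X : Type*} [AddCommGroup X] [Module k X] {Y : Type*} [AddCommGroup Y] [Module k Y]
  {M : Type*} [AddCommGroup M] [Module A M]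

/-- The map `a ⊗ x ↦ λ(x) a`. -/
def tensorFunctional (l : X →ₗ[k] k) : A ⊗[k] X →ₗ[A] A :=
  (TensorProduct.AlgebraTensorModule.rid k A A).toLinearMap ∘ₗ
    TensorProduct.AlgebraTensorModule.map LinearMap.id l

@[simp] theorem tensorFunctional_tmul (l : X →ₗ[k] k) (a : A) (x : X) :
    tensorFunctional l (a ⊗ₜ[k] x) = l x • a := rfl

theorem tensorFunctional_comp_tensorRight (l : X →ₗ[k] k) (x : X) (f : M →ₗ[A] A) :
    tensorFunctional l ∘ₗ tensorRight (k := k) x ∘ₗ f = l x • f := rfl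

theorem tensorRight_add (x y : X) : tensorRight (k := k) (A := A) (x + y) =
    tensorRight (k := k) x + tensorRight (k := k) y :=
  LinearMap.ext fun a => tmul_add a x y

theorem tensorRight_smul (c : k) (x : X) : tensorRight (k := k) (A := A) (c • x) =
    c • tensorRight (k := k) x :=
  LinearMap.ext fun a => tmul_smul c a x

theorem tensorRight_sum {ι : Type*} (s : Finset ι) (x : ι → X) :
    tensorRight (k := k) (A := A) (∑ i ∈ s, x i) = ∑ i ∈ s, tensorRight (k := k) (x i) :=
  LinearMap.ext fun a => by
    rw [LinearMap.sum_apply]; exact tmul_sum a s x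

/-- The statement covers all larger finite sets so that one set can later serve all members of a
finite generating family. -/
theorem exists_finset_coordinates {ι : Type*} (b : Module.Basis ι k X) (z : A ⊗[k] X) :
    ∃ s : Finset ι, ∀ t, s ⊆ t →
      ∑ i ∈ t, tensorRight (k := k) (b i) (tensorFunctional (b.coord i) z) = z := by
  classical
  induction z with
  | zero => exact ⟨∅, fun t _ => by simp⟩
  | tmul a x =>
    refine ⟨(b.repr x).support, fun t ht => ?_⟩
    have : ∑ i ∈ t, b.repr x i • b i = x := by
      conv_rhs => rw [← b.linearCombination_repr x]
      rw [Finsupp.linearCombination_apply, Finsupp.sum_of_support_subset _ ht _ (by simp)]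
    conv_rhs => rw [← this]
    rw [tmul_sum]
    refine Finset.sum_congr rfl fun i _ => ?_
    rw [tensorFunctional_tmul, tensorRight_apply, b.coord_apply, smul_tmul]
  | add z w hz hw =>
    obtain ⟨s, hs⟩ := hz
    obtain ⟨s', hs'⟩ := hw
    refine ⟨s ∪ s', fun t ht => ?_⟩
    simp_rw [map_add]
    rw [Finset.sum_add_distrib, hs t (Finset.union_subset_left ht),
      hs' t (Finset.union_subset_right ht)]

/-- A homomorphism from a finitely generated module to `A ⊗ X` has finitely many coordinates. -/
theorem exists_finset_sum_tensorRight [Module.Finite A M] {ι : Type*} (b : Module.Basis ι k X)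
    (F : M →ₗ[A] A ⊗[k] X) : ∃ s : Finset ι,
      F = ∑ i ∈ s, tensorRight (k := k) (b i) ∘ₗ tensorFunctional (b.coord i) ∘ₗ F := by
  classical
  obtain ⟨G, hG⟩ := Module.Finite.fg_top (R := A) (M := M)
  choose s hs using exists_finset_coordinates (A := A) b
  refine ⟨G.biUnion fun x => s (F x), LinearMap.ext_on hG fun x hx => ?_⟩
  rw [LinearMap.sum_apply]
  exact (hs (F x) _ (Finset.subset_biUnion_of_mem (fun x => s (F x)) hx)).symm

variable {C : ChainComplex (ModuleCat.{u} A) ℕ} {n : ℕ} {f₀ : C.X n →ₗ[A] A}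

/-- If every cocycle with values in `A` is cohomologous to a multiple of `f₀`, then every cocycle
with values in `A ⊗ X` is cohomologous to `f₀ ⊗ ξ` for some `ξ`. -/
theorem exists_cohomologous_tensorRight [Module.Finite A (C.X n)]
    (h₀ : ∀ f : C.X n →ₗ[A] A, IsCocycle C f → ∃ c : k, Cohomologous C f (c • f₀))
    {F : C.X n →ₗ[A] A ⊗[k] X} (hF : IsCocycle C F) :
    ∃ ξ : X, Cohomologous C F (tensorRight (k := k) ξ ∘ₗ f₀) := by
  let b := Module.Basis.ofVectorSpace k X
  obtain ⟨s, hs⟩ := exists_finset_sum_tensorRight b F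
  -- Each coordinate of F is a cocycle with values in A, hence a multiple c i of f₀ up to a
  -- coboundary; ξ collects these scalars.
  choose c hc using fun i => h₀ (tensorFunctional (b.coord i) ∘ₗ F) (hF.comp _)
  refine ⟨∑ i ∈ s, c i • b i, ?_⟩
  have : F - tensorRight (k := k) (∑ i ∈ s, c i • b i) ∘ₗ f₀ = ∑ i ∈ s,
      tensorRight (k := k) (b i) ∘ₗ (tensorFunctional (b.coord i) ∘ₗ F - c i • f₀) := by
    conv_lhs => rw [hs]
    ext x
    rw [LinearMap.sub_apply, LinearMap.sum_apply, LinearMap.sum_apply, LinearMap.comp_apply,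
      tensorRight_sum, LinearMap.sum_apply, ← Finset.sum_sub_distrib]
    refine Finset.sum_congr rfl fun i _ => ?_
    rw [LinearMap.comp_sub, tensorRight_smul]
    exact congrArg _ (smul_tmul' (c i) (f₀ x) (b i))
  rw [Cohomologous, this]
  exact .sum _ fun i _ => IsCoboundary.comp (hc i) _

theorem smul_injective_of_not_isCoboundary (h₀ : ¬ IsCoboundary C f₀) {c c' : k}
    (h : Cohomologous C (c • f₀) (c' • f₀)) : c = c' := by
  by_contra hc
  refine h₀ ?_
  have := IsCoboundary.smul (c - c')⁻¹ h
  have e : (c - c')⁻¹ • (c • f₀ - c' • f₀) = f₀ := by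
    ext x
    change (c - c')⁻¹ • (c • f₀ x - c' • f₀ x) = f₀ x
    rw [← sub_smul, smul_smul, inv_mul_cancel₀ (sub_ne_zero.2 hc), one_smul]
  rwa [e] at this

/-- Linear functionals on X reduce the claim to scalar multiples of f₀, and over a field they
separate points. -/
theorem tensorRight_injective_of_not_isCoboundary (h₀ : ¬ IsCoboundary C f₀) {x y : X}
    (h : Cohomologous C (tensorRight (k := k) x ∘ₗ f₀) (tensorRight (k := k) y ∘ₗ f₀)) :
    x = y := by
  refine (Module.forall_dual_apply_eq_zero_iff k (x - y)).1 ?_ |> sub_eq_zero.1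
  intro l
  rw [map_sub, sub_eq_zero]
  exact smul_injective_of_not_isCoboundary h₀ (h.comp (tensorFunctional l))

end FreeCoefficients

/-! ### Homotopies -/

section Homotopy

variable {R : Type*} [Ring R]

theorem exists_lift_of_exact {Q X Y Z : Type*} [AddCommGroup Q] [Module R Q]
    [Module.Projective R Q] [AddCommGroup X] [Module R X] [AddCommGroup Y] [Module R Y]
    [AddCommGroup Z] [Module R Z] {f : X →ₗ[R] Y} {g : Y →ₗ[R] Z} (h : Function.Exact f g)
    (u : Q →ₗ[R] Y) (hu : g ∘ₗ u = 0) : ∃ v : Q →ₗ[R] X, f ∘ₗ v = u := by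
  obtain ⟨v, hv⟩ := Module.projective_lifting_property f.rangeRestrict
    (u.codRestrict (LinearMap.range f) fun x => (h _).1 (LinearMap.congr_fun hu x))
    f.surjective_rangeRestrict
  refine ⟨v, LinearMap.ext fun x => ?_⟩
  exact congrArg Subtype.val (LinearMap.congr_fun hv x)

/-- A chain map from a complex of projectives to an acyclic complex `E` which is zero on the
augmentation is homotopic to zero. -/
theorem exists_nullHomotopy {C : ChainComplex (ModuleCat.{u} R) ℕ}
    (hC : ∀ i, Module.Projective R (C.X i)) {E : ℕ → Type*} [∀ i, AddCommGroup (E i)]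
    [∀ i, Module R (E i)] {Z : Type*} [AddCommGroup Z] [Module R Z]
    {e : ∀ i, E (i + 1) →ₗ[R] E i} {p : E 0 →ₗ[R] Z}
    (he : ∀ i, Function.Exact (e (i + 1)) (e i)) (hp : Function.Exact (e 0) p)
    {D : ∀ i, C.X i →ₗ[R] E i} (hD : ∀ i, e i ∘ₗ D (i + 1) = D i ∘ₗ (C.d (i + 1) i).hom)
    (hD₀ : p ∘ₗ D 0 = 0) (n : ℕ) :
    ∃ h : C.X n →ₗ[R] E (n + 1), Cohomologous C (D n) (e n ∘ₗ h) := by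
  induction n with
  | zero =>
    obtain ⟨h, hh⟩ := exists_lift_of_exact hp (D 0) hD₀
    exact ⟨h, by rw [Cohomologous, hh, sub_self]; exact .zero⟩
  | succ n ih =>
    obtain ⟨h, j, s, hs⟩ := ih
    -- By induction D n - e n ∘ h factors through a differential of C, so it dies after composition
    -- with the next one; the lift of the resulting cycle is the next homotopy.
    have key : e n ∘ₗ (D (n + 1) - h ∘ₗ (C.d (n + 1) n).hom) = 0 := by
      rw [LinearMap.comp_sub, hD, ← LinearMap.comp_assoc, ← LinearMap.sub_comp, ← hs,
        LinearMap.comp_assoc, ← ModuleCat.hom_comp, C.d_comp_d, ModuleCat.hom_zero,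
        LinearMap.comp_zero]
    obtain ⟨h', hh'⟩ := exists_lift_of_exact (he n) _ key
    exact ⟨h', n, h, by rw [hh']; abel⟩

end Homotopy

end BraidedHopf

-- The coaction κ in cohomology.

namespace BraidedHopf

set_option linter.unusedSectionVars false

variable {k H A : Type u} [Field k] [Ring H] [HopfAlgebra k H] {r : UniversalRForm k H}
  [Ring A] [Algebra k A] [Coalgebra k A] {B : BraidedHopfAlgebra r A}

local notation "Δ" => Coalgebra.comul (R := k)
local notation "ε" => Coalgebra.counit (R := k)
local notation "S" => HopfAlgebra.antipode k

theorem isCoaction_trivialCoaction (V : Type*) [AddCommGroup V] [Module k V] :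
    IsCoaction (trivialCoaction k H V) where
  coassoc := by
    ext v
    simp [trivialCoaction, Algebra.TensorProduct.one_def]
  counit := by
    ext v
    simp [trivialCoaction]

theorem sw_linearMap_apply {R N N' : Type*} [Ring R] [AddCommGroup N] [Module R N]
    [AddCommGroup N'] [Module R N'] {V W : Type*} [AddCommGroup V] [Module k V] [AddCommGroup W]
    [Module k W] (t : V ⊗[k] W) (F : V → W → (N →ₗ[R] N')) (x : N) :
    sw t F x = sw t fun v w => F v w x :=
  LinearMap.sum_apply _ _ _

theorem Cohomologous.sw {C : ChainComplex (ModuleCat.{u} A) ℕ} {n : ℕ} {N : Type*}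
    [AddCommGroup N] [Module A N] {V W : Type*} [AddCommGroup V] [Module k V] [AddCommGroup W]
    [Module k W] {t : V ⊗[k] W} {F G : V → W → (C.X n →ₗ[A] N)}
    (h : ∀ x y, Cohomologous C (F x y) (G x y)) :
    Cohomologous C (BraidedHopf.sw t F) (BraidedHopf.sw t G) := by
  rw [Cohomologous, BraidedHopf.sw, BraidedHopf.sw, ← Finset.sum_sub_distrib]
  exact .sum _ fun p _ => h p.1 p.2

namespace BraidedHopfAlgebra

theorem smul_trivialModule (a : A) (x : B.trivialModule) :
    a • x = (ε a : k) • x := by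
  have h : ∀ c d : A, (ε c : k) = ε d → c • x = d • x := fun c d e =>
    congrArg (fun t : k => (HMul.hMul t (show k from x) : k)) e
  refine h _ (algebraMap k A (ε a)) ?_
  rw [Algebra.algebraMap_eq_smul_one, map_smul, B.counit_one, smul_eq_mul, mul_one]

theorem isHopfModule_trivialModule :
    IsHopfModule B (trivialCoaction k H B.trivialModule) where
  isCoaction := isCoaction_trivialCoaction _
  smul_colinear := by
    ext a x
    change (a • x) ⊗ₜ[k] (1 : H) = (TensorProduct.lift (Algebra.lsmul k k _).toLinearMap).rTensor H
      (tensorCoaction B.coact (trivialCoaction k H B.trivialModule) (a ⊗ₜ x))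
    rw [tensorCoaction_tmul]
    have e : ∀ (a₀ : A) (a₁ : H), (sw (trivialCoaction k H B.trivialModule x) fun w₀ w₁ =>
        (a₀ ⊗ₜ[k] w₀) ⊗ₜ[k] (a₁ * w₁)) = (a₀ ⊗ₜ[k] x) ⊗ₜ[k] a₁ := fun a₀ a₁ => by
      rw [trivialCoaction, LinearMap.flip_apply, TensorProduct.mk_apply,
        sw_tmul (by fun_prop) (by fun_prop), mul_one]
    simp_rw [e, map_sw']
    change _ = sw (B.coact a) fun a₀ a₁ => (a₀ • x) ⊗ₜ[k] a₁
    simp_rw [smul_trivialModule]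
    have := B.sw_coact_counit_smul (f := fun h => x ⊗ₜ[k] h) (by fun_prop) a
    simp_rw [TensorProduct.smul_tmul'] at this
    exact this.symm

variable {M : Type u} [AddCommGroup M] [Module k M] [Module A M] [IsScalarTower k A M]
  {ρ : M →ₗ[k] M ⊗[k] H} {hM : IsHopfModule B ρ}

theorem tensorFunctional_counit_homCoact (f : M →ₗ[A] A) :
    tensorFunctional (ε : H →ₗ[k] k) ∘ₗ B.homCoact hM B.isHopfModule_self f = f := by
  ext x
  rw [LinearMap.comp_apply, homCoact_apply]
  have lin : Lin k fun t => tensorFunctional (A := A) (ε : H →ₗ[k] k) t :=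
    Lin.coe ((tensorFunctional (A := A) (ε : H →ₗ[k] k)).restrictScalars k)
  simp_rw [map_sw lin, tensorFunctional_tmul, Bialgebra.counit_mul, r.counit_antipodeInv, mul_smul]
  have e : ∀ (x₁ : H) (y : A), (sw (B.coact y) fun y₀ y₁ => (ε x₁ : k) • (ε y₁ : k) • y₀) =
      (ε x₁ : k) • y := fun x₁ y => by
    rw [← smul_sw, sw_coact_counit B.isCoaction (f := fun y => y) (by fun_prop)]
  simp_rw [e]
  exact sw_coact_counit hM.isCoaction (f := fun x => f.restrictScalars k x) (by fun_prop) x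

/-- `κ` of `f` followed by a right multiplication. -/
theorem homCoact_toSpanSingleton_comp (f : M →ₗ[A] A) (a : A) (x : M) :
    B.homCoact hM B.isHopfModule_self (LinearMap.toSpanSingleton A A a ∘ₗ f) x =
      sw (B.coact a) fun a₀ a₁ => TensorProduct.map (LinearMap.mulRight k a₀)
        (LinearMap.mulRight k a₁) (B.homCoact hM B.isHopfModule_self f x) := by
  simp_rw [homCoact_apply, map_sw', LinearMap.comp_apply, LinearMap.toSpanSingleton_apply,
    smul_eq_mul, map_tmul, LinearMap.mulRight_apply]
  rw [sw_comm]
  refine sw_congr fun x₀ x₁ => ?_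
  rw [B.sw_coact_mul (by fun_prop) (by fun_prop), sw_comm]
  simp_rw [mul_assoc]

end BraidedHopfAlgebra

namespace FiniteRelativeProjectiveResolution

variable {M : ModuleCat.{u} A} {ρM : M →ₗ[k] M ⊗[k] H}
  (P : FiniteRelativeProjectiveResolution B M ρM)

theorem module_projective (i : ℕ) : Module.Projective A (P.complex.X i) :=
  (P.finiteRelativeProjective i).projective

theorem module_finite (i : ℕ) : Module.Finite A (P.complex.X i) := by
  obtain ⟨V, _, _, ρV, ι, p, -, hV, -, -, hp⟩ := P.finiteRelativeProjective i
  have := hV.finite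
  exact Module.Finite.of_surjective p fun x => ⟨ι x, LinearMap.congr_fun hp x⟩

theorem exact_d (i : ℕ) :
    Function.Exact (P.complex.d (i + 2) (i + 1)).hom (P.complex.d (i + 1) i).hom := by
  have := (ShortComplex.moduleCat_exact_iff _).1 (P.toProjectiveResolution.exact_succ i)
  refine fun x => ⟨this x, ?_⟩
  rintro ⟨y, rfl⟩
  exact LinearMap.congr_fun (congrArg ModuleCat.Hom.hom (P.complex.d_comp_d (i + 2) (i + 1) i)) y

theorem exact_aug : Function.Exact (P.complex.d 1 0).hom P.aug.hom := by
  have := (ShortComplex.moduleCat_exact_iff _).1 P.toProjectiveResolution.exact₀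
  refine fun x => ⟨this x, ?_⟩
  rintro ⟨y, rfl⟩
  exact LinearMap.congr_fun (congrArg ModuleCat.Hom.hom P.d_comp_aug) y

theorem aug_surjective : Function.Surjective P.aug.hom :=
  (ModuleCat.epi_iff_surjective (P.toProjectiveResolution.π.f 0)).1 inferInstance

/-- The coaction `f ↦ f₀ ⊗ f₁` on homomorphisms `P_n → N`. -/
abbrev homCoact {n : ℕ} {N : Type u} [AddCommGroup N] [Module k N] [Module A N]
    [IsScalarTower k A N] {ρN : N →ₗ[k] N ⊗[k] H} (hN : IsHopfModule B ρN)
    (f : P.complex.X n →ₗ[A] N) : P.complex.X n →ₗ[A] N ⊗[k] H :=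
  B.homCoact (P.isHopfModule n) hN f

section

variable {n : ℕ} {N : Type u} [AddCommGroup N] [Module k N] [Module A N]
    [IsScalarTower k A N] {ρN : N →ₗ[k] N ⊗[k] H} (hN : IsHopfModule B ρN)

theorem isCocycle_homCoact {f : P.complex.X n →ₗ[A] N} (hf : IsCocycle P.complex f) :
    IsCocycle P.complex (P.homCoact hN f) := by
  have := B.homCoact_comp (hM := P.isHopfModule (n + 1)) (hN := P.isHopfModule n) (hL := hN) f
    (P.complex.d (n + 1) n).hom (P.d_colinear (n + 1) n)
  rw [IsCocycle, ← this, hf]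
  have h := B.homCoact_smul (hM := P.isHopfModule (n + 1)) (hN := hN) 0 0
  rwa [zero_smul, zero_smul] at h

theorem isCoboundary_homCoact {f : P.complex.X n →ₗ[A] N} (hf : IsCoboundary P.complex f) :
    IsCoboundary P.complex (P.homCoact hN f) := by
  obtain ⟨j, s, rfl⟩ := hf
  exact ⟨j, P.homCoact hN s, (B.homCoact_comp (hM := P.isHopfModule n)
    (hN := P.isHopfModule j) (hL := hN) s (P.complex.d n j).hom (P.d_colinear n j)).symm⟩

theorem cohomologous_homCoact {f g : P.complex.X n →ₗ[A] N} (h : Cohomologous P.complex f g) :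
    Cohomologous P.complex (P.homCoact hN f) (P.homCoact hN g) := by
  have e : P.homCoact hN (f - g) = P.homCoact hN f - P.homCoact hN g := by
    rw [eq_sub_iff_add_eq, homCoact, homCoact, ← B.homCoact_add, sub_add_cancel]
  rw [Cohomologous, ← e]
  exact P.isCoboundary_homCoact hN h

end

/-! ### The group-like element and the character of a one-dimensional `Ext` -/

section Generator

variable {n : ℕ} {f₀ : P.complex.X n →ₗ[A] A} {g : H}

theorem counit_of_cohomologous_homCoact (hf₀ : ¬ IsCoboundary P.complex f₀)
    (hg : Cohomologous P.complex (P.homCoact B.isHopfModule_self f₀)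
      (tensorRight (k := k) g ∘ₗ f₀)) : ε g = (1 : k) := by
  have := hg.comp (tensorFunctional (ε : H →ₗ[k] k))
  rw [B.tensorFunctional_counit_homCoact, tensorFunctional_comp_tensorRight] at this
  refine (smul_injective_of_not_isCoboundary (k := k) hf₀ ?_).symm
  rwa [one_smul]

/-- Applying κ twice to f₀ gives f₀ ⊗ g ⊗ g up to coboundaries, while coassociativity of κ gives f₀
⊗ Δ g; the coefficient of f₀ is unique. -/
theorem comul_of_cohomologous_homCoact (hf₀ : ¬ IsCoboundary P.complex f₀)
    (hg : Cohomologous P.complex (P.homCoact B.isHopfModule_self f₀)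
      (tensorRight (k := k) g ∘ₗ f₀)) : Δ g = g ⊗ₜ[k] g := by
  have hAH : IsHopfModule B (tensorCoaction B.coact (trivialCoaction k H H)) :=
    B.isHopfModule_tensor (isCoaction_trivialCoaction H)
  have h1 := P.cohomologous_homCoact hAH hg
  have hcol : IsColinear B.coact (tensorCoaction B.coact (trivialCoaction k H H))
      ((tensorRight (k := k) (A := A) g).restrictScalars k) := by
    ext a
    change tensorCoaction B.coact (trivialCoaction k H H) (a ⊗ₜ g) =
      ((tensorRight (k := k) (A := A) g).restrictScalars k).rTensor H (B.coact a)
    rw [tensorCoaction_tmul, rTensor_eq_sw]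
    refine sw_congr fun a₀ a₁ => ?_
    rw [trivialCoaction, LinearMap.flip_apply, TensorProduct.mk_apply,
      sw_tmul (by fun_prop) (by fun_prop), mul_one]
    rfl
  have hc : P.homCoact hAH (tensorRight (k := k) g ∘ₗ f₀) =
      TensorProduct.AlgebraTensorModule.map (tensorRight (k := k) g) LinearMap.id ∘ₗ
        P.homCoact B.isHopfModule_self f₀ :=
    B.homCoact_colinear_comp (hN := B.isHopfModule_self) f₀ _ hcol
  rw [hc] at h1
  have h2 := h1.trans (hg.comp _)
  -- The flip is needed because `homCoact_homCoact` produces the two legs of Δ in reversed order.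
  let θ : (A ⊗[k] H) ⊗[k] H →ₗ[A] A ⊗[k] (H ⊗[k] H) :=
    TensorProduct.AlgebraTensorModule.map LinearMap.id (TensorProduct.comm k H H).toLinearMap ∘ₗ
      (TensorProduct.AlgebraTensorModule.assoc k k A A H H).toLinearMap
  have h3 := h2.comp θ
  have h4 := hg.comp (TensorProduct.AlgebraTensorModule.map (LinearMap.id : A →ₗ[A] A)
    (Δ : H →ₗ[k] H ⊗[k] H))
  have e : TensorProduct.AlgebraTensorModule.map (LinearMap.id : A →ₗ[A] A)
      (Δ : H →ₗ[k] H ⊗[k] H) ∘ₗ P.homCoact B.isHopfModule_self f₀ =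
      θ ∘ₗ B.homCoact (P.isHopfModule n) hAH (B.homCoact (P.isHopfModule n)
        B.isHopfModule_self f₀) := by
    ext x
    rw [LinearMap.comp_apply, LinearMap.comp_apply, B.homCoact_homCoact]
    have lin : Lin k fun t => θ t := Lin.coe (θ.restrictScalars k)
    simp_rw [map_sw lin]
    have e1 : ∀ (a : A) (h : H), (sw (Δ h) fun g h => θ ((a ⊗ₜ[k] h) ⊗ₜ[k] g)) =
        a ⊗ₜ[k] Δ h := fun a h => by
      conv_rhs => rw [← sw_self (Δ h)]
      rw [tmul_sw]
      rfl
    simp_rw [e1]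
    exact lTensor_eq_sw _ _
  rw [e] at h4
  exact tensorRight_injective_of_not_isCoboundary hf₀ (h4.symm.trans h3)

/-- The class of κ(f₀ a) is computed twice: from f₀ a ~ ψ(a) f₀, and from κ(f₀ a) = κ(f₀) (a₀ ⊗ a₁)
~ f₀ a₀ ⊗ g a₁ ~ ψ(a₀) f₀ ⊗ g a₁. -/
theorem sw_coact_eq_of_cohomologous_homCoact (hf₀ : ¬ IsCoboundary P.complex f₀)
    (hg : Cohomologous P.complex (P.homCoact B.isHopfModule_self f₀)
      (tensorRight (k := k) g ∘ₗ f₀)) {ψ : A →ₗ[k] k}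
    (hψ : ∀ a, Cohomologous P.complex (LinearMap.toSpanSingleton A A a ∘ₗ f₀) (ψ a • f₀)) (a : A) :
    (sw (B.coact a) fun a₀ a₁ => ψ a₀ • (g * a₁)) = ψ a • g := by
  refine tensorRight_injective_of_not_isCoboundary (k := k) hf₀ (Cohomologous.symm ?_)
  have h1 := P.cohomologous_homCoact B.isHopfModule_self (hψ a)
  have h2 : P.homCoact B.isHopfModule_self (ψ a • f₀) = ψ a • P.homCoact B.isHopfModule_self f₀ :=
    B.homCoact_smul _ _
  have h3 : P.homCoact B.isHopfModule_self (LinearMap.toSpanSingleton A A a ∘ₗ f₀) =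
      sw (B.coact a) fun a₀ a₁ => TensorProduct.AlgebraTensorModule.map
        (LinearMap.toSpanSingleton A A a₀) (LinearMap.mulRight k a₁) ∘ₗ
          P.homCoact B.isHopfModule_self f₀ := by
    ext x
    rw [sw_linearMap_apply]
    exact B.homCoact_toSpanSingleton_comp f₀ a x
  have h4 : tensorRight (k := k) (sw (B.coact a) fun a₀ a₁ => ψ a₀ • (g * a₁)) ∘ₗ f₀ =
      sw (B.coact a) fun a₀ a₁ => tensorRight (k := k) (g * a₁) ∘ₗ (ψ a₀ • f₀) := by
    ext x
    rw [sw_linearMap_apply]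
    refine (tmul_sw _ _ _).trans (sw_congr fun a₀ a₁ => ?_)
    exact (smul_tmul (ψ a₀) (f₀ x) (g * a₁)).symm
  rw [h2] at h1
  have h5 : Cohomologous P.complex (P.homCoact B.isHopfModule_self
      (LinearMap.toSpanSingleton A A a ∘ₗ f₀)) (sw (B.coact a) fun a₀ a₁ =>
        TensorProduct.AlgebraTensorModule.map (LinearMap.toSpanSingleton A A a₀)
          (LinearMap.mulRight k a₁) ∘ₗ tensorRight (k := k) g ∘ₗ f₀) := by
    rw [h3]
    exact .sw fun _ _ => hg.comp _
  have h6 : tensorRight (k := k) (ψ a • g) ∘ₗ f₀ = ψ a • (tensorRight (k := k) g ∘ₗ f₀) := by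
    rw [tensorRight_smul]
    rfl
  rw [h4, h6]
  refine ((hg.smul (ψ a)).symm.trans (h1.symm.trans (h5.trans ?_)))
  exact .sw fun a₀ a₁ => (hψ a₀).comp (tensorRight (k := k) (g * a₁))

end Generator

end FiniteRelativeProjectiveResolution

end BraidedHopf

-- Independence of the resolution.

namespace BraidedHopf

set_option linter.unusedSectionVars false

variable {k H A : Type u} [Field k] [Ring H] [HopfAlgebra k H] {r : UniversalRForm k H}
  [Ring A] [Algebra k A] [Coalgebra k A] {B : BraidedHopfAlgebra r A}

local notation "Δ" => Coalgebra.comul (R := k)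
local notation "ε" => Coalgebra.counit (R := k)
local notation "S" => HopfAlgebra.antipode k

section

variable {M : Type u} [AddCommGroup M] [Module k M] [Module A M] [IsScalarTower k A M]
  {ρ : M →ₗ[k] M ⊗[k] H} {hM : IsHopfModule B ρ}

/-- The map `x ↦ x ⊗ 1`. -/
def tensorOne (A H M : Type*) [Ring A] [Algebra k A] [Ring H] [Algebra k H] [AddCommGroup M]
    [Module k M] [Module A M] [IsScalarTower k A M] : M →ₗ[A] M ⊗[k] H where
  toFun x := x ⊗ₜ 1
  map_add' x y := add_tmul x y 1
  map_smul' a x := (TensorProduct.smul_tmul' a x 1).symm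

theorem BraidedHopfAlgebra.homCoact_id :
    B.homCoact hM hM LinearMap.id = tensorOne (k := k) A H M := by
  ext x
  rw [homCoact_apply]
  simp_rw [LinearMap.id_apply]
  rw [sw_coact_coact hM.isCoaction (B := fun x g h => x ⊗ₜ[k] (r.antipodeInv h * g))
    (by fun_prop) (by fun_prop) (by fun_prop)]
  refine Eq.trans ?_ (sw_coact_counit hM.isCoaction (f := fun x => x ⊗ₜ[k] (1 : H))
    (by fun_prop) x)
  refine sw_congr fun x h => ?_
  exact r.sw_antipodeInv_mul (f := fun t => x ⊗ₜ[k] t) (by fun_prop) h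

end

namespace FiniteRelativeProjectiveResolution

variable {M : ModuleCat.{u} A} {ρM : M →ₗ[k] M ⊗[k] H}
  (P Q : FiniteRelativeProjectiveResolution B M ρM)

theorem exists_chainMap : ∃ φ : Q.complex ⟶ P.complex, φ.f 0 ≫ P.aug = Q.aug := by
  refine ⟨ProjectiveResolution.lift (𝟙 M) Q.toProjectiveResolution P.toProjectiveResolution, ?_⟩
  exact (ProjectiveResolution.lift_commutes_zero (𝟙 M) Q.toProjectiveResolution
    P.toProjectiveResolution).trans (Category.comp_id _)

variable {P Q} {n : ℕ}

/-- A chain map is colinear up to homotopy. -/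
theorem homCoact_chainMap_homotopic (hM : IsHopfModule B ρM) {φ : Q.complex ⟶ P.complex}
    (hφ : φ.f 0 ≫ P.aug = Q.aug) (n : ℕ) :
    ∃ h : Q.complex.X n →ₗ[A] P.complex.X (n + 1) ⊗[k] H,
      Cohomologous Q.complex
        (Q.homCoact (P.isHopfModule n) (φ.f n).hom - tensorOne (k := k) A H _ ∘ₗ (φ.f n).hom)
        (TensorProduct.AlgebraTensorModule.map (P.complex.d (n + 1) n).hom LinearMap.id ∘ₗ h) := by
  -- The failure of φ to be colinear, κ(φ) - φ ⊗ 1, is itself a chain map into P ⊗ H. The target is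
  -- acyclic since H is flat over k, and the map vanishes on the augmentation since both
  -- augmentations are colinear.
  refine exists_nullHomotopy Q.module_projective (E := fun i => P.complex.X i ⊗[k] H)
    (e := fun i => TensorProduct.AlgebraTensorModule.map (P.complex.d (i + 1) i).hom LinearMap.id)
    (p := TensorProduct.AlgebraTensorModule.map P.aug.hom LinearMap.id)
    (D := fun i => Q.homCoact (P.isHopfModule i) (φ.f i).hom -
      tensorOne (k := k) A H _ ∘ₗ (φ.f i).hom) (fun i => ?_) ?_ (fun i => ?_) ?_ n
  · exact Module.Flat.rTensor_exact H
      (f := (P.complex.d (i + 2) (i + 1)).hom.restrictScalars k)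
      (g := (P.complex.d (i + 1) i).hom.restrictScalars k) (P.exact_d i)
  · exact Module.Flat.rTensor_exact H (f := (P.complex.d 1 0).hom.restrictScalars k)
      (g := P.aug.hom.restrictScalars k) P.exact_aug
  · have h1 := congrArg ModuleCat.Hom.hom (φ.comm (i + 1) i)
    rw [ModuleCat.hom_comp, ModuleCat.hom_comp] at h1
    have h2 := B.homCoact_colinear_comp (hM := Q.isHopfModule (i + 1))
      (hN := P.isHopfModule (i + 1)) (hL := P.isHopfModule i) (φ.f (i + 1)).hom
      (P.complex.d (i + 1) i).hom (P.d_colinear (i + 1) i)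
    have h3 := B.homCoact_comp (hM := Q.isHopfModule (i + 1)) (hN := Q.isHopfModule i)
      (hL := P.isHopfModule i) (φ.f i).hom (Q.complex.d (i + 1) i).hom (Q.d_colinear (i + 1) i)
    rw [LinearMap.comp_sub, LinearMap.sub_comp]
    congr 1
    · exact h2.symm.trans ((congrArg _ h1).trans h3)
    · ext x
      exact congrArg (· ⊗ₜ[k] (1 : H)) (LinearMap.congr_fun h1 x)
  · have h1 := congrArg ModuleCat.Hom.hom hφ
    rw [ModuleCat.hom_comp] at h1
    have h2 := B.homCoact_colinear_comp (hM := Q.isHopfModule 0)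
      (hN := P.isHopfModule 0) (hL := hM) (φ.f 0).hom P.aug.hom P.aug_colinear
    have h3 := B.homCoact_comp (hM := Q.isHopfModule 0) (hN := hM)
      (hL := hM) LinearMap.id Q.aug.hom Q.aug_colinear
    rw [B.homCoact_id, LinearMap.id_comp] at h3
    rw [LinearMap.comp_sub, sub_eq_zero]
    refine h2.symm.trans ((congrArg _ h1).trans (h3.trans ?_))
    ext x
    exact congrArg (· ⊗ₜ[k] (1 : H)) (LinearMap.congr_fun h1 x).symm

/-- In κ(f φ), the composite of κ(f) and κ(φ), the factor κ(φ) may be replaced by φ ⊗ 1: the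
homotopy term passes through the differential of P, which the cocycle κ(f) kills. What remains is
κ(f) φ ~ (f ⊗ g) φ. -/
theorem cohomologous_homCoact_comp_chainMap (hM : IsHopfModule B ρM)
    {φ : Q.complex ⟶ P.complex} (hφ : φ.f 0 ≫ P.aug = Q.aug) {f : P.complex.X n →ₗ[A] A}
    (hf : IsCocycle P.complex f) {g : H}
    (hg : Cohomologous P.complex (P.homCoact B.isHopfModule_self f)
      (tensorRight (k := k) g ∘ₗ f)) :
    Cohomologous Q.complex (Q.homCoact B.isHopfModule_self (f ∘ₗ (φ.f n).hom))
      (tensorRight (k := k) g ∘ₗ f ∘ₗ (φ.f n).hom) := by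
  obtain ⟨h, hh⟩ := homCoact_chainMap_homotopic hM hφ n
  have h1 : Q.homCoact B.isHopfModule_self (f ∘ₗ (φ.f n).hom) =
      BraidedHopfAlgebra.mulCoact (P.homCoact B.isHopfModule_self f) ∘ₗ
        Q.homCoact (P.isHopfModule n) (φ.f n).hom :=
    B.homCoact_comp' (hM := Q.isHopfModule n) (hN := P.isHopfModule n)
      (hL := B.isHopfModule_self) (φ.f n).hom f
  have h2 : BraidedHopfAlgebra.mulCoact (P.homCoact B.isHopfModule_self f) ∘ₗ
      tensorOne (k := k) A H _ ∘ₗ (φ.f n).hom =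
        P.homCoact B.isHopfModule_self f ∘ₗ (φ.f n).hom := by
    ext x
    change BraidedHopfAlgebra.mulCoact (P.homCoact B.isHopfModule_self f) (_ ⊗ₜ[k] (1 : H)) = _
    rw [BraidedHopfAlgebra.mulCoact_tmul]
    simp_rw [one_mul]
    exact sw_self _
  have h3 : BraidedHopfAlgebra.mulCoact (P.homCoact B.isHopfModule_self f) ∘ₗ
      (TensorProduct.AlgebraTensorModule.map (P.complex.d (n + 1) n).hom LinearMap.id ∘ₗ h) =
        0 := by
    rw [← LinearMap.comp_assoc]
    convert LinearMap.zero_comp h using 2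
    ext x y
    change BraidedHopfAlgebra.mulCoact (P.homCoact B.isHopfModule_self f) (_ ⊗ₜ[k] y) = 0
    rw [BraidedHopfAlgebra.mulCoact_tmul]
    have h4 : P.homCoact B.isHopfModule_self f ((P.complex.d (n + 1) n).hom x) = 0 :=
      LinearMap.congr_fun (P.isCocycle_homCoact B.isHopfModule_self hf) x
    rw [h4]
    exact Lin.zero' (f := fun t => sw t fun (z : A) (g : H) => z ⊗ₜ[k] (y * g)) (by fun_prop)
  have h5 := hh.comp (BraidedHopfAlgebra.mulCoact (P.homCoact B.isHopfModule_self f))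
  rw [LinearMap.comp_sub, ← h1, h2, h3, Cohomologous, sub_zero] at h5
  exact Cohomologous.trans h5 (hg.comp_chainMap φ)

theorem homCoactionAux_eq (f : Q.complex.X n →ₗ[A] A) (x : Q.complex.X n) :
    Q.homCoactionAux n f x = Q.homCoact B.isHopfModule_self f x := by
  rw [homCoact, B.homCoact_apply, homCoactionAux, r.ringInverse_antipode]
  simp only [LinearMap.comp_apply, LinearEquiv.coe_coe]
  rw [rTensor_eq_sw, map_sw (f := fun t => TensorProduct.assoc k A H H t) (by fun_prop),
    map_sw']
  refine sw_congr fun x₀ x₁ => ?_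
  change _ = sw (B.coact (f x₀)) fun y₀ y₁ => y₀ ⊗ₜ[k] (r.antipodeInv x₁ * y₁)
  simp only [LinearMap.comp_apply, LinearMap.restrictScalars_apply]
  conv_lhs => rw [← sw_self (B.coact (f x₀))]
  rw [sw_tmul_right, map_sw (f := fun t => TensorProduct.assoc k A H H t) (by fun_prop), map_sw']
  rfl

/-- If `κ` sends every cocycle `f` to `f ⊗ g` up to a coboundary, then the coaction on `Ext` is
`e ↦ e ⊗ g`. -/
theorem isExtCoaction_of_cohomologous {g : H}
    (hg : ∀ f : Q.complex.X n →ₗ[A] A, IsCocycle Q.complex f →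
      Cohomologous Q.complex (Q.homCoact B.isHopfModule_self f) (tensorRight (k := k) g ∘ₗ f)) :
    Q.IsExtCoaction n ((TensorProduct.mk k _ H).flip g) := by
  intro f
  obtain ⟨j, s, hs⟩ := hg f.1 f.2
  have := Q.module_finite j
  -- `IsExtCoaction` asks for an exact lift of κ(f) to cocycles ⊗ H. The coboundary κ(f) - f ⊗ g is
  -- therefore split along a basis of H into finitely many coboundaries, whose classes vanish.
  obtain ⟨t, ht⟩ := exists_finset_sum_tensorRight (Module.Basis.ofVectorSpace k H) s
  let b := Module.Basis.ofVectorSpace k H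
  have hcob : ∀ i, IsCoboundary Q.complex
      ((tensorFunctional (b.coord i) ∘ₗ s) ∘ₗ (Q.complex.d n j).hom) := fun i => ⟨j, _, rfl⟩
  have hcoc : ∀ i, (tensorFunctional (b.coord i) ∘ₗ s) ∘ₗ (Q.complex.d n j).hom ∈
      Q.cocycles n := fun i => by
    change (_ ∘ₗ _) ∘ₗ _ = 0
    rw [LinearMap.comp_assoc, ← ModuleCat.hom_comp, Q.complex.d_comp_d, ModuleCat.hom_zero,
      LinearMap.comp_zero]
  refine ⟨f ⊗ₜ g + ∑ i ∈ t, (⟨_, hcoc i⟩ : Q.cocycles n) ⊗ₜ b i, fun x => ?_, ?_⟩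
  · rw [homCoactionAux_eq, map_add, map_sum]
    have h1 := LinearMap.congr_fun hs x
    rw [LinearMap.sub_apply, eq_sub_iff_add_eq] at h1
    have h2 := LinearMap.congr_fun ht ((Q.complex.d n j).hom x)
    rw [LinearMap.sum_apply] at h2
    rw [← h1, add_comm]
    exact congrArg₂ (· + ·) h2.symm rfl
  · rw [map_add, map_sum]
    have h1 : ∀ i, Q.extClass n ⟨_, hcoc i⟩ = 0 := fun i =>
      (extOf_eq_zero_iff Q.toProjectiveResolution (hcoc i)).2 (hcob i)
    simp_rw [LinearMap.rTensor_tmul, h1, zero_tmul, Finset.sum_const_zero, add_zero]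
    rfl

end FiniteRelativeProjectiveResolution

end BraidedHopf

namespace BraidedHopf

set_option linter.unusedSectionVars false

/-! ### The character and the group-like element -/

section Character

variable {k A : Type u} [Field k] [Ring A] [Algebra k A] {C : ChainComplex (ModuleCat.{u} A) ℕ}
  {n : ℕ} {f₀ : C.X n →ₗ[A] A}

/-- The right action of `A` on a one-dimensional cohomology space is through a character. -/
theorem exists_character (hf₀ : IsCocycle C f₀) (h₀ : ¬ IsCoboundary C f₀)
    (hgen : ∀ f : C.X n →ₗ[A] A, IsCocycle C f → ∃ c : k, Cohomologous C f (c • f₀)) :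
    ∃ ψ : A →ₐ[k] k, ∀ a, Cohomologous C (LinearMap.toSpanSingleton A A a ∘ₗ f₀) (ψ a • f₀) := by
  choose ψ hψ using fun a => hgen (LinearMap.toSpanSingleton A A a ∘ₗ f₀) (hf₀.comp _)
  -- Every algebra-map identity for ψ follows from uniqueness of the scalar, by computing the class
  -- of a right multiple of f₀ in two ways.
  have huniq : ∀ {c c' : k}, Cohomologous C (c • f₀) (c' • f₀) → c = c' :=
    smul_injective_of_not_isCoboundary h₀
  have halg : ∀ c : k, ψ (algebraMap k A c) = c := fun c => by
    refine huniq ((hψ _).symm.trans ?_)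
    have : LinearMap.toSpanSingleton A A (algebraMap k A c) ∘ₗ f₀ = c • f₀ := by
      ext x
      exact (Algebra.commutes c (f₀ x)).symm.trans (Algebra.smul_def c (f₀ x)).symm
    rw [this, Cohomologous, sub_self]
    exact .zero
  have hmul : ∀ a b, ψ (a * b) = ψ a * ψ b := fun a b => by
    have h1 : LinearMap.toSpanSingleton A A (a * b) ∘ₗ f₀ =
        LinearMap.toSpanSingleton A A b ∘ₗ LinearMap.toSpanSingleton A A a ∘ₗ f₀ := by
      ext x
      exact (mul_assoc (f₀ x) a b).symm
    have h2 : LinearMap.toSpanSingleton A A b ∘ₗ (ψ a • f₀) =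
        ψ a • (LinearMap.toSpanSingleton A A b ∘ₗ f₀) := by
      ext x
      exact smul_mul_assoc (ψ a) (f₀ x) b
    refine huniq ((hψ _).symm.trans ?_)
    rw [h1, mul_smul]
    refine ((hψ a).comp _).trans ?_
    rw [h2]
    exact (hψ b).smul _
  have hadd : ∀ a b, ψ (a + b) = ψ a + ψ b := fun a b => by
    have h1 : LinearMap.toSpanSingleton A A (a + b) ∘ₗ f₀ =
        LinearMap.toSpanSingleton A A a ∘ₗ f₀ + LinearMap.toSpanSingleton A A b ∘ₗ f₀ := by
      ext x
      exact mul_add (f₀ x) a b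
    refine huniq ((hψ _).symm.trans ?_)
    have h2 := IsCoboundary.add (hψ a) (hψ b)
    rw [h1, add_smul, Cohomologous]
    convert h2 using 1
    abel
  have hone : ψ 1 = 1 := by
    have := halg 1
    rwa [map_one] at this
  have hzero : ψ 0 = 0 := by
    have := halg 0
    rwa [map_zero] at this
  let ψ' : A →ₐ[k] k :=
    { toFun := ψ
      map_one' := hone
      map_mul' := hmul
      map_zero' := hzero
      map_add' := hadd
      commutes' := halg }
  exact ⟨ψ', hψ⟩

end Character

variable {k H A : Type u} [Field k] [Ring H] [HopfAlgebra k H] {r : UniversalRForm k H}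
  [Ring A] [Algebra k A] [Coalgebra k A] {B : BraidedHopfAlgebra r A}

namespace FiniteRelativeProjectiveResolution

variable {M : ModuleCat.{u} A} {ρM : M →ₗ[k] M ⊗[k] H}
  (P : FiniteRelativeProjectiveResolution B M ρM) {n : ℕ} {f₀ : P.complex.X n →ₗ[A] A}

/-- κ(f₀) is a cocycle with values in the free module A ⊗ H, so it is f₀ ⊗ g up to a coboundary; a
group-like element of a Hopf algebra is invertible. -/
theorem exists_isGroupLikeElem (hf₀ : IsCocycle P.complex f₀) (h₀ : ¬ IsCoboundary P.complex f₀)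
    (hgen : ∀ f : P.complex.X n →ₗ[A] A, IsCocycle P.complex f →
      ∃ c : k, Cohomologous P.complex f (c • f₀)) :
    ∃ g : Hˣ, IsGroupLikeElem k (g : H) ∧ Cohomologous P.complex
      (P.homCoact B.isHopfModule_self f₀) (tensorRight (k := k) (g : H) ∘ₗ f₀) := by
  have := P.module_finite n
  obtain ⟨g, hg⟩ := exists_cohomologous_tensorRight hgen
    (P.isCocycle_homCoact B.isHopfModule_self hf₀)
  have hgl : IsGroupLikeElem k g :=
    ⟨P.counit_of_cohomologous_homCoact h₀ hg, P.comul_of_cohomologous_homCoact h₀ hg⟩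
  exact ⟨hgl.isUnit.unit, hgl, hg⟩

/-- Invertibility of g allows it to be cancelled from ψ(a₀) g a₁ = ψ(a) g. -/
theorem lid_rTensor_character (h₀ : ¬ IsCoboundary P.complex f₀) {g : Hˣ}
    (hg : Cohomologous P.complex
      (P.homCoact B.isHopfModule_self f₀) (tensorRight (k := k) (g : H) ∘ₗ f₀))
    {ψ : A →ₐ[k] k}
    (hψ : ∀ a, Cohomologous P.complex (LinearMap.toSpanSingleton A A a ∘ₗ f₀) (ψ a • f₀))
    (a : A) : TensorProduct.lid k H (ψ.toLinearMap.rTensor H (B.coact a)) = ψ a • (1 : H) := by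
  have := P.sw_coact_eq_of_cohomologous_homCoact h₀ hg (ψ := ψ.toLinearMap) hψ a
  rw [lid_eq_sw, sw_rTensor _ (by fun_prop) (by fun_prop)]
  refine g.isUnit.mul_left_cancel ?_
  rw [mul_sw]
  simp_rw [mul_smul_comm, mul_one]
  exact this

/-- If `κ(f₀)` is cohomologous to `f₀ ⊗ g` for a generator `f₀`, then the coaction on `Ext` is
`e ↦ e ⊗ g`, for every resolution. -/
theorem isExtCoaction (hM : IsHopfModule B ρM) (hf₀ : IsCocycle P.complex f₀) {g : H}
    (hg : Cohomologous P.complex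
      (P.homCoact B.isHopfModule_self f₀) (tensorRight (k := k) g ∘ₗ f₀))
    (hspan : ∀ e, ∃ c : k, c • extOf P.toProjectiveResolution f₀ hf₀ = e)
    (Q : FiniteRelativeProjectiveResolution B M ρM) :
    Q.IsExtCoaction n ((TensorProduct.mk k _ H).flip g) := by
  obtain ⟨φ, hφ⟩ := exists_chainMap P Q
  refine isExtCoaction_of_cohomologous fun f hf => ?_
  obtain ⟨c, hc⟩ := hspan (extOf Q.toProjectiveResolution f hf)
  have h1 := extOf_comp_chainMap P.toProjectiveResolution Q.toProjectiveResolution φ hφ hf₀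
  have hf₁ : IsCocycle Q.complex (f₀ ∘ₗ (φ.f n).hom) := hf₀.comp_chainMap φ
  have h2 : Cohomologous Q.complex f (c • (f₀ ∘ₗ (φ.f n).hom)) := by
    refine (extOf_eq_iff Q.toProjectiveResolution hf (hf₁.smul c)).1 ?_
    rw [← hc, ← h1]
    exact (extOf_smul Q.toProjectiveResolution c hf₁).symm
  have h3 := cohomologous_homCoact_comp_chainMap hM hφ hf₀ hg
  have h4 := Q.cohomologous_homCoact B.isHopfModule_self h2
  rw [homCoact, homCoact, B.homCoact_smul] at h4
  refine h4.trans ((h3.smul c).trans ?_)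
  exact (h2.comp (tensorRight (k := k) g)).symm

end FiniteRelativeProjectiveResolution

end BraidedHopf

namespace BraidedHopf

set_option linter.unusedSectionVars false

/-! ### The induced resolution of the regular bimodule -/

section
variable {R : Type u} [Ring R] {C : ChainComplex (ModuleCat.{u} R) ℕ} {Z : ModuleCat.{u} R}

/-- The projective resolution given by an exact augmented complex of projective modules. -/
def projectiveResolutionOfExact (hC : ∀ i, Module.Projective R (C.X i)) (π : C.X 0 ⟶ Z)
    (hπ : Function.Surjective π.hom) (h₀ : Function.Exact (C.d 1 0).hom π.hom)
    (h : ∀ i, Function.Exact (C.d (i + 2) (i + 1)).hom (C.d (i + 1) i).hom) :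
    ProjectiveResolution Z where
  complex := C
  projective i := (IsProjective.iff_projective (C.X i)).1 (hC i)
  π := (ChainComplex.toSingle₀Equiv C Z).symm
    ⟨π, ModuleCat.hom_ext (LinearMap.ext h₀.apply_apply_eq_zero)⟩
  quasiIso := ⟨fun n => by
    cases n with
    | zero =>
      rw [ChainComplex.quasiIsoAt₀_iff, ShortComplex.quasiIso_iff_of_zeros' _
        (C.shape _ _ (by simp)) rfl rfl]
      constructor
      · rw [ShortComplex.moduleCat_exact_iff]
        intro x hx
        exact (h₀ x).1 hx
      · exact (ModuleCat.epi_iff_surjective π).2 hπ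
    | succ n =>
      rw [quasiIsoAt_iff_exactAt']
      · rw [HomologicalComplex.exactAt_iff' _ (n + 1 + 1) (n + 1) n (by simp) (by simp),
          ShortComplex.moduleCat_exact_iff]
        exact fun x hx => (h n x).1 hx
      · exact ChainComplex.exactAt_succ_single_obj _ _⟩
end

variable {k H A : Type u} [Field k] [Ring H] [HopfAlgebra k H] {r : UniversalRForm k H}
  [Ring A] [Algebra k A] [Coalgebra k A] {B : BraidedHopfAlgebra r A}

local notation "Δ" => Coalgebra.comul (R := k)
local notation "ε" => Coalgebra.counit (R := k)

namespace BraidedHopfAlgebra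

variable (B) in
/-- The trivial module is one-dimensional. -/
def trivialModuleEquiv : B.trivialModule ≃ₗ[k] k where
  toFun x := x
  invFun x := x
  left_inv _ := rfl
  right_inv _ := rfl
  map_add' _ _ := rfl
  map_smul' c x := by
    have h : ∀ d : A, (show k from d • x) = (ε d : k) * (show k from x) := fun d => rfl
    refine (h (algebraMap k A c)).trans ?_
    rw [Algebra.algebraMap_eq_smul_one, map_smul, B.counit_one, smul_eq_mul, mul_one]
    rfl

variable (B) in
/-- The bimodule attached to the trivial module is the regular bimodule. -/
def boxTrivialModuleEquiv :
    Box B (isHopfModule_trivialModule (B := B)) ≃ₗ[A ⊗[k] Aᵐᵒᵖ] regularBimodule k A :=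
  letI : Module (A ⊗[k] Aᵐᵒᵖ) A := instModuleTensorProductMop k A
  have hs : ∀ (a b x : A), (a ⊗ₜ[k] MulOpposite.op b) • x = a * x * b := fun a b x =>
    (TensorProduct.Algebra.smul_def a (MulOpposite.op b) x).trans (mul_assoc a x b).symm
  have : IsScalarTower k (A ⊗[k] Aᵐᵒᵖ) A := ⟨fun c t x => by
    change TensorProduct.Algebra.moduleAux _ _ = _ • TensorProduct.Algebra.moduleAux _ _
    rw [map_smul, LinearMap.smul_apply]⟩
  let f : B.trivialModule ⊗[k] A ≃ₗ[k] A :=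
    TensorProduct.congr B.trivialModuleEquiv (LinearEquiv.refl k A) ≪≫ₗ TensorProduct.lid k A
  have hf : ∀ x y, f (x ⊗ₜ y) = B.trivialModuleEquiv x • y := fun x y => rfl
  LinearEquiv.ofBijective
    (Box.linearMap B isHopfModule_trivialModule (N := A) f.toLinearMap
      (fun a x y => by
        -- On a trivial comodule the braiding operators reduce to the counit, so the left action
        -- becomes ε(a₁) a₂ = a on the factor A.
        have h : ∀ h : H, r.homAct (trivialCoaction k H B.trivialModule) h x = (ε h : k) • x :=
          fun h => by
            rw [r.homAct_apply, trivialCoaction, LinearMap.flip_apply, TensorProduct.mk_apply,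
              sw_tmul (by fun_prop) (by fun_prop), r.form_one_right]
        rw [boxAct_tmul]
        simp_rw [map_sw', h, smul_trivialModule, LinearEquiv.coe_coe, hf, map_smul]
        have e : ∀ a₁ a₂ : A, (sw (B.coact a₂) fun p h => ((ε a₁ : k) • (ε h : k) •
            B.trivialModuleEquiv x) • (p * y)) = (ε a₁ : k) • B.trivialModuleEquiv x • (a₂ * y) :=
          fun a₁ a₂ => by
            simp_rw [smul_assoc]
            rw [← sw_smul, sw_coact_counit B.isCoaction
              (f := fun p => B.trivialModuleEquiv x • (p * y)) (by fun_prop)]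
        simp_rw [e]
        rw [sw_counit_left (f := fun p => B.trivialModuleEquiv x • (p * y)) (by fun_prop)]
        refine Eq.trans ?_ (hs a 1 _).symm
        rw [mul_one, mul_smul_comm])
      (fun b x y => by
        refine Eq.trans ?_ (hs 1 b _).symm
        rw [one_mul]
        exact (smul_mul_assoc _ _ _).symm))
    f.bijective

end BraidedHopfAlgebra

open BraidedHopfAlgebra

namespace FiniteRelativeProjectiveResolution

section

variable {M : ModuleCat.{u} A} {ρM : M →ₗ[k] M ⊗[k] H}
  (P : FiniteRelativeProjectiveResolution B M ρM)

/-- The complex of bimodules attached to a complex of Hopf modules. -/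
def boxComplex : ChainComplex (ModuleCat.{u} (A ⊗[k] Aᵐᵒᵖ)) ℕ where
  X i := ModuleCat.of _ (Box B (P.isHopfModule i))
  d i j := ModuleCat.ofHom (Box.map (P.complex.d i j).hom (P.d_colinear i j))
  shape i j hij := by
    refine ModuleCat.hom_ext (LinearMap.ext fun t => ?_)
    change ((P.complex.d i j).hom.restrictScalars k).rTensor A t = 0
    rw [P.complex.shape i j hij]
    exact LinearMap.congr_fun (LinearMap.rTensor_zero A) t
  d_comp_d' i j l _ _ := by
    refine ModuleCat.hom_ext (LinearMap.ext fun t => ?_)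
    change (((P.complex.d j l).hom.restrictScalars k).rTensor A ∘ₗ
      ((P.complex.d i j).hom.restrictScalars k).rTensor A) t = 0
    rw [← LinearMap.rTensor_comp]
    have : (P.complex.d j l).hom.restrictScalars k ∘ₗ (P.complex.d i j).hom.restrictScalars k =
        0 := LinearMap.ext fun x =>
      LinearMap.congr_fun (congrArg ModuleCat.Hom.hom (P.complex.d_comp_d i j l)) x
    rw [this]
    exact LinearMap.congr_fun (LinearMap.rTensor_zero A) t

end

variable (P : FiniteRelativeProjectiveResolution B B.trivialModule
  (trivialCoaction k H B.trivialModule))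

/-- The projective resolution of the regular bimodule attached to a resolution of the trivial
module. -/
def boxResolution : ProjectiveResolution (regularBimodule k A) :=
  projectiveResolutionOfExact (C := P.boxComplex)
    (fun i => (B.box_finite_projective (P.isHopfModule i) (P.finiteRelativeProjective i)).2)
    (ModuleCat.ofHom (Y := (regularBimodule k A : Type u)) (B.boxTrivialModuleEquiv.toLinearMap ∘ₗ
      Box.map (hN := isHopfModule_trivialModule) P.aug.hom P.aug_colinear))
    ((LinearEquiv.surjective B.boxTrivialModuleEquiv).comp (LinearMap.rTensor_surjective A
      (g := P.aug.hom.restrictScalars k) P.aug_surjective))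
    -- Over k the bimodule complex is P ⊗ A, so exactness is inherited by flatness.
    (fun x => (LinearEquiv.map_eq_zero_iff B.boxTrivialModuleEquiv).trans
      (Module.Flat.rTensor_exact A (f := (P.complex.d 1 0).hom.restrictScalars k)
        (g := P.aug.hom.restrictScalars k) P.exact_aug x))
    (fun i => Module.Flat.rTensor_exact A
      (f := (P.complex.d (i + 2) (i + 1)).hom.restrictScalars k)
      (g := (P.complex.d (i + 1) i).hom.restrictScalars k) (P.exact_d i))

theorem isSmoothAlgebra (hP : IsBoundedComplex P.complex) : IsSmoothAlgebra k A := by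
  obtain ⟨N, hN⟩ := hP
  refine ⟨P.boxResolution, ⟨N, fun i hi => ?_⟩, fun i =>
    (B.box_finite_projective (P.isHopfModule i) (P.finiteRelativeProjective i)).1⟩
  have := ModuleCat.subsingleton_of_isZero (hN i hi)
  have : Subsingleton (P.complex.X i ⊗[k] A) := inferInstance
  exact @ModuleCat.isZero_of_subsingleton _ _ (P.boxComplex.X i) this

end FiniteRelativeProjectiveResolution

end BraidedHopf

-- Hochschild cohomology with values in A ⊗ A and its right module structure.

namespace BraidedHopf

set_option linter.unusedSectionVars false

variable {k H A : Type u} [Field k] [Ring H] [HopfAlgebra k H] {r : UniversalRForm k H}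
  [Ring A] [Algebra k A] [Coalgebra k A] {B : BraidedHopfAlgebra r A}

local notation "S" => HopfAlgebra.antipode k

theorem extRightMul_extRightMul {R : Type u} [Ring R] {M : ModuleCat.{u} R} {i : ℕ}
    (e : Abelian.Ext M (ModuleCat.of R R) i) (x y : R) :
    extRightMul (extRightMul e x) y = extRightMul e (x * y) := by
  rw [extRightMul, extRightMul, extRightMul, Abelian.Ext.comp_assoc_of_third_deg_zero,
    Abelian.Ext.mk₀_comp_mk₀]
  congr 2
  ext
  simp

namespace FiniteRelativeProjectiveResolution

section

variable {M : ModuleCat.{u} A} {ρM : M →ₗ[k] M ⊗[k] H}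
  (P : FiniteRelativeProjectiveResolution B M ρM) {n : ℕ}

/-- The bijection between homomorphisms `P_n → A ⊗ A` and bimodule homomorphisms to `A ⊗ A`. -/
def boxDual (F : P.complex.X n →ₗ[A] A ⊗[k] A) :
    P.boxComplex.X n →ₗ[A ⊗[k] Aᵐᵒᵖ] A ⊗[k] Aᵐᵒᵖ :=
  B.boxDual (P.isHopfModule n) F

theorem boxDual_injective : Function.Injective (P.boxDual (n := n)) :=
  B.boxDual_injective

theorem boxDual_surjective : Function.Surjective (P.boxDual (n := n)) :=
  B.boxDual_surjective

theorem boxDual_add (F G : P.complex.X n →ₗ[A] A ⊗[k] A) :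
    P.boxDual (F + G) = P.boxDual F + P.boxDual G :=
  B.boxDual_add F G

theorem boxDual_zero : P.boxDual (0 : P.complex.X n →ₗ[A] A ⊗[k] A) = 0 := by
  have := P.boxDual_add (0 : P.complex.X n →ₗ[A] A ⊗[k] A) 0
  rw [add_zero] at this
  exact LinearMap.ext fun t => left_eq_add.1 (LinearMap.congr_fun this t)

theorem boxDual_sub (F G : P.complex.X n →ₗ[A] A ⊗[k] A) :
    P.boxDual (F - G) = P.boxDual F - P.boxDual G := by
  have := P.boxDual_add (F - G) G
  rw [sub_add_cancel] at this
  exact LinearMap.ext fun t => eq_sub_of_add_eq (LinearMap.congr_fun this t).symm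

theorem boxDual_comp_d {j : ℕ} (F : P.complex.X j →ₗ[A] A ⊗[k] A) :
    P.boxDual (F ∘ₗ (P.complex.d n j).hom) = P.boxDual F ∘ₗ (P.boxComplex.d n j).hom :=
  B.boxDual_comp _ (P.d_colinear n j) F

theorem isCocycle_boxDual_iff {F : P.complex.X n →ₗ[A] A ⊗[k] A} :
    IsCocycle P.boxComplex (P.boxDual F) ↔ IsCocycle P.complex F := by
  rw [IsCocycle, ← boxDual_comp_d, ← P.boxDual_zero, P.boxDual_injective.eq_iff]
  rfl

theorem isCoboundary_boxDual_iff {F : P.complex.X n →ₗ[A] A ⊗[k] A} :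
    IsCoboundary P.boxComplex (P.boxDual F) ↔ IsCoboundary P.complex F := by
  constructor
  · rintro ⟨j, s, hs⟩
    obtain ⟨s, rfl⟩ := P.boxDual_surjective s
    exact ⟨j, s, P.boxDual_injective ((P.boxDual_comp_d s).trans hs)⟩
  · rintro ⟨j, s, rfl⟩
    exact ⟨j, P.boxDual s, (P.boxDual_comp_d s).symm⟩

theorem cohomologous_boxDual_iff {F G : P.complex.X n →ₗ[A] A ⊗[k] A} :
    Cohomologous P.boxComplex (P.boxDual F) (P.boxDual G) ↔ Cohomologous P.complex F G := by
  rw [Cohomologous, ← boxDual_sub, isCoboundary_boxDual_iff]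
  rfl

theorem boxDual_tensorRight (f : P.complex.X n →ₗ[A] A) (ξ b : A) :
    LinearMap.toSpanSingleton (A ⊗[k] Aᵐᵒᵖ) (A ⊗[k] Aᵐᵒᵖ) (1 ⊗ₜ[k] MulOpposite.op b) ∘ₗ
      P.boxDual (tensorRight (k := k) ξ ∘ₗ f) =
        P.boxDual (tensorRight (k := k) (b * ξ) ∘ₗ f) :=
  (B.boxDual_tensorRight f ξ b).symm

/-- The left multiplication by `a ⊗ 1` of the dual classes. -/
theorem cohomologous_boxDual_mul {f₀ : P.complex.X n →ₗ[A] A} {g : Hˣ}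
    (hgl : IsGroupLikeElem k (g : H))
    (hg : Cohomologous P.complex
      (P.homCoact B.isHopfModule_self f₀) (tensorRight (k := k) (g : H) ∘ₗ f₀))
    {ψ : A →ₐ[k] k}
    (hψ : ∀ a, Cohomologous P.complex (LinearMap.toSpanSingleton A A a ∘ₗ f₀) (ψ a • f₀))
    (hψ' : ∀ a, TensorProduct.lid k H (ψ.toLinearMap.rTensor H (B.coact a)) = ψ a • (1 : H))
    (a : A) : Cohomologous P.boxComplex
      (LinearMap.toSpanSingleton (A ⊗[k] Aᵐᵒᵖ) (A ⊗[k] Aᵐᵒᵖ) (a ⊗ₜ[k] 1) ∘ₗ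
        P.boxDual (tensorRight (k := k) 1 ∘ₗ f₀))
      (P.boxDual (tensorRight (k := k) (nakayamaMap B ψ g a) ∘ₗ f₀)) := by
  have h1 : P.boxDual (B.nuMul a ∘ₗ P.homCoact B.isHopfModule_self f₀) =
      LinearMap.toSpanSingleton (A ⊗[k] Aᵐᵒᵖ) (A ⊗[k] Aᵐᵒᵖ) (a ⊗ₜ[k] 1) ∘ₗ
        P.boxDual (tensorRight (k := k) 1 ∘ₗ f₀) := B.boxDual_nuMul f₀ a
  rw [← h1, cohomologous_boxDual_iff]
  -- κ(f₀) is replaced by f₀ ⊗ g; afterwards the first legs of ν(a), for S², act on f₀ from the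
  -- right and become scalars through ψ.
  refine (hg.comp _).trans ?_
  have h2 : B.nuMul a ∘ₗ tensorRight (k := k) (g : H) ∘ₗ f₀ =
      sw (B.nu B.antipodeSq a) fun u v => tensorRight (k := k) (r.opAct B.coact (S (g : H)) v) ∘ₗ
        LinearMap.toSpanSingleton A A u ∘ₗ f₀ := by
    ext x
    rw [sw_linearMap_apply]
    exact B.nuMul_tmul a (f₀ x) (g : H)
  have h3 : tensorRight (k := k) (nakayamaMap B ψ g a) ∘ₗ f₀ =
      sw (B.nu B.antipodeSq a) fun u v =>
        tensorRight (k := k) (r.opAct B.coact (S (g : H)) v) ∘ₗ (ψ u • f₀) := by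
    ext x
    rw [sw_linearMap_apply, ← B.sw_nu_character ψ g hψ' hgl]
    refine (tmul_sw _ _ _).trans (sw_congr fun u v => ?_)
    exact (smul_tmul (ψ u) (f₀ x) (r.opAct B.coact (S (g : H)) v)).symm
  rw [h2, h3]
  exact .sw fun u v => (hψ u).comp _

end

variable (P : FiniteRelativeProjectiveResolution B B.trivialModule
  (trivialCoaction k H B.trivialModule)) {n : ℕ}

-- This is the case f₀ = 0 of `exists_cohomologous_tensorRight`: if all cocycles with values in A
-- are coboundaries, so are those with values in A ⊗ A.
include P in
theorem subsingleton_hochschildRegular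
    (h : Subsingleton (Abelian.Ext B.trivialModule (ModuleCat.of A A) n)) :
    Subsingleton (HochschildRegular k A n) := by
  rw [subsingleton_ext_iff P.toProjectiveResolution] at h
  refine (subsingleton_ext_iff P.boxResolution).2 fun f hf => ?_
  obtain ⟨F, rfl⟩ := P.boxDual_surjective f
  refine P.isCoboundary_boxDual_iff.2 ?_
  have := P.module_finite n
  obtain ⟨ξ, hξ⟩ := exists_cohomologous_tensorRight (k := k) (f₀ := 0) (fun f hf =>
    ⟨0, by rw [smul_zero, Cohomologous, sub_zero]; exact h f hf⟩)
    (P.isCocycle_boxDual_iff.1 hf)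
  rwa [LinearMap.comp_zero, Cohomologous, sub_zero] at hξ

variable {f₀ : P.complex.X n →ₗ[A] A} (hf₀ : IsCocycle P.complex f₀)

/-- The class in `Ext_{A^e}^n(A, A^e)` attached to `ξ ∈ A`. -/
def hochschildClass (ξ : A) : HochschildRegular k A n :=
  extOf P.boxResolution (P.boxDual (tensorRight (k := k) ξ ∘ₗ f₀))
    (P.isCocycle_boxDual_iff.2 (hf₀.comp _))

theorem hochschildClass_add (ξ ζ : A) : P.hochschildClass hf₀ (ξ + ζ) =
    P.hochschildClass hf₀ ξ + P.hochschildClass hf₀ ζ := by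
  let F : A → (P.boxResolution.complex.X n →ₗ[A ⊗[k] Aᵐᵒᵖ] A ⊗[k] Aᵐᵒᵖ) := fun ξ =>
    P.boxDual (tensorRight (k := k) ξ ∘ₗ f₀)
  have hF : ∀ ξ, IsCocycle P.boxResolution.complex (F ξ) := fun ξ =>
    P.isCocycle_boxDual_iff.2 (hf₀.comp _)
  have h : F (ξ + ζ) = F ξ + F ζ := by
    have := P.boxDual_add (tensorRight (k := k) ξ ∘ₗ f₀) (tensorRight (k := k) ζ ∘ₗ f₀)
    rw [← LinearMap.add_comp, ← tensorRight_add] at this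
    exact this
  exact (extOf_congr P.boxResolution h (hF _) ((hF ξ).add (hF ζ))).trans
    (extOf_add P.boxResolution (hF ξ) (hF ζ) _)

theorem hochschildClass_mul (ξ b : A) : extRightMul (P.hochschildClass hf₀ ξ)
    (1 ⊗ₜ[k] MulOpposite.op b) = P.hochschildClass hf₀ (b * ξ) :=
  (extRightMul_extOf P.boxResolution _ _).trans
    (extOf_congr P.boxResolution (P.boxDual_tensorRight f₀ ξ b) _ _)

/-- Scalars are treated as right multiplication by 1 ⊗ c, a central element of A^e. -/
theorem hochschildClass_smul (c : k) (ξ : A) : P.hochschildClass hf₀ (c • ξ) =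
    c • P.hochschildClass hf₀ ξ := by
  rw [Algebra.smul_def, ← hochschildClass_mul]
  have h : (1 : A) ⊗ₜ[k] MulOpposite.op (algebraMap k A c) = c • (1 : A ⊗[k] Aᵐᵒᵖ) := by
    rw [Algebra.algebraMap_eq_smul_one, MulOpposite.op_smul, tmul_smul]
    rfl
  refine (extRightMul_extOf P.boxResolution _ _).trans
    (Eq.trans (extOf_congr P.boxResolution (LinearMap.ext fun x => ?_) _ _)
      (extOf_smul P.boxResolution c _))
  change P.boxDual _ x * (1 ⊗ₜ[k] MulOpposite.op (algebraMap k A c)) = c • P.boxDual _ x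
  rw [h, mul_smul_comm, mul_one]

/-- The action of `a ⊗ 1` on the classes. -/
theorem hochschildClass_one_mul {g : Hˣ}
    (hgl : IsGroupLikeElem k (g : H))
    (hg : Cohomologous P.complex
      (P.homCoact B.isHopfModule_self f₀) (tensorRight (k := k) (g : H) ∘ₗ f₀))
    {ψ : A →ₐ[k] k}
    (hψ : ∀ a, Cohomologous P.complex (LinearMap.toSpanSingleton A A a ∘ₗ f₀) (ψ a • f₀))
    (hψ' : ∀ a, TensorProduct.lid k H (ψ.toLinearMap.rTensor H (B.coact a)) = ψ a • (1 : H))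
    (a : A) : extRightMul (P.hochschildClass hf₀ 1) (a ⊗ₜ[k] 1) =
      P.hochschildClass hf₀ (nakayamaMap B ψ g a) :=
  (extRightMul_extOf P.boxResolution _ _).trans
    ((extOf_eq_iff P.boxResolution _ _).2 (P.cohomologous_boxDual_mul hgl hg hψ hψ' a))

theorem hochschildClass_injective (h₀ : ¬ IsCoboundary P.complex f₀) :
    Function.Injective (P.hochschildClass hf₀) := fun _ _ h =>
  tensorRight_injective_of_not_isCoboundary (k := k) h₀ (P.cohomologous_boxDual_iff.1
    ((extOf_eq_iff P.boxResolution _ _).1 h))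

theorem hochschildClass_surjective (hgen : ∀ f : P.complex.X n →ₗ[A] A, IsCocycle P.complex f →
      ∃ c : k, Cohomologous P.complex f (c • f₀)) :
    Function.Surjective (P.hochschildClass hf₀) := fun e => by
  obtain ⟨f, hf, rfl⟩ := extOf_surjective P.boxResolution e
  obtain ⟨F, rfl⟩ := P.boxDual_surjective f
  have := P.module_finite n
  obtain ⟨ξ, hξ⟩ := exists_cohomologous_tensorRight hgen (P.isCocycle_boxDual_iff.1 hf)
  exact ⟨ξ, (extOf_eq_iff P.boxResolution _ _).2 (P.cohomologous_boxDual_iff.2 hξ.symm)⟩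

end FiniteRelativeProjectiveResolution

end BraidedHopf

end

-- Assembly of the theorem.

theorem theorem5p2 {k H A : Type u} [Field k] [Ring H] [HopfAlgebra k H]
    (r : UniversalRForm k H) [Ring A] [Algebra k A] [Coalgebra k A]
    (B : BraidedHopfAlgebra r A) (hS : Function.Bijective B.antipode)
    (hFP : TrivialModuleIsTypeFP B) (n : ℕ)
    (hvanish : ∀ i, i ≠ n →
      Subsingleton (Abelian.Ext B.trivialModule (ModuleCat.of A A) i))
    (hdim : Module.finrank k (Abelian.Ext B.trivialModule (ModuleCat.of A A) n) = 1) :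
    ∃ (ψ : A →ₐ[k] k) (g : Hˣ) (μ : A ≃ₐ[k] A),
      (∀ (e : Abelian.Ext B.trivialModule (ModuleCat.of A A) n) (a : A),
        extRightMul e a = ψ a • e) ∧
      (∀ a : A, (TensorProduct.lid k H) (ψ.toLinearMap.rTensor H (B.coact a)) = ψ a • (1 : H)) ∧
      IsGroupLikeElem k (g : H) ∧
      (∀ P : FiniteRelativeProjectiveResolution B B.trivialModule
          (trivialCoaction k H B.trivialModule),
        P.IsExtCoaction n ((TensorProduct.mk k _ H).flip (g : H))) ∧
      (∀ a : A, μ a = nakayamaMap B ψ g a) ∧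
      IsTwistedCalabiYau n μ := by
  obtain ⟨P, hP⟩ := hFP
  obtain ⟨e₀, he₀, hspan⟩ := finrank_eq_one_iff'.1 hdim
  have hsurj : ∀ e, ∃ (f : P.complex.X n →ₗ[A] A) (hf : IsCocycle P.complex f),
      extOf P.toProjectiveResolution f hf = e := extOf_surjective P.toProjectiveResolution
  obtain ⟨f₀, hf₀, rfl⟩ := hsurj e₀
  have h₀ : ¬ IsCoboundary P.complex f₀ := fun h =>
    he₀ ((extOf_eq_zero_iff P.toProjectiveResolution hf₀).2 h)
  have hgen : ∀ f : P.complex.X n →ₗ[A] A, IsCocycle P.complex f →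
      ∃ c : k, Cohomologous P.complex f (c • f₀) := fun f hf => by
    obtain ⟨c, hc⟩ := hspan (extOf P.toProjectiveResolution f hf)
    rw [← extOf_smul P.toProjectiveResolution c hf₀] at hc
    exact ⟨c, (extOf_eq_iff P.toProjectiveResolution hf (hf₀.smul c)).1 hc.symm⟩
  obtain ⟨ψ, hψ⟩ := exists_character hf₀ h₀ hgen
  obtain ⟨g, hgl, hg⟩ := P.exists_isGroupLikeElem hf₀ h₀ hgen
  have hψ' := P.lid_rTensor_character h₀ hg hψ
  let Ψ : A ≃ₗ[k] HochschildRegular k A n := LinearEquiv.ofBijective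
    { toFun := P.hochschildClass hf₀
      map_add' := P.hochschildClass_add hf₀
      map_smul' := P.hochschildClass_smul hf₀ }
    ⟨P.hochschildClass_injective hf₀ h₀, P.hochschildClass_surjective hf₀ hgen⟩
  have hΨmul : ∀ ξ b, extRightMul (Ψ ξ) (1 ⊗ₜ[k] MulOpposite.op b) = Ψ (b * ξ) :=
    P.hochschildClass_mul hf₀
  have hΨone : ∀ a, extRightMul (Ψ 1) (a ⊗ₜ[k] 1) = Ψ (nakayamaMap B ψ g a) :=
    P.hochschildClass_one_mul hf₀ hgl hg hψ hψ'
  have hΨ : ∀ ξ a b, extRightMul (Ψ ξ) (a ⊗ₜ[k] MulOpposite.op b) =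
      Ψ (b * ξ * nakayamaMap B ψ g a) := fun ξ a b => by
    -- Ψ(ξ) = Ψ(1) · (1 ⊗ ξ), and 1 ⊗ ξ commutes with a ⊗ 1 in A^e, so the action on Ψ(1) determines
    -- the whole module.
    have h1 := hΨmul 1 ξ
    rw [mul_one] at h1
    rw [← h1, extRightMul_extRightMul, ← hΨmul, ← hΨone, extRightMul_extRightMul]
    simp
  -- Both sides describe the action of a b ⊗ 1 = (a ⊗ 1)(b ⊗ 1) on Ψ(1), so multiplicativity needs
  -- no computation with the formula.
  have hmul : ∀ a b, nakayamaMap B ψ g (a * b) = nakayamaMap B ψ g a * nakayamaMap B ψ g b :=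
    fun a b => Ψ.injective <| by
      rw [← hΨone, ← one_mul (nakayamaMap B ψ g a), ← hΨ, MulOpposite.op_one, ← hΨone,
        extRightMul_extRightMul]
      simp
  have hone : nakayamaMap B ψ g 1 = 1 := Ψ.injective <| by
    have h1 := hΨmul 1 1
    rw [mul_one] at h1
    exact (hΨone 1).symm.trans h1
  let μ : A ≃ₐ[k] A := AlgEquiv.ofBijective (AlgHom.ofLinearMap (nakayamaMap B ψ g) hone hmul)
    (B.nakayamaMap_bijective ψ g hS)
  refine ⟨ψ, g, μ, fun e a => ?_, hψ', hgl,
    P.isExtCoaction BraidedHopfAlgebra.isHopfModule_trivialModule hf₀ hg hspan, fun _ => rfl,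
    ⟨P.isSmoothAlgebra hP, fun i hi => P.subsingleton_hochschildRegular (hvanish i hi),
      Ψ.symm, fun e a b => ?_⟩⟩
  · obtain ⟨f, hf, rfl⟩ := hsurj e
    obtain ⟨c, hc⟩ := hgen f hf
    have h1 : LinearMap.toSpanSingleton A A a ∘ₗ (c • f₀) =
        c • (LinearMap.toSpanSingleton A A a ∘ₗ f₀) := by
      ext x
      exact smul_mul_assoc c (f₀ x) a
    have h2 := hc.comp (LinearMap.toSpanSingleton A A a)
    rw [h1] at h2
    -- The character was defined on f₀ only; it extends to all classes because each is a scalar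
    -- multiple of that of f₀.
    have h3 : Cohomologous P.complex (LinearMap.toSpanSingleton A A a ∘ₗ f) (ψ a • f) := by
      refine h2.trans (((hψ a).smul c).trans ?_)
      rw [smul_comm]
      exact (hc.smul (ψ a)).symm
    exact (extRightMul_extOf P.toProjectiveResolution hf a).trans
      (((extOf_eq_iff P.toProjectiveResolution (hf.comp _) (hf.smul _)).2 h3).trans
        (extOf_smul P.toProjectiveResolution (ψ a) hf))
  · obtain ⟨ξ, rfl⟩ := Ψ.surjective e
    rw [hΨ, Ψ.symm_apply_apply, Ψ.symm_apply_apply]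
    rfl
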